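/- Graphs are finite, undirected and simple; $t$ ranges over the natural numbers including $0$. $\mathrm{tw}$ denotes treewidth, $G[U]$ the subgraph of $G$ induced by $U$, $G-U=G[V(G)\setminus U]$, and $G-C=G-V(C)$ for a subgraph $C$. A \emph{modulator} of $G$ is a set $X\subseteq V(G)$ with $\mathrm{tw}(G-X)\le 2$. A \emph{solution} for $(G,t)$ is a modulator $S$ of $G$ with $|S|\le t$. A set $X\subseteq V(G)$ is a \emph{limit-$m$ clique} for $(G,t)$ if $G[X]$ is a clique and $|X\setminus S|\le m$ for every solution $S$ for $(G,t)$. The algorithm \textsc{Find-Disjoint-Modulator}$(G,t,X)$ takes a graph $G$, a number $t$ and a modulator $X$ of $G$ such that $G[X]$ is a clique and $0<|X|\le 3$, and works as follows. Let $(T,\chi)$ be a tree decomposition of $G-X$ of width at most $2$ with an arbitrary root; for a node $r$ let $T(r)$ be the subtree of $T$ rooted at $r$, and for a subtree $T'$ write $\chi(T')$ for the union of its bags. Start with $Y=\emptyset$. While $\mathrm{tw}(G[\chi(T)\cup X])>2$, and at most $t+1$ times: let $r$ be a node of $T$ furthest from the root among those with $\mathrm{tw}(G[\chi(T(r))\cup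 X])>2$, add all vertices of $\chi(r)$ to $Y$, and remove the vertices of $\chi(T(r))$ from all bags (keeping the tree $T$). Return $Y$. \textbf{Theorem.} Let $(G,t,X)$ be such an input. For every choice of the width-2 tree decomposition of $G-X$, of its root and of the nodes $r$, the algorithm terminates without getting stuck (a node $r$ exists in each iteration), and the returned set $Y$ satisfies $Y\subseteq V(G)\setminus X$ and $|Y|\le 3t+3$, and moreover \begin{itemize} \item $\mathrm{tw}(G-Y)\le 2$, or \item for every connected component $C$ of $G-(X\cup Y)$, the set $X$ is a limit-$(|X|-1)$ clique for $(G-C,t)$. \end{itemize} Furthermore, the algorithm can be carried out in time polynomial in the size of $G$: there are a program for a random access machine (with unit-cost addition and truncated subtraction on natural numbers, and without multiplication) and a polynomial $p$ such that on every input $(G,t,X)$ with $n=|V(G)|$, $G$ given by its adjacency matrix, the program halts after at most $p(n)$ steps and outputs a set $Y$ that the algorithm returns for some choice of the tree decomposition of $G-X$, of the root and of the nodes $r$. -/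

import Mathlib

namespace TW2

/-! ### Tree decompositions and treewidth -/

/-- `(T, χ)` is a tree decomposition of `G`. -/
structure IsTreeDecomposition {V ι : Type*} (G : SimpleGraph V) (T : SimpleGraph ι)
    (χ : ι → Set V) : Prop where
  isTree : T.IsTree
  cover : ⋃ s, χ s = Set.univ
  edge : ∀ ⦃u v : V⦄, G.Adj u v → ∃ s, u ∈ χ s ∧ v ∈ χ s
  connected : ∀ v : V, (T.induce {s | v ∈ χ s}).Connected

/-- The width of a family of bags: the largest size of a bag, minus one. (If all bags are empty
this is `0` instead of `-1`; the width is only ever compared with `2`.) -/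
noncomputable def width {V ι : Type*} (χ : ι → Set V) : ℕ∞ :=
  (⨆ s, (χ s).encard) - 1

/-- The treewidth of `G`: the least width of a tree decomposition of `G` over a finite tree. -/
noncomputable def treewidth {V : Type*} (G : SimpleGraph V) : ℕ∞ :=
  sInf {w | ∃ (m : ℕ) (T : SimpleGraph (Fin m)) (χ : Fin m → Set V),
    IsTreeDecomposition G T χ ∧ width χ = w}

/-! ### Modulators, solutions, limit subsets and limit cliques -/

/-- `X` is a modulator of `G`: the treewidth of `G - X` is at most two. -/
def IsModulator {V : Type*} (G : SimpleGraph V) (X : Set V) : Prop :=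
  treewidth (G.induce Xᶜ) ≤ 2

/-- `S` is a solution for the problem instance `(G, t)`. -/
def IsSolution {V : Type*} (G : SimpleGraph V) (t : ℕ) (S : Set V) : Prop :=
  IsModulator G S ∧ S.encard ≤ t

/-- `X` is a limit-`m` subset for `(G, t)`. -/
def IsLimitSubset {V : Type*} (G : SimpleGraph V) (t m : ℕ) (X : Set V) : Prop :=
  ∀ S : Set V, IsSolution G t S → (X \ S).encard ≤ m

/-- `X` is a limit-`m` clique for `(G, t)`. -/
def IsLimitClique {V : Type*} (G : SimpleGraph V) (t m : ℕ) (X : Set V) : Prop :=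
  G.IsClique X ∧ IsLimitSubset G t m X

/-- The vertex set, as a set of vertices of `G`, of a component `C` of `G - Z`. -/
def componentVerts {V : Type*} {G : SimpleGraph V} {Z : Set V}
    (C : (G.induce Zᶜ).ConnectedComponent) : Set V :=
  Subtype.val '' C.supp

/-! ### The algorithm Find-Disjoint-Modulator

The algorithm leaves three choices open: the tree decomposition of `G - X`, its root, and, in each
iteration, one of the candidate nodes furthest from the root. It is modelled as a nondeterministic
transition system that allows all of them. -/

/-- The inputs `(G, t, X)` of the algorithm (`t` is an arbitrary natural number): `X` is a
modulator of `G` that induces a clique of size one to three. -/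
structure IsInput {V : Type*} (G : SimpleGraph V) (X : Set V) : Prop where
  modulator : IsModulator G X
  clique : G.IsClique X
  pos : 0 < X.encard
  le_three : X.encard ≤ 3

/-- The nodes of the subtree `T(r)` of the tree `T` with root `ρ`: the node `r` and all its
descendants, i.e. all `u` such that `r` lies on the simple path from `u` to the root. -/
def subtree {ι : Type*} (T : SimpleGraph ι) (ρ r : ι) : Set ι :=
  {u | ∃ p : T.Walk u ρ, p.IsPath ∧ r ∈ p.support}

/-- `χ(U)`: the union of the bags of the nodes in `U`. -/
def bagUnion {V ι : Type*} (χ : ι → Set V) (U : Set ι) : Set V :=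
  ⋃ s ∈ U, χ s

/-- The variables of the algorithm: the number of iterations made, the current bags, and `Y`. -/
structure LoopState (V ι : Type*) where
  count : ℕ
  bag : ι → Set V
  out : Set V

/-- The state before the first iteration, for the bags `χ` of a tree decomposition of `G - X`. -/
def initState {V ι : Type*} {X : Set V} (χ : ι → Set ↥Xᶜ) : LoopState V ι where
  count := 0
  bag s := Subtype.val '' χ s
  out := ∅

/-- The condition of the while-loop: `G[χ(T) ∪ X]` has treewidth more than two, and fewer than
`t + 1` iterations have been made. -/
def Guard {V ι : Type*} (G : SimpleGraph V) (t : ℕ) (X : Set V) (σ : LoopState V ι) : Prop :=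
  2 < treewidth (G.induce (bagUnion σ.bag Set.univ ∪ X)) ∧ σ.count < t + 1

/-- `G[χ(T(r)) ∪ X]` has treewidth more than two. -/
def IsCandidate {V ι : Type*} (G : SimpleGraph V) (X : Set V) (T : SimpleGraph ι) (ρ : ι)
    (σ : LoopState V ι) (r : ι) : Prop :=
  2 < treewidth (G.induce (bagUnion σ.bag (subtree T ρ r) ∪ X))

/-- One iteration of the while-loop: choose a candidate `r` furthest from the root, add its bag to
`Y`, and remove the vertices of `χ(T(r))` from all bags. -/
def Step {V ι : Type*} (G : SimpleGraph V) (t : ℕ) (X : Set V) (T : SimpleGraph ι) (ρ : ι)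
    (σ σ' : LoopState V ι) : Prop :=
  Guard G t X σ ∧ ∃ r : ι, IsCandidate G X T ρ σ r ∧
    (∀ r' : ι, IsCandidate G X T ρ σ r' → T.dist ρ r' ≤ T.dist ρ r) ∧
    σ' = { count := σ.count + 1
           bag := fun s => σ.bag s \ bagUnion σ.bag (subtree T ρ r)
           out := σ.out ∪ σ.bag r }

/-- The state `σ` can occur in a run with the decomposition `(T, χ)` of `G - X` and root `ρ`. -/
def Reachable {V ι : Type*} (G : SimpleGraph V) (t : ℕ) (X : Set V) (T : SimpleGraph ι) (ρ : ι)
    (χ : ι → Set ↥Xᶜ) (σ : LoopState V ι) : Prop :=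
  Relation.ReflTransGen (Step G t X T ρ) (initState χ) σ

/-- Some run with the decomposition `(T, χ)` of `G - X` and root `ρ` ends and returns `Y`. -/
def Returns {V ι : Type*} (G : SimpleGraph V) (t : ℕ) (X : Set V) (T : SimpleGraph ι) (ρ : ι)
    (χ : ι → Set ↥Xᶜ) (Y : Set V) : Prop :=
  ∃ σ : LoopState V ι, Reachable G t X T ρ χ σ ∧ ¬ Guard G t X σ ∧ σ.out = Y

/-! ### Running time: random access machines with a step count

Structured programs on a random access machine with registers and (finitely many, as a program is
finite) two-dimensional arrays that hold natural numbers. The arithmetic is addition and truncated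
subtraction, at unit cost. There is no multiplication, so a number computed in `k` steps is at most
`2 ^ k` times the largest number in the input or the program, and the model is polynomially
equivalent to Turing machines. -/

/-- The memory of the machine. -/
structure Memory where
  reg : ℕ → ℕ
  cell : ℕ → ℕ → ℕ → ℕ

/-- Expressions: constants, registers, entries `a[i, j]` of array number `a`, sums, differences. -/
inductive Expr where
  | const (k : ℕ)
  | reg (x : ℕ)
  | cell (a : ℕ) (i j : Expr)
  | add (e f : Expr)
  | sub (e f : Expr)

/-- The value of an expression. -/
def Expr.eval (μ : Memory) : Expr → ℕ
  | .const k => k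
  | .reg x => μ.reg x
  | .cell a i j => μ.cell a (i.eval μ) (j.eval μ)
  | .add e f => e.eval μ + f.eval μ
  | .sub e f => e.eval μ - f.eval μ

/-- The number of steps that the evaluation of an expression takes. -/
def Expr.cost : Expr → ℕ
  | .const _ => 1
  | .reg _ => 1
  | .cell _ i j => i.cost + j.cost + 1
  | .add e f => e.cost + f.cost + 1
  | .sub e f => e.cost + f.cost + 1

/-- Programs. A test succeeds when the value of its expression is not zero. -/
inductive Prog where
  | skip
  | setReg (x : ℕ) (e : Expr)
  | setCell (a : ℕ) (i j e : Expr)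
  | seq (c d : Prog)
  | ite (e : Expr) (c d : Prog)
  | loop (e : Expr) (c : Prog)

/-- The memory after the assignment of `v` to register `x`. -/
def Memory.setReg (μ : Memory) (x v : ℕ) : Memory :=
  { μ with reg := fun y => if y = x then v else μ.reg y }

/-- The memory after the assignment of `v` to the entry `a[i, j]`. -/
def Memory.setCell (μ : Memory) (a i j v : ℕ) : Memory :=
  { μ with cell := fun b k l => if b = a ∧ k = i ∧ l = j then v else μ.cell b k l }

/-- `Runs c μ k μ'`: started with memory `μ`, the program `c` halts after exactly `k` steps, with
memory `μ'`. -/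
inductive Runs : Prog → Memory → ℕ → Memory → Prop where
  | skip (μ : Memory) : Runs .skip μ 1 μ
  | setReg (x : ℕ) (e : Expr) (μ : Memory) :
      Runs (.setReg x e) μ (e.cost + 1) (μ.setReg x (e.eval μ))
  | setCell (a : ℕ) (i j e : Expr) (μ : Memory) :
      Runs (.setCell a i j e) μ (i.cost + j.cost + e.cost + 1)
        (μ.setCell a (i.eval μ) (j.eval μ) (e.eval μ))
  | seq {c d : Prog} {μ μ' μ'' : Memory} {k l : ℕ} :
      Runs c μ k μ' → Runs d μ' l μ'' → Runs (.seq c d) μ (k + l + 1) μ''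
  | ite_true {e : Expr} {c d : Prog} {μ μ' : Memory} {k : ℕ} :
      e.eval μ ≠ 0 → Runs c μ k μ' → Runs (.ite e c d) μ (e.cost + k + 1) μ'
  | ite_false {e : Expr} {c d : Prog} {μ μ' : Memory} {k : ℕ} :
      e.eval μ = 0 → Runs d μ k μ' → Runs (.ite e c d) μ (e.cost + k + 1) μ'
  | loop_true {e : Expr} {c : Prog} {μ μ' μ'' : Memory} {k l : ℕ} :
      e.eval μ ≠ 0 → Runs c μ k μ' → Runs (.loop e c) μ' l μ'' →
      Runs (.loop e c) μ (e.cost + k + l + 1) μ''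
  | loop_false {e : Expr} {c : Prog} {μ : Memory} :
      e.eval μ = 0 → Runs (.loop e c) μ (e.cost + 1) μ

open Classical in
/-- The memory that holds the input `(G, t, X)`, for a graph `G` on the vertices `0, …, n - 1`:
register `0` holds `n`, register `1` holds `t`, array `0` is the adjacency matrix of `G`, column `0`
of array `1` is the indicator of `X`, and everything else is zero. -/
noncomputable def inputMemory {n : ℕ} (G : SimpleGraph (Fin n)) (t : ℕ) (X : Set (Fin n)) :
    Memory where
  reg x := if x = 0 then n else if x = 1 then t else 0
  cell a i j :=
    if a = 0 ∧ (∃ u v : Fin n, u.val = i ∧ v.val = j ∧ G.Adj u v) then 1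
    else if a = 1 ∧ j = 0 ∧ (∃ u : Fin n, u.val = i ∧ u ∈ X) then 1
    else 0

/-- The set of vertices that the machine outputs: column `0` of array `2` is its indicator. -/
def outputSet (n : ℕ) (μ : Memory) : Set (Fin n) :=
  {v | μ.cell 2 v.val 0 ≠ 0}

end TW2

/-! Both halves rest on one characterisation, `reducible_iff_twTwo`: a finite graph has treewidth at
most two iff it can be emptied by repeatedly eliminating a vertex of degree at most two and joining
its neighbours. It gives gluing along a clique (`Reducible.union`), and it gives a polynomial test,
because any vertex of degree at most two may be eliminated first (`Reducible.fill_iff`).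

Correctness. Let W_i be the set χ(T(r)) removed in iteration i and U the set of vertices still in
bags. The nodes whose bags contain a given vertex are connected in T, so no edge of G - (X ∪ Y)
leaves W_i or U. Since r is deepest, its children are not candidates; the parts of W_i \ χ(r) below
the different children are not joined by edges and glue along X. Hence G - (U ∪ Y) has treewidth at
most two throughout (`Invariant.step`). If at the end G[U ∪ X] has treewidth at most two, a last
gluing along X gives tw(G - Y) ≤ 2. Otherwise t + 1 iterations were made, and W_0, …, W_t, U are t +
2 disjoint sets, each of which induces together with X a graph of treewidth more than two. A
component C of G - (X ∪ Y) meets at most one of them and a solution S for G - C at most t. If S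
missed X, a set that avoids both C and S would, together with X, lie in G - C - S, which is
impossible. So S meets X (`Invariant.isLimitClique`).

Running time. Eliminating G - X and recording each closed neighbourhood at its elimination yields
the bags of a tree decomposition, rooted at a vertex of X with empty bag
(`ElimInvariant.exists_isTreeDecompositionOn`). Candidates are found by the same elimination. Every
iteration removes a vertex, so n rounds suffice however large t is (`Reachable.count_add_ncard_le`).
The program is written in a language in which every loop runs over 0, …, n - 1; compiling it gives a
polynomial bound by structural induction (`BProg.transforms_compile`). -/

namespace TW2

/-! ### Rooted trees given by a parent function -/

/-- `T` is the tree with root `ρ` in which `par` sends every node other than the root to its parent,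
and `dep` is the depth. -/
structure Rooted {ι : Type*} (T : SimpleGraph ι) (ρ : ι) (par : ι → ι) (dep : ι → ℕ) : Prop where
  adj : ∀ i j, T.Adj i j ↔ (i ≠ ρ ∧ par i = j) ∨ (j ≠ ρ ∧ par j = i)
  par_root : par ρ = ρ
  dep_root : dep ρ = 0
  dep_par : ∀ i, i ≠ ρ → dep i = dep (par i) + 1

section Rooted
variable {ι : Type*} {T : SimpleGraph ι} {ρ : ι} {par : ι → ι} {dep : ι → ℕ}

/-- The parent is the neighbour closer to the root. It exists as the second node of a shortest walk,
and it is unique because two such neighbours would give two paths to the root. -/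
theorem exists_rooted_of_isTree (hT : T.IsTree) (ρ : ι) :
    ∃ par : ι → ι, Rooted T ρ par (T.dist ρ) := by
  classical
  have key : ∀ i j j', T.Adj i j → T.Adj i j' → T.dist ρ i = T.dist ρ j + 1 →
      T.dist ρ i = T.dist ρ j' + 1 → j = j' := by
    intro i j j' h h' hd hd'
    obtain ⟨q, hq⟩ := hT.connected.exists_walk_length_eq_dist j ρ
    obtain ⟨q', hq'⟩ := hT.connected.exists_walk_length_eq_dist j' ρ
    have p1 : (SimpleGraph.Walk.cons h q).IsPath := by
      apply SimpleGraph.Walk.isPath_of_length_eq_dist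
      rw [SimpleGraph.Walk.length_cons, hq, T.dist_comm, ← hd, T.dist_comm]
    have p2 : (SimpleGraph.Walk.cons h' q').IsPath := by
      apply SimpleGraph.Walk.isPath_of_length_eq_dist
      rw [SimpleGraph.Walk.length_cons, hq', T.dist_comm, ← hd', T.dist_comm]
    have := (hT.existsUnique_path i ρ).unique p1 p2
    simpa using congrArg (fun w => SimpleGraph.Walk.snd w) this
  have ex : ∀ i, i ≠ ρ → ∃ j, T.Adj i j ∧ T.dist ρ i = T.dist ρ j + 1 := by
    intro i hi
    obtain ⟨q, hq⟩ := hT.connected.exists_walk_length_eq_dist i ρ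
    cases q with
    | nil => exact absurd rfl hi
    | @cons _ j _ h q =>
      refine ⟨j, h, ?_⟩
      rw [SimpleGraph.Walk.length_cons] at hq
      have h1 := T.dist_le q
      have h2 := hT.dist_eq_dist_add_one_of_adj ρ h
      rw [T.dist_comm] at h1 hq
      omega
  choose! f hf hf' using ex
  refine ⟨fun i => if i = ρ then ρ else f i, ?_, by simp, by simp, ?_⟩
  · intro i j
    constructor
    · intro h
      rcases hT.dist_eq_dist_add_one_of_adj ρ h with hd | hd
      · have hi : i ≠ ρ := by rintro rfl; simp at hd
        left
        refine ⟨hi, ?_⟩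
        simp only [hi, if_false]
        exact key i _ _ (hf i hi) h (hf' i hi) hd
      · have hi : j ≠ ρ := by rintro rfl; simp at hd
        right
        refine ⟨hi, ?_⟩
        simp only [hi, if_false]
        exact key j _ _ (hf j hi) h.symm (hf' j hi) hd
    · rintro (⟨hi, rfl⟩ | ⟨hi, rfl⟩)
      · simpa [hi] using hf i hi
      · simpa [hi] using (hf j hi).symm
  · intro i hi
    simpa [hi] using hf' i hi

namespace Rooted

theorem ne_root_of_dep (h : Rooted T ρ par dep) {i : ι} (hi : 0 < dep i) : i ≠ ρ := by
  rintro rfl; rw [h.dep_root] at hi; exact lt_irrefl _ hi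

theorem adj_par (h : Rooted T ρ par dep) {i : ι} (hi : i ≠ ρ) : T.Adj i (par i) :=
  (h.adj _ _).2 (Or.inl ⟨hi, rfl⟩)

theorem induction (h : Rooted T ρ par dep) {P : ι → Prop} (root : P ρ)
    (step : ∀ i, i ≠ ρ → P (par i) → P i) (i : ι) : P i := by
  induction hd : dep i generalizing i with
  | zero =>
    by_cases hi : i = ρ
    · rwa [hi]
    · have := h.dep_par i hi; omega
  | succ k ih =>
    have hi := h.ne_root_of_dep (i := i) (by omega)
    exact step i hi (ih _ (by have := h.dep_par i hi; omega))

theorem connected (h : Rooted T ρ par dep) : T.Connected := by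
  have : ∀ i, T.Reachable i ρ := h.induction (SimpleGraph.Reachable.refl _)
    fun i hi hr => (h.adj_par hi).reachable.trans hr
  have hne : Nonempty ι := ⟨ρ⟩
  exact ⟨fun i j => (this i).trans (this j).symm⟩

/-- Every edge joins a node other than the root to its parent, so there are at most as many edges as
such nodes; a connected graph with so few edges is a tree. -/
theorem isTree [Finite ι] (h : Rooted T ρ par dep) : T.IsTree := by
  classical
  rw [SimpleGraph.isTree_iff_connected_and_card]
  refine ⟨h.connected, le_antisymm ?_ h.connected.card_vert_le_card_edgeSet_add_one⟩
  have hsub : T.edgeSet ⊆ (fun i => s(i, par i)) '' {i | i ≠ ρ} := by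
    intro e
    induction e with
    | _ i j =>
      rw [SimpleGraph.mem_edgeSet, h.adj]
      rintro (⟨hi, rfl⟩ | ⟨hi, rfl⟩)
      · exact ⟨i, hi, rfl⟩
      · exact ⟨j, hi, Sym2.eq_swap⟩
  have h1 := Set.ncard_le_ncard hsub (Set.toFinite _)
  have h2 := Set.ncard_image_le (f := fun i => s(i, par i)) (Set.toFinite {i | i ≠ ρ})
  have h3 : {i | i ≠ ρ}.ncard + 1 = Nat.card ι := by
    have := Set.ncard_add_ncard_compl ({ρ} : Set ι)
    rw [Set.ncard_singleton] at this
    rw [← this, add_comm]; rfl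
  rw [Nat.card_coe_set_eq]
  omega

theorem dep_par_le (h : Rooted T ρ par dep) (i : ι) : dep (par i) ≤ dep i := by
  by_cases hi : i = ρ
  · rw [hi, h.par_root]
  · rw [h.dep_par i hi]; omega

/-- `r` is a weak ancestor of `u`. -/
def Anc (par : ι → ι) (u r : ι) : Prop := ∃ k : ℕ, par^[k] u = r

theorem anc_refl (par : ι → ι) (u : ι) : Anc par u u := ⟨0, rfl⟩

theorem anc_par {u r : ι} (h : Anc par (par u) r) : Anc par u r := by
  obtain ⟨k, hk⟩ := h
  exact ⟨k + 1, hk⟩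

theorem anc_iff {u r : ι} : Anc par u r ↔ u = r ∨ Anc par (par u) r := by
  constructor
  · rintro ⟨k, hk⟩
    cases k with
    | zero => exact Or.inl hk
    | succ k => exact Or.inr ⟨k, hk⟩
  · rintro (rfl | h)
    · exact anc_refl _ _
    · exact anc_par h

theorem anc_root (h : Rooted T ρ par dep) (u : ι) : Anc par u ρ :=
  h.induction (P := fun u => Anc par u ρ) (anc_refl _ _) (fun _ _ hr => anc_par hr) u

theorem anc_root_left (h : Rooted T ρ par dep) {r : ι} : Anc par ρ r ↔ r = ρ := by
  constructor
  · rintro ⟨k, rfl⟩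
    exact Function.iterate_fixed h.par_root k
  · rintro rfl; exact anc_refl _ _

theorem dep_le_of_anc (h : Rooted T ρ par dep) {u r : ι} (hr : Anc par u r) : dep r ≤ dep u := by
  obtain ⟨k, rfl⟩ := hr
  induction k with
  | zero => exact le_rfl
  | succ k ih =>
    rw [Function.iterate_succ_apply']
    exact (h.dep_par_le _).trans ih

theorem eq_of_anc_of_dep_le (h : Rooted T ρ par dep) {u r : ι} (hr : Anc par u r)
    (hd : dep u ≤ dep r) : u = r := by
  rcases anc_iff.1 hr with e | hr'
  · exact e
  · by_cases hu : u = ρ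
    · subst hu; exact (h.anc_root_left.1 hr).symm
    · have := h.dep_le_of_anc hr'
      have := h.dep_par u hu
      omega

theorem exists_path (h : Rooted T ρ par dep) (u : ι) :
    ∃ p : T.Walk u ρ, p.IsPath ∧ p.length = dep u ∧ ∀ r, r ∈ p.support ↔ Anc par u r := by
  refine h.induction (P := fun u => ∃ p : T.Walk u ρ, p.IsPath ∧ p.length = dep u ∧
    ∀ r, r ∈ p.support ↔ Anc par u r) ?_ ?_ u
  · refine ⟨SimpleGraph.Walk.nil, by simp, by simp [h.dep_root], fun r => ?_⟩
    rw [h.anc_root_left]; simp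
  · rintro i hi ⟨p, hp, hl, hs⟩
    refine ⟨SimpleGraph.Walk.cons (h.adj_par hi) p, ?_, ?_, fun r => ?_⟩
    · rw [SimpleGraph.Walk.cons_isPath_iff]
      refine ⟨hp, fun hm => ?_⟩
      have := h.dep_le_of_anc ((hs i).1 hm)
      have := h.dep_par i hi
      omega
    · rw [SimpleGraph.Walk.length_cons, hl, h.dep_par i hi]
    · rw [SimpleGraph.Walk.support_cons, List.mem_cons, hs, anc_iff (u := i), eq_comm]

theorem mem_subtree (h : Rooted T ρ par dep) (hT : T.IsTree) {u r : ι} :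
    u ∈ subtree T ρ r ↔ Anc par u r := by
  obtain ⟨p, hp, _, hs⟩ := h.exists_path u
  constructor
  · rintro ⟨q, hq, hr⟩
    rw [(hT.existsUnique_path u ρ).unique hq hp] at hr
    exact (hs r).1 hr
  · intro hr
    exact ⟨p, hp, (hs r).2 hr⟩

theorem dist_eq (h : Rooted T ρ par dep) (hT : T.IsTree) (u : ι) : T.dist ρ u = dep u := by
  obtain ⟨p, hp, hl, _⟩ := h.exists_path u
  obtain ⟨q, hq, hql⟩ := hT.connected.exists_path_of_dist u ρ
  rw [← hl, T.dist_comm, ← hql, (hT.existsUnique_path u ρ).unique hq hp]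

/-- A connected set that meets the subtree at `c` and its complement contains `c` and its parent. -/
theorem mem_of_connected (h : Rooted T ρ par dep) {S : Set ι} (hS : (T.induce S).Connected)
    {c s s' : ι} (hs : s ∈ S) (hs' : s' ∈ S) (hc : Anc par s c) (hc' : ¬ Anc par s' c) :
    c ∈ S ∧ par c ∈ S := by
  by_contra hcon
  -- The edge from `c` to its parent is the only one that leaves the subtree at `c`; if `S` lacks
  -- one of its ends, no walk in `S` gets out.
  have key : ∀ x y : S, (T.induce S).Adj x y → Anc par x.1 c → Anc par y.1 c := by
    rintro ⟨x, hx⟩ ⟨y, hy⟩ hxy hxc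
    rw [SimpleGraph.comap_adj] at hxy
    rcases (h.adj _ _).1 hxy with ⟨_, e⟩ | ⟨_, e⟩
    · rcases anc_iff.1 hxc with e' | h'
      · dsimp at e e' 
        subst e' 
        exact absurd ⟨hx, by rw [e]; exact hy⟩ hcon
      · dsimp at e h'
        rwa [e] at h'
    · exact anc_par (by dsimp at e ⊢; rwa [e])
  obtain ⟨w⟩ := hS.preconnected ⟨s, hs⟩ ⟨s', hs'⟩
  have : ∀ x y : S, (T.induce S).Walk x y → Anc par x.1 c → Anc par y.1 c := by
    intro x y w
    induction w with
    | nil => exact id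
    | cons hxy _ ih => exact fun hx => ih (key _ _ hxy hx)
  exact hc' (this _ _ w hc)

/-- Take `τ` of least depth in `S`. For any other `s` in `S`, the node `τ` is not below `s`, so
connectedness forces the parent of `s` into `S`. -/
theorem exists_top (h : Rooted T ρ par dep) {S : Set ι} (hS : (T.induce S).Connected) :
    ∃ τ ∈ S, ∀ s ∈ S, Anc par s τ ∧ (s ≠ τ → s ≠ ρ ∧ par s ∈ S) := by
  obtain ⟨⟨x, hx⟩⟩ := hS.nonempty
  have hex : ∃ d, ∃ s ∈ S, dep s = d := ⟨_, x, hx, rfl⟩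
  classical
  obtain ⟨τ, hτ, hd⟩ := Nat.find_spec hex
  have hmin : ∀ s ∈ S, dep τ ≤ dep s := fun s hs => by
    rw [hd]; exact Nat.find_min' hex ⟨s, hs, rfl⟩
  have hcl : ∀ s ∈ S, s ≠ τ → s ≠ ρ ∧ par s ∈ S := by
    intro s hs hne
    have hna : ¬ Anc par τ s := fun ha => hne (h.eq_of_anc_of_dep_le ha (hmin s hs)).symm
    refine ⟨fun e => hna (by rw [e]; exact h.anc_root τ), ?_⟩
    exact (h.mem_of_connected hS hs hτ (anc_refl _ _) hna).2
  refine ⟨τ, hτ, fun s hs => ⟨?_, hcl s hs⟩⟩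
  by_contra hna
  -- If `s` were not below `τ`, its whole way up would stay in `S` without meeting `τ`, and would
  -- end at the root, which has no parent to continue with.
  have : ∀ k, par^[k] s ∈ S ∧ ¬ Anc par (par^[k] s) τ := by
    intro k
    induction k with
    | zero => exact ⟨hs, hna⟩
    | succ k ih =>
      rw [Function.iterate_succ_apply']
      exact ⟨(hcl _ ih.1 (fun e => ih.2 (e ▸ anc_refl _ _))).2, fun ha => ih.2 (anc_par ha)⟩
  obtain ⟨k, hk⟩ := h.anc_root s
  have h1 := this k
  rw [hk] at h1
  exact (hcl ρ h1.1 (fun e => h1.2 (e ▸ anc_refl _ _))).1 rfl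

/-- Converse of `exists_top`: connectedness of the nodes of a vertex becomes a local condition on
parents, which is easy to check for the trees built below. -/
theorem connected_of_top (h : Rooted T ρ par dep) {S : Set ι} {τ : ι} (hτ : τ ∈ S)
    (hcl : ∀ s ∈ S, s ≠ τ → s ≠ ρ ∧ par s ∈ S) : (T.induce S).Connected := by
  have : ∀ n, ∀ s (hs : s ∈ S), dep s = n → (T.induce S).Reachable ⟨s, hs⟩ ⟨τ, hτ⟩ := by
    intro n
    induction n with
    | zero =>
      intro s hs hd
      by_cases e : s = τ
      · subst e; exact SimpleGraph.Reachable.refl _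
      · have := h.dep_par s (hcl s hs e).1; omega
    | succ n ih =>
      intro s hs hd
      by_cases e : s = τ
      · subst e; exact SimpleGraph.Reachable.refl _
      · obtain ⟨h1, h2⟩ := hcl s hs e
        have hadj : (T.induce S).Adj ⟨s, hs⟩ ⟨par s, h2⟩ := h.adj_par h1
        exact hadj.reachable.trans (ih _ h2 (by have := h.dep_par s h1; omega))
  have hne : Nonempty S := ⟨⟨τ, hτ⟩⟩
  exact ⟨fun a b => (this _ a.1 a.2 rfl).trans (this _ b.1 b.2 rfl).symm⟩

end Rooted
end Rooted

/-- The tree with root `ρ` and parent function `par`. -/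
def parentTree {ι : Type*} (ρ : ι) (par : ι → ι) : SimpleGraph ι where
  Adj i j := i ≠ j ∧ ((i ≠ ρ ∧ par i = j) ∨ (j ≠ ρ ∧ par j = i))
  symm := ⟨fun _ _ h => ⟨h.1.symm, h.2.symm⟩⟩
  loopless := ⟨fun _ h => h.1 rfl⟩

theorem rooted_parentTree {ι : Type*} {ρ : ι} {par : ι → ι} {dep : ι → ℕ} (h1 : par ρ = ρ)
    (h2 : dep ρ = 0) (h3 : ∀ i, i ≠ ρ → dep i = dep (par i) + 1) :
    Rooted (parentTree ρ par) ρ par dep where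
  adj i j := by
    refine ⟨fun h => h.2, fun h => ⟨?_, h⟩⟩
    rintro rfl
    rcases h with ⟨hi, e⟩ | ⟨hi, e⟩ <;>
    · have := h3 i hi
      rw [e] at this
      omega
  par_root := h1
  dep_root := h2
  dep_par := h3

/-! ### Tree decompositions of width two of induced subgraphs -/

/-- `(T, χ)` is a tree decomposition of width at most two of `G[A]`, with bags given as sets of
vertices of `G`. -/
structure IsTreeDecompositionOn {V ι : Type*} (G : SimpleGraph V) (A : Set V) (T : SimpleGraph ι)
    (χ : ι → Set V) : Prop where
  isTree : T.IsTree
  sub : ∀ s, χ s ⊆ A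
  card : ∀ s, (χ s).encard ≤ 3
  edge : ∀ u ∈ A, ∀ v ∈ A, G.Adj u v → ∃ s, u ∈ χ s ∧ v ∈ χ s
  connected : ∀ v ∈ A, (T.induce {s | v ∈ χ s}).Connected

/-- `G[A]` has treewidth at most two. -/
def TWTwo {V : Type*} (G : SimpleGraph V) (A : Set V) : Prop :=
  ∃ (m : ℕ) (T : SimpleGraph (Fin m)) (χ : Fin m → Set V), IsTreeDecompositionOn G A T χ

theorem IsTreeDecompositionOn.twTwo {V ι : Type*} [Finite ι] {G : SimpleGraph V} {A : Set V}
    {T : SimpleGraph ι} {χ : ι → Set V} (h : IsTreeDecompositionOn G A T χ) : TWTwo G A := by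
  obtain ⟨m, ⟨e⟩⟩ := Finite.exists_equiv_fin ι
  refine ⟨m, T.comap e.symm, fun s => χ (e.symm s), ?_, fun s => h.sub _, fun s => h.card _, ?_, ?_⟩
  · exact (SimpleGraph.Iso.isTree_iff (SimpleGraph.Iso.comap e.symm T)).2 h.isTree
  · intro u hu v hv huv
    obtain ⟨s, hs⟩ := h.edge u hu v hv huv
    exact ⟨e s, by simpa using hs⟩
  · intro v hv
    have iso : (T.comap e.symm).induce {s | v ∈ χ (e.symm s)} ≃g T.induce {s | v ∈ χ s} :=
      { toEquiv := Equiv.subtypeEquiv e.symm (fun _ => Iff.rfl)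
        map_rel_iff' := Iff.rfl }
    exact iso.connected_iff.2 (h.connected v hv)

theorem width_le_two_iff {V ι : Type*} {χ : ι → Set V} :
    width χ ≤ 2 ↔ ∀ s, (χ s).encard ≤ 3 := by
  unfold width
  rw [tsub_le_iff_right, iSup_le_iff]
  norm_num

theorem IsTreeDecomposition.isTreeDecompositionOn {V ι : Type*} {G : SimpleGraph V}
    {T : SimpleGraph ι} {χ : ι → Set V} (h : IsTreeDecomposition G T χ) (hw : width χ ≤ 2) :
    IsTreeDecompositionOn G Set.univ T χ :=
  ⟨h.isTree, fun _ => Set.subset_univ _, width_le_two_iff.1 hw, fun _ _ _ _ huv => h.edge huv,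
    fun v _ => h.connected v⟩

theorem IsTreeDecompositionOn.isTreeDecomposition {V ι : Type*} {G : SimpleGraph V}
    {T : SimpleGraph ι} {χ : ι → Set V} (h : IsTreeDecompositionOn G Set.univ T χ) :
    IsTreeDecomposition G T χ ∧ width χ ≤ 2 := by
  refine ⟨⟨h.isTree, ?_, fun u v huv => h.edge u trivial v trivial huv,
    fun v => h.connected v trivial⟩, width_le_two_iff.2 h.card⟩
  rw [Set.eq_univ_iff_forall]
  intro v
  obtain ⟨⟨s, hs⟩⟩ := (h.connected v trivial).nonempty
  exact Set.mem_iUnion.2 ⟨s, hs⟩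

theorem treewidth_le_two_iff_univ {V : Type*} {G : SimpleGraph V} :
    treewidth G ≤ 2 ↔ TWTwo G Set.univ := by
  constructor
  · intro h
    unfold treewidth at h
    -- An empty set of widths would have infimum `⊤`; a nonempty one attains its infimum.
    have hne : {w | ∃ (m : ℕ) (T : SimpleGraph (Fin m)) (χ : Fin m → Set V),
        IsTreeDecomposition G T χ ∧ width χ = w}.Nonempty := by
      by_contra hne
      rw [Set.not_nonempty_iff_eq_empty] at hne
      rw [hne, sInf_empty] at h
      simp at h
    obtain ⟨m, T, χ, h1, h2⟩ := csInf_mem hne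
    exact ⟨m, T, χ, h1.isTreeDecompositionOn (h2.trans_le h)⟩
  · rintro ⟨m, T, χ, h⟩
    have hmem : width χ ∈ {w | ∃ (m : ℕ) (T : SimpleGraph (Fin m)) (χ : Fin m → Set V),
        IsTreeDecomposition G T χ ∧ width χ = w} := ⟨m, T, χ, h.isTreeDecomposition.1, rfl⟩
    exact (sInf_le hmem).trans h.isTreeDecomposition.2

/-- Preimages of bags under a map that is injective on `A` are no larger, and a vertex of `A`
occupies the same nodes as its image. This covers both subgraphs and the passage between a subtype
and the ambient vertex set. -/
theorem IsTreeDecompositionOn.comap {V W ι : Type*} {G : SimpleGraph V} {H : SimpleGraph W}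
    {A : Set V} {B : Set W} {T : SimpleGraph ι} {χ : ι → Set W}
    (f : V → W) (hAB : ∀ v ∈ A, f v ∈ B) (hf : Set.InjOn f A)
    (hadj : ∀ u ∈ A, ∀ v ∈ A, G.Adj u v → H.Adj (f u) (f v)) (h : IsTreeDecompositionOn H B T χ) :
    IsTreeDecompositionOn G A T (fun s => A ∩ f ⁻¹' χ s) := by
  refine ⟨h.isTree, fun s => Set.inter_subset_left, fun s => ?_,
    fun u hu v hv huv => ?_, fun v hv => ?_⟩
  · refine le_trans ?_ (h.card s)
    rw [← (hf.mono Set.inter_subset_left).encard_image]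
    apply Set.encard_le_encard
    rintro _ ⟨x, hx, rfl⟩
    exact hx.2
  · obtain ⟨s, h1, h2⟩ := h.edge _ (hAB u hu) _ (hAB v hv) (hadj u hu v hv huv)
    exact ⟨s, ⟨hu, h1⟩, ⟨hv, h2⟩⟩
  · have e : {s | v ∈ A ∩ f ⁻¹' χ s} = {s | f v ∈ χ s} := by ext s; simp [hv]
    rw [e]
    exact h.connected _ (hAB v hv)

theorem TWTwo.comap {V W : Type*} {G : SimpleGraph V} {H : SimpleGraph W} {A : Set V} {B : Set W}
    (f : V → W) (hAB : ∀ v ∈ A, f v ∈ B) (hf : Set.InjOn f A)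
    (hadj : ∀ u ∈ A, ∀ v ∈ A, G.Adj u v → H.Adj (f u) (f v)) (h : TWTwo H B) : TWTwo G A := by
  obtain ⟨m, T, χ, h⟩ := h
  exact ⟨m, T, _, h.comap f hAB hf hadj⟩

theorem TWTwo.mono {V : Type*} {G G' : SimpleGraph V} {A B : Set V} (hAB : A ⊆ B)
    (hadj : ∀ u ∈ A, ∀ v ∈ A, G.Adj u v → G'.Adj u v) (h : TWTwo G' B) : TWTwo G A :=
  h.comap id hAB (Set.injOn_id _) hadj

theorem TWTwo.image_val {V : Type*} {G : SimpleGraph V} {A : Set V} {B : Set A}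
    (h : TWTwo (G.induce A) B) : TWTwo G (Subtype.val '' B) := by
  obtain ⟨m, T, χ, h⟩ := h
  refine ⟨m, T, fun s => Subtype.val '' χ s, h.isTree, fun s => Set.image_mono (h.sub s),
    fun s => ?_, ?_, ?_⟩
  · rw [Subtype.val_injective.encard_image]; exact h.card s
  · rintro _ ⟨u, hu, rfl⟩ _ ⟨v, hv, rfl⟩ huv
    obtain ⟨s, h1, h2⟩ := h.edge u hu v hv huv
    exact ⟨s, ⟨u, h1, rfl⟩, ⟨v, h2, rfl⟩⟩
  · rintro _ ⟨v, hv, rfl⟩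
    have e : {s | (v : V) ∈ Subtype.val '' χ s} = {s | v ∈ χ s} := by
      ext s; simp
    rw [e]
    exact h.connected v hv

theorem treewidth_induce_le_two_iff {V : Type*} {G : SimpleGraph V} {A : Set V} :
    treewidth (G.induce A) ≤ 2 ↔ TWTwo G A := by
  rw [treewidth_le_two_iff_univ]
  constructor
  · intro h
    have := h.image_val
    rwa [Set.image_univ, Subtype.range_val] at this
  · intro h
    exact h.comap Subtype.val (fun v _ => v.2) Subtype.val_injective.injOn (fun _ _ _ _ h => h)

/-! ### Eliminating vertices of degree at most two -/

section Elimination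
variable {V : Type*}

/-- The neighbours of `v` in `G[A]`. -/
def nbrs (G : SimpleGraph V) (A : Set V) (v : V) : Set V := {u | u ∈ A ∧ G.Adj v u}

/-- The graph `G` with the neighbours of `v` in `G[A]` made into a clique. -/
def fill (G : SimpleGraph V) (A : Set V) (v : V) : SimpleGraph V where
  Adj x y := x ≠ y ∧ (G.Adj x y ∨ (x ∈ nbrs G A v ∧ y ∈ nbrs G A v))
  symm := ⟨fun _ _ h => ⟨h.1.symm, h.2.imp (fun h => h.symm) And.symm⟩⟩
  loopless := ⟨fun _ h => h.1 rfl⟩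

theorem le_fill {G : SimpleGraph V} {A : Set V} {v x y : V} (h : G.Adj x y) :
    (fill G A v).Adj x y := ⟨h.ne, Or.inl h⟩

/-- `G[A]` can be reduced to the empty graph by eliminating vertices of degree at most two. -/
inductive Reducible : SimpleGraph V → Set V → Prop where
  | empty (G : SimpleGraph V) : Reducible G ∅
  | step {G : SimpleGraph V} {A : Set V} {v : V} : v ∈ A → (nbrs G A v).encard ≤ 2 →
      Reducible (fill G A v) (A \ {v}) → Reducible G A

theorem encard_le_two_cases {N : Set V} (h : N.encard ≤ 2) :
    N = ∅ ∨ (∃ a, N = {a}) ∨ ∃ a b, a ≠ b ∧ N = {a, b} := by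
  have : N.encard = 0 ∨ N.encard = 1 ∨ N.encard = 2 := by
    generalize N.encard = k at h
    cases k with
    | top => simp at h
    | coe k =>
      have : k ≤ 2 := by exact_mod_cast h
      interval_cases k <;> simp
  rcases this with h | h | h
  · exact Or.inl (Set.encard_eq_zero.1 h)
  · exact Or.inr (Or.inl (Set.encard_eq_one.1 h))
  · exact Or.inr (Or.inr (Set.encard_eq_two.1 h))

theorem notMem_nbrs {G : SimpleGraph V} {A : Set V} {v : V} : v ∉ nbrs G A v := fun h => h.2.ne rfl

/-- Choose `v` whose top node `τ v` is deepest. A neighbour shares a bag with `v` at some node below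
`τ v`, and its own top is no deeper than `τ v`, so it persists upwards into the bag of `τ v`. That
bag has at most two vertices besides `v`. -/
theorem TWTwo.exists_degree_le_two [Finite V] {G : SimpleGraph V} {A : Set V} (h : TWTwo G A)
    (hA : A.Nonempty) : ∃ v ∈ A, (nbrs G A v).encard ≤ 2 := by
  obtain ⟨m, T, χ, h⟩ := h
  obtain ⟨ρ⟩ := h.isTree.connected.nonempty
  obtain ⟨par, hr⟩ := exists_rooted_of_isTree h.isTree ρ
  have top := fun v (hv : v ∈ A) => hr.exists_top (h.connected v hv)
  have hne : Nonempty (Fin m) := ⟨ρ⟩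
  choose! τ hτ hcl using top
  obtain ⟨v, hv, hmax⟩ := Set.exists_max_image A (fun v => T.dist ρ (τ v)) (Set.toFinite _) hA
  refine ⟨v, hv, ?_⟩
  have hsub : nbrs G A v ⊆ χ (τ v) \ {v} := by
    rintro u ⟨hu, huv⟩
    refine ⟨?_, huv.ne.symm⟩
    obtain ⟨s, hsv, hsu⟩ := h.edge v hv u hu huv
    obtain ⟨k, hk⟩ := (hcl v hv s hsv).1
    clear hsv
    induction k generalizing s with
    | zero => rw [← hk]; exact hsu
    | succ k ih =>
      by_cases e : s = τ u
      -- On the way up the top of `u` is reached only at `τ v` itself, since it is below `τ v` and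
      -- not deeper.
      · have := hr.eq_of_anc_of_dep_le (u := s) (r := τ v) ⟨k + 1, hk⟩ (by rw [e]; exact hmax u hu)
        rw [← this]; exact hsu
      · exact ih (par s) ((hcl u hu s hsu).2 e).2 hk
  refine (Set.encard_le_encard hsub).trans ?_
  have h1 := Set.encard_sdiff_singleton_add_one (show v ∈ χ (τ v) from hτ v hv)
  have h2 := h.card (τ v)
  rw [← h1] at h2
  have : (χ (τ v) \ {v}).encard + 1 ≤ 2 + 1 := by norm_num; exact h2
  exact (ENat.add_le_add_iff_right (by simp)).1 this

/-- Contract `v` into a neighbour `a`: replace `v` by `a` in all bags. With at most two neighbours,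
every new edge has `a` as an end. -/
theorem TWTwo.fill {G : SimpleGraph V} {A : Set V} (h : TWTwo G A) {v : V} (hv : v ∈ A)
    (hN : (nbrs G A v).encard ≤ 2) : TWTwo (fill G A v) (A \ {v}) := by
  classical
  by_cases hne : nbrs G A v = ∅
  · refine h.mono Set.sdiff_subset ?_
    rintro x _ y _ ⟨_, h | h⟩
    · exact h
    · rw [hne] at h; exact absurd h.1 (by simp)
  obtain ⟨a, ha⟩ := Set.nonempty_iff_ne_empty.2 hne
  have hav : a ≠ v := fun e => notMem_nbrs (e ▸ ha)
  obtain ⟨m, T, χ, h⟩ := h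
  have mem_of : ∀ u s, u ≠ v → u ∈ χ s → u ∈ (if v ∈ χ s then insert a (χ s \ {v}) else χ s) := by
    intro u s hu hs
    split_ifs
    · exact Or.inr ⟨hs, hu⟩
    · exact hs
  have new : ∀ y ∈ nbrs G A v, ∃ s, a ∈ (if v ∈ χ s then insert a (χ s \ {v}) else χ s) ∧
      y ∈ (if v ∈ χ s then insert a (χ s \ {v}) else χ s) := by
    intro y hy
    obtain ⟨s, h1, h2⟩ := h.edge v hv y hy.1 hy.2
    refine ⟨s, ?_, mem_of y s (fun e => notMem_nbrs (e ▸ hy)) h2⟩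
    rw [if_pos h1]; exact Or.inl rfl
  refine ⟨m, T, fun s => if v ∈ χ s then insert a (χ s \ {v}) else χ s, h.isTree, ?_, ?_, ?_, ?_⟩
  · intro s
    split_ifs with hs
    · exact Set.insert_subset ⟨ha.1, hav⟩ (Set.sdiff_subset_sdiff_left (h.sub s))
    · exact fun u hu => ⟨h.sub s hu, fun e => hs (e ▸ hu)⟩
  · intro s
    split_ifs with hs
    · refine (Set.encard_insert_le _ _).trans ?_
      rw [Set.encard_sdiff_singleton_add_one hs]
      exact h.card s
    · exact h.card s
  · rintro x ⟨hx, hxv⟩ y ⟨hy, hyv⟩ ⟨hxy, hadj | ⟨h1, h2⟩⟩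
    · obtain ⟨s, h1, h2⟩ := h.edge x hx y hy hadj
      exact ⟨s, mem_of x s hxv h1, mem_of y s hyv h2⟩
    · have hcase : a = x ∨ a = y := by
        by_contra hc
        rw [not_or] at hc
        have h3 : ({a, x, y} : Set V) ⊆ nbrs G A v := by
          rintro z (rfl | rfl | rfl) <;> assumption
        have h4 := (Set.encard_le_encard h3).trans hN
        rw [Set.encard_eq_three.2 ⟨a, x, y, hc.1, hc.2, hxy, rfl⟩] at h4
        exact absurd h4 (by decide)
      rcases hcase with rfl | rfl
      · exact new y h2
      · obtain ⟨s, h3, h4⟩ := new x h1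
        exact ⟨s, h4, h3⟩
  · rintro u ⟨hu, huv⟩
    by_cases hua : u = a
    · subst hua
      -- The nodes of `a` become the union of two connected sets, those of `a` and of `v`, which
      -- meet in a bag for the edge between them.
      have e : {s | u ∈ (if v ∈ χ s then insert u (χ s \ {v}) else χ s)} =
          {s | u ∈ χ s} ∪ {s | v ∈ χ s} := by
        ext s
        simp only [Set.mem_ofPred_eq, Set.mem_union]
        split_ifs with hs <;> simp [hs]
      rw [e]
      obtain ⟨s, h1, h2⟩ := h.edge v hv u hu ha.2
      exact SimpleGraph.induce_union_connected (h.connected u hu).preconnected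
        (h.connected v hv).preconnected ⟨s, h2, h1⟩
    · have e : {s | u ∈ (if v ∈ χ s then insert a (χ s \ {v}) else χ s)} = {s | u ∈ χ s} := by
        ext s
        simp only [Set.mem_ofPred_eq]
        have : u ≠ v := huv
        split_ifs with hs <;> simp [hua, this]
      rw [e]
      exact h.connected u hu

/-- In the filled graph the at most two neighbours of `v` are a clique, hence lie in one bag; a new
leaf attached there (the node `none`) carries `v` and its neighbours. -/
theorem TWTwo.of_fill {G : SimpleGraph V} {A : Set V} {v : V} (hv : v ∈ A)
    (hN : (nbrs G A v).encard ≤ 2) (h : TWTwo (TW2.fill G A v) (A \ {v})) : TWTwo G A := by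
  obtain ⟨m, T, χ, h⟩ := h
  obtain ⟨ρ⟩ := h.isTree.connected.nonempty
  obtain ⟨par, hr⟩ := exists_rooted_of_isTree h.isTree ρ
  have hNsub : ∀ u ∈ nbrs G A v, u ∈ A \ {v} := fun u hu =>
    ⟨hu.1, fun e => notMem_nbrs (e ▸ hu)⟩
  obtain ⟨s₀, hs₀⟩ : ∃ s, nbrs G A v ⊆ χ s := by
    rcases encard_le_two_cases hN with e | ⟨a, e⟩ | ⟨a, b, hab, e⟩
    · exact ⟨ρ, by rw [e]; exact Set.empty_subset _⟩
    · obtain ⟨⟨s, hs⟩⟩ := (h.connected a (hNsub a (by rw [e]; rfl))).nonempty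
      exact ⟨s, by rw [e]; exact Set.singleton_subset_iff.2 hs⟩
    · have ha : a ∈ nbrs G A v := by rw [e]; exact Or.inl rfl
      have hb : b ∈ nbrs G A v := by rw [e]; exact Or.inr rfl
      obtain ⟨s, h1, h2⟩ := h.edge a (hNsub a ha) b (hNsub b hb) ⟨hab, Or.inr ⟨ha, hb⟩⟩
      refine ⟨s, ?_⟩
      rw [e]
      rintro x (rfl | rfl) <;> assumption
  let par' : Option (Fin m) → Option (Fin m) := fun i => i.elim (some s₀) (fun i => some (par i))
  let dep' : Option (Fin m) → ℕ := fun i => i.elim (T.dist ρ s₀ + 1) (T.dist ρ)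
  have hr' : Rooted (parentTree (some ρ) par') (some ρ) par' dep' := by
    apply rooted_parentTree
    · simp [par', hr.par_root]
    · simp [dep']
    · rintro (_ | i) hi
      · rfl
      · exact hr.dep_par i (fun e => hi (by rw [e]))
  refine IsTreeDecompositionOn.twTwo (T := parentTree (some ρ) par')
    (χ := fun i => i.elim (insert v (nbrs G A v)) χ) ⟨hr'.isTree, ?_, ?_, ?_, ?_⟩
  · rintro (_ | i)
    · exact Set.insert_subset hv fun u hu => hu.1
    · exact (h.sub i).trans Set.sdiff_subset
  · rintro (_ | i)
    · refine (Set.encard_insert_le _ _).trans ?_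
      refine (add_le_add_left hN 1).trans ?_
      norm_num
    · exact h.card i
  · intro x hx y hy hxy
    by_cases hxv : x = v
    · subst hxv
      exact ⟨none, Or.inl rfl, Or.inr ⟨hy, hxy⟩⟩
    by_cases hyv : y = v
    · subst hyv
      exact ⟨none, Or.inr ⟨hx, hxy.symm⟩, Or.inl rfl⟩
    obtain ⟨s, h1, h2⟩ := h.edge x ⟨hx, hxv⟩ y ⟨hy, hyv⟩ (le_fill hxy)
    exact ⟨some s, h1, h2⟩
  · intro u hu
    by_cases huv : u = v
    · subst huv
      refine hr'.connected_of_top (τ := none) (Or.inl rfl) ?_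
      rintro (_ | i) hi hne
      · exact absurd rfl hne
      · exact absurd rfl (h.sub i hi).2
    · obtain ⟨τ, hτ, hcl⟩ := hr.exists_top (h.connected u ⟨hu, huv⟩)
      refine hr'.connected_of_top (τ := some τ) hτ ?_
      rintro (_ | i) hi hne
      · rcases hi with hi | hi
        · exact absurd hi huv
        · exact ⟨by simp, hs₀ hi⟩
      · obtain ⟨h1, h2⟩ := (hcl i hi).2 (fun e => hne (by rw [e]))
        exact ⟨fun e => h1 (Option.some_injective _ e), h2⟩

/-- Elimination of a vertex of degree at most two preserves treewidth at most two in both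
directions, and such a vertex is available as long as any vertex is left. -/
theorem reducible_iff_twTwo [Finite V] {G : SimpleGraph V} {A : Set V} :
    Reducible G A ↔ TWTwo G A := by
  constructor
  · intro h
    induction h with
    | empty G =>
      refine ⟨1, ⊥, fun _ => ∅, SimpleGraph.IsTree.of_subsingleton, fun _ => le_rfl, by simp,
        by simp, by simp⟩
    | step hv hN _ ih => exact TWTwo.of_fill hv hN ih
  · intro h
    induction hn : A.ncard generalizing G A with
    | zero =>
      rw [Set.ncard_eq_zero] at hn
      rw [hn]
      exact Reducible.empty G
    | succ n ih =>
      obtain ⟨v, hv, hN⟩ := h.exists_degree_le_two (Set.nonempty_of_ncard_ne_zero (by omega))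
      refine Reducible.step hv hN (ih (h.fill hv hN) ?_)
      rw [Set.ncard_sdiff_singleton_of_mem hv, hn]; rfl

theorem treewidth_induce_le_two_iff_reducible [Finite V] {G : SimpleGraph V} {A : Set V} :
    treewidth (G.induce A) ≤ 2 ↔ Reducible G A := by
  rw [treewidth_induce_le_two_iff, reducible_iff_twTwo]

theorem two_lt_treewidth_induce_iff [Finite V] {G : SimpleGraph V} {A : Set V} :
    2 < treewidth (G.induce A) ↔ ¬ Reducible G A := by
  rw [← treewidth_induce_le_two_iff_reducible, not_le]

/-- Monotonicity is immediate for tree decompositions, not for elimination sequences, hence the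
detour. -/
theorem Reducible.mono [Finite V] {G G' : SimpleGraph V} {A B : Set V} (hAB : A ⊆ B)
    (hadj : ∀ u ∈ A, ∀ v ∈ A, G.Adj u v → G'.Adj u v) (h : Reducible G' B) : Reducible G A := by
  rw [reducible_iff_twTwo] at h ⊢
  exact h.mono hAB hadj

theorem Reducible.subset [Finite V] {G : SimpleGraph V} {A B : Set V} (h : Reducible G B)
    (hAB : A ⊆ B) : Reducible G A :=
  h.mono hAB fun _ _ _ _ h => h

/-- Greedy elimination cannot go wrong: no choice of a vertex of degree at most two destroys
reducibility. The program depends on this. -/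
theorem Reducible.fill_iff [Finite V] {G : SimpleGraph V} {A : Set V} {v : V} (hv : v ∈ A)
    (hN : (nbrs G A v).encard ≤ 2) : Reducible (fill G A v) (A \ {v}) ↔ Reducible G A := by
  refine ⟨fun h => h.step hv hN, fun h => ?_⟩
  rw [reducible_iff_twTwo] at h ⊢
  exact h.fill hv hN

theorem Reducible.exists_degree_le_two {G : SimpleGraph V} {A : Set V} (h : Reducible G A)
    (hA : A.Nonempty) : ∃ v ∈ A, (nbrs G A v).encard ≤ 2 := by
  cases h with
  | empty => exact absurd hA Set.not_nonempty_empty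
  | step hv hN _ => exact ⟨_, hv, hN⟩

/-- Lets a clique `X` be kept until last. If the given sequence starts with some `v` in `X`, then
`X` lies in the closed neighbourhood of `v`, so the induction hypothesis is applied to the clique of
neighbours of `v` in the filled graph instead of `X`. -/
theorem Reducible.exists_degree_le_two_notMem {G : SimpleGraph V} {A X : Set V}
    (h : Reducible G A) (hX : G.IsClique X) (hXA : X ⊆ A) (hne : X ≠ A) :
    ∃ v ∈ A, v ∉ X ∧ (nbrs G A v).encard ≤ 2 := by
  induction h generalizing X with
  | empty G => exact absurd (Set.subset_empty_iff.1 hXA) hne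
  | @step G A v hv hN _ ih =>
    by_cases hvX : v ∉ X
    · exact ⟨v, hv, hvX, hN⟩
    rw [not_not] at hvX
    have hXN : X ⊆ insert v (nbrs G A v) := by
      intro x hx
      by_cases e : x = v
      · exact Or.inl e
      · exact Or.inr ⟨hXA hx, hX hvX hx (Ne.symm e)⟩
    -- If `v` is adjacent to everything, at most three vertices are left and all degrees are at most
    -- two. Otherwise the vertex `u` found is not adjacent to `v`, so its neighbours are unaffected
    -- by the removal of `v`.
    by_cases hall : nbrs G A v = A \ {v}
    · obtain ⟨u, hu, huX⟩ := Set.exists_of_ssubset (hXA.ssubset_of_ne hne)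
      refine ⟨u, hu, huX, ?_⟩
      have h1 : nbrs G A u ⊆ A \ {u} := fun w hw => ⟨hw.1, hw.2.ne.symm⟩
      refine (Set.encard_le_encard h1).trans (le_trans (le_of_eq ?_) hN)
      rw [hall, Set.encard_sdiff_singleton_of_mem hu, Set.encard_sdiff_singleton_of_mem hv]
    · obtain ⟨u, hu, huN, hd⟩ := ih (X := nbrs G A v)
        (fun x hx y hy hxy => ⟨hxy, Or.inr ⟨hx, hy⟩⟩)
        (fun x hx => ⟨hx.1, fun e => notMem_nbrs (e ▸ hx)⟩) hall
      refine ⟨u, hu.1, fun hc => (hXN hc).elim hu.2 huN, ?_⟩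
      refine (Set.encard_le_encard ?_).trans hd
      intro w hw
      refine ⟨⟨hw.1, ?_⟩, le_fill hw.2⟩
      rintro rfl
      exact huN ⟨hu.1, hw.2.symm⟩

/-- Two graphs of treewidth at most two that are glued along a clique. -/
theorem Reducible.union [Finite V] {G : SimpleGraph V} {A B X : Set V} (hA : Reducible G A)
    (hB : Reducible G B) (hX : G.IsClique X) (hXA : X ⊆ A) (hXB : X ⊆ B) (hAB : A ∩ B ⊆ X)
    (hedge : ∀ u ∈ A, u ∉ X → ∀ v ∈ B, v ∉ X → ¬ G.Adj u v) : Reducible G (A ∪ B) := by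
  induction hn : A.ncard generalizing G A with
  | zero =>
    rw [Set.ncard_eq_zero] at hn
    rwa [hn, Set.empty_union]
  | succ n ih =>
    by_cases hne : X = A
    · rwa [← hne, Set.union_eq_self_of_subset_left hXB]
    -- Eliminate the vertices of `A` outside `X` first. Such a `v` has no neighbour in `B` outside
    -- `X`, so it has the same neighbours in the union, and edges filled in inside `B` join vertices
    -- of the clique `X` and are present already.
    obtain ⟨v, hv, hvX, hd⟩ := hA.exists_degree_le_two_notMem hX hXA hne
    have hvB : v ∉ B := fun h => hvX (hAB ⟨hv, h⟩)
    have hN : nbrs G (A ∪ B) v = nbrs G A v := by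
      ext u
      refine ⟨fun hu => ⟨?_, hu.2⟩, fun hu => ⟨Or.inl hu.1, hu.2⟩⟩
      rcases hu.1 with h | h
      · exact h
      · by_cases huX : u ∈ X
        · exact hXA huX
        · exact absurd hu.2 (hedge v hv hvX u h huX)
    have hfill : TW2.fill G (A ∪ B) v = TW2.fill G A v := by
      ext x y
      simp only [TW2.fill, hN]
    refine Reducible.step (v := v) (Or.inl hv) (by rwa [hN]) ?_
    rw [hfill, Set.union_sdiff_distrib, Set.sdiff_singleton_eq_self hvB]
    have hXX : ∀ x ∈ B, x ∈ nbrs G A v → x ∈ X := fun x hx hxN => hAB ⟨hxN.1, hx⟩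
    apply ih
    · exact (Reducible.fill_iff hv hd).2 hA
    · refine hB.mono le_rfl ?_
      rintro x hx y hy ⟨hxy, h | ⟨h1, h2⟩⟩
      · exact h
      · exact hX (hXX x hx h1) (hXX y hy h2) hxy
    · exact fun x hx y hy hxy => le_fill (hX hx hy hxy)
    · exact fun x hx => ⟨hXA hx, fun e => hvX (e ▸ hx)⟩
    · exact fun x hx => hAB ⟨hx.1.1, hx.2⟩
    · rintro x hx hxX y hy hyX ⟨_, h | ⟨_, h⟩⟩
      · exact hedge x hx.1 hxX y hy hyX h
      · exact hyX (hXX y hy h)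
    · rw [Set.ncard_sdiff_singleton_of_mem hv, hn]; rfl

end Elimination

theorem Rooted.anc_total {ι : Type*} {par : ι → ι} {u a b : ι} (ha : Rooted.Anc par u a)
    (hb : Rooted.Anc par u b) : Rooted.Anc par a b ∨ Rooted.Anc par b a := by
  obtain ⟨k, rfl⟩ := ha
  obtain ⟨l, rfl⟩ := hb
  rcases le_total k l with h | h
  · exact Or.inl ⟨l - k, by rw [← Function.iterate_add_apply, Nat.sub_add_cancel h]⟩
  · exact Or.inr ⟨k - l, by rw [← Function.iterate_add_apply, Nat.sub_add_cancel h]⟩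

theorem Reducible.of_encard_le_three {V : Type*} [Finite V] {G : SimpleGraph V} {A : Set V}
    (h : A.encard ≤ 3) : Reducible G A := by
  rw [reducible_iff_twTwo]
  refine ⟨1, ⊥, fun _ => A, SimpleGraph.IsTree.of_subsingleton, fun _ => le_rfl, fun _ => h,
    fun u hu v hv _ => ⟨0, hu, hv⟩, fun v hv => ?_⟩
  have hne : Nonempty {s : Fin 1 | v ∈ A} := ⟨⟨0, hv⟩⟩
  exact SimpleGraph.IsTree.of_subsingleton.connected

/-! ### Correctness of the algorithm -/

section Correctness
variable {V ι : Type*}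

theorem mem_bagUnion {χ : ι → Set V} {U : Set ι} {v : V} :
    v ∈ bagUnion χ U ↔ ∃ s ∈ U, v ∈ χ s := by
  simp [bagUnion]

/-- All vertices in the current bags. -/
def LoopState.verts (σ : LoopState V ι) : Set V := bagUnion σ.bag Set.univ

theorem LoopState.mem_verts {σ : LoopState V ι} {v : V} : v ∈ σ.verts ↔ ∃ s, v ∈ σ.bag s := by
  simp [LoopState.verts, mem_bagUnion]

theorem LoopState.bagUnion_subset_verts {σ : LoopState V ι} {U : Set ι} :
    bagUnion σ.bag U ⊆ σ.verts := by
  intro v hv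
  obtain ⟨s, _, hs⟩ := mem_bagUnion.1 hv
  exact mem_verts.2 ⟨s, hs⟩

/-- The invariants of the loop. `W i` is the set of vertices removed in iteration `i`. -/
structure Invariant (G : SimpleGraph V) (X : Set V) (T : SimpleGraph ι) (σ : LoopState V ι)
    (W : ℕ → Set V) : Prop where
  bag_sub : ∀ s, σ.bag s ⊆ Xᶜ
  bag_card : ∀ s, (σ.bag s).encard ≤ 3
  connected : ∀ v ∈ σ.verts, (T.induce {s | v ∈ σ.bag s}).Connected
  edge : ∀ u ∈ σ.verts, ∀ v ∈ σ.verts, G.Adj u v → ∃ s, u ∈ σ.bag s ∧ v ∈ σ.bag s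
  out_sub : σ.out ⊆ Xᶜ
  out_card : σ.out.encard ≤ 3 * (σ.count : ℕ∞)
  verts_out : ∀ v ∈ σ.verts, v ∉ σ.out
  removed_disjoint : ∀ i < σ.count, ∀ j < σ.count, i ≠ j → Disjoint (W i) (W j)
  removed_verts : ∀ i < σ.count, Disjoint (W i) σ.verts
  removed_not_reducible : ∀ i < σ.count, ¬ Reducible G (W i ∪ X)
  removed_closed : ∀ u ∉ X ∪ σ.out, ∀ v ∉ X ∪ σ.out, G.Adj u v →
    ∀ i < σ.count, u ∈ W i → v ∈ W i
  verts_closed : ∀ u ∉ X ∪ σ.out, ∀ v ∉ X ∪ σ.out, G.Adj u v → u ∈ σ.verts → v ∈ σ.verts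
  done : Reducible G (σ.verts ∪ σ.out)ᶜ

theorem invariant_initState [Finite V] {G : SimpleGraph V} {X : Set V} {T : SimpleGraph ι}
    {χ : ι → Set ↥Xᶜ} (hX : X.encard ≤ 3) (hχ : IsTreeDecomposition (G.induce Xᶜ) T χ)
    (hw : width χ ≤ 2) (W : ℕ → Set V) : Invariant G X T (initState χ) W := by
  have hverts : (initState χ).verts = Xᶜ := by
    ext v
    rw [LoopState.mem_verts]
    constructor
    · rintro ⟨s, u, _, rfl⟩
      exact u.2
    · intro hv
      have := Set.eq_univ_iff_forall.1 hχ.cover ⟨v, hv⟩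
      obtain ⟨s, hs⟩ := Set.mem_iUnion.1 this
      exact ⟨s, ⟨v, hv⟩, hs, rfl⟩
  refine ⟨?_, ?_, ?_, ?_, by simp [initState], by simp [initState], by simp [initState],
    by simp [initState], by simp [initState], by simp [initState], by simp [initState], ?_, ?_⟩
  · rintro s _ ⟨u, _, rfl⟩
    exact u.2
  · intro s
    rw [initState, Subtype.val_injective.encard_image]
    exact width_le_two_iff.1 hw s
  · intro v hv
    rw [hverts] at hv
    have e : {s | v ∈ (initState χ).bag s} = {s | (⟨v, hv⟩ : ↥Xᶜ) ∈ χ s} := by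
      ext s
      constructor
      · rintro ⟨u, hu, rfl⟩; exact hu
      · intro h; exact ⟨_, h, rfl⟩
    rw [e]
    exact hχ.connected _
  · intro u hu v hv huv
    rw [hverts] at hu hv
    obtain ⟨s, h1, h2⟩ := hχ.edge (u := ⟨u, hu⟩) (v := ⟨v, hv⟩) huv
    exact ⟨s, ⟨_, h1, rfl⟩, ⟨_, h2, rfl⟩⟩
  · intro u _ v hv _ _
    rw [hverts]
    exact fun h => hv (Or.inl h)
  · rw [hverts]
    refine Reducible.of_encard_le_three ?_
    simpa [initState] using hX

/-! ### Separation by bags, one iteration of the loop, and the limit-clique argument -/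

section Separation
variable {G : SimpleGraph V} {X : Set V} {T : SimpleGraph ι} {σ : LoopState V ι} {W : ℕ → Set V}
  {ρ : ι} {par : ι → ι} {dep : ι → ℕ}

/-- A vertex missing from the bag at one end of the edge between `c` and its parent has all its
nodes on one side of that edge. Both alternatives occur: the first for `c = r` and vertices outside
`Y`, the second for children of `r` and vertices outside the bag of `r`. -/
theorem Invariant.mem_of_adj (h : Invariant G X T σ W) (hr : Rooted T ρ par dep) (hT : T.IsTree)
    {c : ι} {u w : V} (hu : u ∈ bagUnion σ.bag (subtree T ρ c))
    (hc : u ∉ σ.bag c ∨ u ∉ σ.bag (par c)) (hw : w ∈ σ.verts) (huw : G.Adj u w) :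
    w ∈ bagUnion σ.bag (subtree T ρ c) := by
  obtain ⟨s, hs, hus⟩ := mem_bagUnion.1 hu
  have huv : u ∈ σ.verts := LoopState.bagUnion_subset_verts hu
  obtain ⟨s', hus', hws'⟩ := h.edge u huv w hw huw
  refine mem_bagUnion.2 ⟨s', ?_, hws'⟩
  by_contra hs'
  rw [hr.mem_subtree hT] at hs hs'
  have := hr.mem_of_connected (h.connected u huv) (show s ∈ _ from hus) (show s' ∈ _ from hus')
    hs hs'
  exact hc.elim (fun hc => hc this.1) (fun hc => hc this.2)

/-- If the nodes of `u` reached below two children of `r`, they would include `r` by connectedness.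
-/
theorem Invariant.child_eq (h : Invariant G X T σ W) (hr : Rooted T ρ par dep) (hT : T.IsTree)
    {c c' r : ι} {u : V} (hc : c ≠ ρ) (hcr : par c = r) (hc' : c' ≠ ρ) (hcr' : par c' = r)
    (hu : u ∈ bagUnion σ.bag (subtree T ρ c)) (hu' : u ∈ bagUnion σ.bag (subtree T ρ c'))
    (hur : u ∉ σ.bag r) : c = c' := by
  obtain ⟨s, hs, hus⟩ := mem_bagUnion.1 hu
  obtain ⟨s', hs', hus'⟩ := mem_bagUnion.1 hu'
  have huv : u ∈ σ.verts := LoopState.bagUnion_subset_verts hu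
  rw [hr.mem_subtree hT] at hs hs'
  have hs'c : Rooted.Anc par s' c := by
    by_contra hcon
    have := hr.mem_of_connected (h.connected u huv) (show s ∈ _ from hus) (show s' ∈ _ from hus')
      hs hcon
    rw [hcr] at this
    exact hur this.2
  have hd : dep c = dep c' := by rw [hr.dep_par c hc, hr.dep_par c' hc', hcr, hcr']
  rcases Rooted.anc_total hs'c hs' with ha | ha
  · exact hr.eq_of_anc_of_dep_le ha hd.le
  · exact (hr.eq_of_anc_of_dep_le ha hd.ge).symm

/-- Outside the bag of `r`, the parts below different children are disjoint by `Invariant.child_eq`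
and not adjacent by `Invariant.mem_of_adj`. They are glued one after another along `X`. -/
theorem Invariant.reducible_subtree_diff [Finite V] [Finite ι] (h : Invariant G X T σ W)
    (hr : Rooted T ρ par dep) (hT : T.IsTree) (hX : G.IsClique X) (hX3 : X.encard ≤ 3) {r : ι}
    (hch : ∀ c, c ≠ ρ → par c = r → Reducible G (bagUnion σ.bag (subtree T ρ c) ∪ X)) :
    Reducible G ((bagUnion σ.bag (subtree T ρ r) \ σ.bag r) ∪ X) := by
  classical
  have := Fintype.ofFinite ι
  have key : ∀ F : Finset ι, (∀ c ∈ F, c ≠ ρ ∧ par c = r) →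
      Reducible G ((⋃ c ∈ F, bagUnion σ.bag (subtree T ρ c) \ σ.bag r) ∪ X) := by
    intro F
    induction F using Finset.induction_on with
    | empty =>
      intro _
      simpa using Reducible.of_encard_le_three hX3
    | insert c F hcF ih =>
      intro hF
      have hc := hF c (Finset.mem_insert_self _ _)
      have ih := ih fun d hd => hF d (Finset.mem_insert_of_mem hd)
      have hc' : Reducible G ((bagUnion σ.bag (subtree T ρ c) \ σ.bag r) ∪ X) :=
        (hch c hc.1 hc.2).subset (Set.union_subset_union_left _ Set.sdiff_subset)
      have := hc'.union ih hX Set.subset_union_right Set.subset_union_right ?_ ?_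
      · rw [Finset.set_biUnion_insert]
        refine this.subset ?_
        rintro x ((hx | hx) | hx)
        · exact Or.inl (Or.inl hx)
        · exact Or.inr (Or.inl hx)
        · exact Or.inl (Or.inr hx)
      · rintro x ⟨hx | hx, hx' | hx'⟩
        · obtain ⟨d, hd, hxd⟩ := Set.mem_iUnion₂.1 hx'
          have hd' := hF d (Finset.mem_insert_of_mem hd)
          exact absurd (h.child_eq hr hT hc.1 hc.2 hd'.1 hd'.2 hx.1 hxd.1 hx.2 ▸ hd) hcF
        · exact hx'
        · exact hx
        · exact hx
      · intro u hu huX v hv hvX huv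
        have hu := hu.resolve_right huX
        obtain ⟨d, hd, hvd⟩ := Set.mem_iUnion₂.1 (hv.resolve_right hvX)
        have hd' := hF d (Finset.mem_insert_of_mem hd)
        have hvc := h.mem_of_adj hr hT hu.1 (Or.inr (by rw [hc.2]; exact hu.2))
          (LoopState.bagUnion_subset_verts hvd.1) huv
        exact absurd (h.child_eq hr hT hc.1 hc.2 hd'.1 hd'.2 hvc hvd.1 hvd.2 ▸ hd) hcF
  refine (key (Finset.univ.filter fun c => c ≠ ρ ∧ par c = r) (by simp)).subset
    (Set.union_subset_union_left _ ?_)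
  rintro x ⟨hx, hxr⟩
  obtain ⟨s, hs, hxs⟩ := mem_bagUnion.1 hx
  rw [hr.mem_subtree hT] at hs
  obtain ⟨k, hk⟩ := hs
  have hs : s ≠ r := by rintro rfl; exact hxr hxs
  -- Climbing from `s` to its proper ancestor `r`, the last node before `r` is the wanted child.
  obtain ⟨c, hc, hcr, hsc⟩ : ∃ c, c ≠ ρ ∧ par c = r ∧ Rooted.Anc par s c := by
    clear hxs
    induction k generalizing s with
    | zero => exact absurd hk hs
    | succ k ih =>
      by_cases e : par s = r
      · refine ⟨s, ?_, e, Rooted.anc_refl _ _⟩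
        rintro rfl
        rw [hr.par_root] at e
        exact hs e
      · obtain ⟨c, h1, h2, h3⟩ := ih (par s) hk e
        exact ⟨c, h1, h2, Rooted.anc_par h3⟩
  refine Set.mem_iUnion₂.2 ⟨c, by simp [hc, hcr], ?_, hxr⟩
  exact mem_bagUnion.2 ⟨s, (hr.mem_subtree hT).2 hsc, hxs⟩

theorem Invariant.step [Finite V] [Finite ι] (h : Invariant G X T σ W) (hT : T.IsTree)
    (hX : G.IsClique X) (hX3 : X.encard ≤ 3) {t : ℕ} {σ' : LoopState V ι}
    (hstep : Step G t X T ρ σ σ') : ∃ W' : ℕ → Set V, Invariant G X T σ' W' := by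
  obtain ⟨_, r, hcand, hmax, rfl⟩ := hstep
  obtain ⟨par, hr⟩ := exists_rooted_of_isTree hT ρ
  set R := bagUnion σ.bag (subtree T ρ r) with hR
  have hRU : R ⊆ σ.verts := LoopState.bagUnion_subset_verts
  have hrR : σ.bag r ⊆ R := fun v hv =>
    mem_bagUnion.2 ⟨r, (hr.mem_subtree hT).2 (Rooted.anc_refl _ _), hv⟩
  have hRX : ∀ v ∈ R, v ∉ X := fun v hv => by
    obtain ⟨s, hs⟩ := LoopState.mem_verts.1 (hRU hv)
    exact h.bag_sub s hs
  set σ' : LoopState V ι := { count := σ.count + 1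
                              bag := fun s => σ.bag s \ R
                              out := σ.out ∪ σ.bag r } with hσ'
  have hverts : σ'.verts = σ.verts \ R := by
    ext v
    simp only [LoopState.mem_verts, Set.mem_sdiff, hσ']
    exact ⟨fun ⟨s, h1, h2⟩ => ⟨⟨s, h1⟩, h2⟩, fun ⟨⟨s, h1⟩, h2⟩ => ⟨s, h1, h2⟩⟩
  have hlt : ∀ i, i < σ.count + 1 → i ≠ σ.count → i < σ.count := fun i h1 h2 => by omega
  have hout : ∀ v, v ∉ X ∪ (σ.out ∪ σ.bag r) → v ∉ X ∪ σ.out := fun v hv hc =>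
    hv (hc.imp id Or.inl)
  -- The bag of `r` goes into `Y`, so a surviving vertex of `R` misses that bag and its neighbours
  -- among the current vertices are in `R`.
  have hRcl : ∀ u ∉ X ∪ (σ.out ∪ σ.bag r), ∀ v ∉ X ∪ (σ.out ∪ σ.bag r), G.Adj u v → u ∈ R →
      v ∈ R := by
    intro u hu v hv huv huR
    exact h.mem_of_adj hr hT huR (Or.inl fun hc => hu (Or.inr (Or.inr hc)))
      (h.verts_closed u (hout u hu) v (hout v hv) huv (hRU huR)) huv
  refine ⟨Function.update W σ.count R, ?_, ?_, ?_, ?_, ?_, ?_, ?_, ?_, ?_, ?_, ?_, ?_, ?_⟩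
  · exact fun s => Set.sdiff_subset.trans (h.bag_sub s)
  · exact fun s => (Set.encard_le_encard Set.sdiff_subset).trans (h.bag_card s)
  · intro v hv
    rw [hverts] at hv
    have e : {s | v ∈ σ'.bag s} = {s | v ∈ σ.bag s} := by
      ext s
      exact ⟨fun h => h.1, fun h => ⟨h, hv.2⟩⟩
    rw [e]
    exact h.connected v hv.1
  · intro u hu v hv huv
    rw [hverts] at hu hv
    obtain ⟨s, h1, h2⟩ := h.edge u hu.1 v hv.1 huv
    exact ⟨s, ⟨h1, hu.2⟩, ⟨h2, hv.2⟩⟩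
  · exact Set.union_subset h.out_sub (h.bag_sub r)
  · refine (Set.encard_union_le _ _).trans ((add_le_add h.out_card (h.bag_card r)).trans ?_)
    rw [hσ']
    push_cast
    rw [mul_add, mul_one]
  · intro v hv
    rw [hverts] at hv
    rintro (hc | hc)
    · exact h.verts_out v hv.1 hc
    · exact hv.2 (hrR hc)
  · intro i hi j hj hij
    by_cases ei : i = σ.count
    · rw [ei, Function.update_self, Function.update_of_ne (by omega)]
      exact ((h.removed_verts j (hlt j hj (by omega))).mono_right hRU).symm
    · rw [Function.update_of_ne ei]
      by_cases ej : j = σ.count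
      · rw [ej, Function.update_self]
        exact (h.removed_verts i (hlt i hi ei)).mono_right hRU
      · rw [Function.update_of_ne ej]
        exact h.removed_disjoint i (hlt i hi ei) j (hlt j hj ej) hij
  · intro i hi
    rw [hverts]
    by_cases ei : i = σ.count
    · rw [ei, Function.update_self]
      exact Set.disjoint_sdiff_right
    · rw [Function.update_of_ne ei]
      exact (h.removed_verts i (hlt i hi ei)).mono_right Set.sdiff_subset
  · intro i hi
    by_cases ei : i = σ.count
    · rw [ei, Function.update_self]
      exact two_lt_treewidth_induce_iff.1 hcand
    · rw [Function.update_of_ne ei]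
      exact h.removed_not_reducible i (hlt i hi ei)
  · intro u hu v hv huv i hi
    by_cases ei : i = σ.count
    · rw [ei, Function.update_self]
      exact hRcl u hu v hv huv
    · rw [Function.update_of_ne ei]
      exact h.removed_closed u (hout u hu) v (hout v hv) huv i (hlt i hi ei)
  · intro u hu v hv huv
    rw [hverts]
    rintro ⟨h1, h2⟩
    exact ⟨h.verts_closed u (hout u hu) v (hout v hv) huv h1,
      fun hc => h2 (hRcl v hv u hu huv.symm hc)⟩
  -- The finished part grows by `R` minus the bag of `r`. The children of `r` are deeper than `r`,
  -- so by the choice of `r` none is a candidate.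
  · have hchild := h.reducible_subtree_diff hr hT hX hX3 (r := r) ?_
    · rw [hverts]
      refine (h.done.union hchild hX ?_ Set.subset_union_right ?_ ?_).subset ?_
      · rintro x hx (hc | hc)
        · obtain ⟨s, hs⟩ := LoopState.mem_verts.1 hc
          exact h.bag_sub s hs hx
        · exact h.out_sub hc hx
      · rintro x ⟨hx, hx' | hx'⟩
        · exact absurd (Or.inl (hRU hx'.1)) hx
        · exact hx'
      · intro u hu huX v hv hvX huv
        have hv := hv.resolve_right hvX
        refine hu (Or.inl (h.verts_closed v ?_ u ?_ huv.symm (hRU hv.1)))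
        · exact fun hc => hc.elim hvX (h.verts_out v (hRU hv.1))
        · exact fun hc => hc.elim huX (fun hc => hu (Or.inr hc))
      · intro x hx
        by_cases hxR : x ∈ R
        · exact Or.inr (Or.inl ⟨hxR, fun hc => hx (Or.inr (Or.inr hc))⟩)
        · refine Or.inl fun hc => hx ?_
          exact hc.elim (fun hc => Or.inl ⟨hc, hxR⟩) (fun hc => Or.inr (Or.inl hc))
    · intro c hc hcr
      by_contra hcon
      have := hmax c (two_lt_treewidth_induce_iff.2 hcon)
      have := hr.dep_par c hc
      rw [hcr] at this
      omega

theorem exists_invariant_of_reachable [Finite V] [Finite ι] {t : ℕ} {χ : ι → Set ↥Xᶜ}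
    (hX : IsInput G X) (hχ : IsTreeDecomposition (G.induce Xᶜ) T χ) (hw : width χ ≤ 2)
    (h : Reachable G t X T ρ χ σ) : ∃ W : ℕ → Set V, Invariant G X T σ W := by
  induction h with
  | refl => exact ⟨fun _ => ∅, invariant_initState hX.le_three hχ hw _⟩
  | tail _ hstep ih =>
    obtain ⟨W, hW⟩ := ih
    exact hW.step hχ.isTree hX.clique hX.le_three hstep

theorem Reachable.count_le {t : ℕ} {χ : ι → Set ↥Xᶜ} (h : Reachable G t X T ρ χ σ) :
    σ.count ≤ t + 1 := by
  induction h with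
  | refl => simp [initState]
  | tail _ hstep ih =>
    obtain ⟨⟨_, hg⟩, r, _, _, rfl⟩ := hstep
    exact hg

/-- The subtree at the root is the whole tree, so the guard makes the root a candidate. -/
theorem exists_step_of_guard [Finite ι] (hT : T.IsTree) {t : ℕ} (hg : Guard G t X σ) :
    ∃ σ', Step G t X T ρ σ σ' := by
  obtain ⟨par, hr⟩ := exists_rooted_of_isTree hT ρ
  have huniv : subtree T ρ ρ = Set.univ :=
    Set.eq_univ_of_forall fun u => (hr.mem_subtree hT).2 (hr.anc_root u)
  have hρ : ρ ∈ {r | IsCandidate G X T ρ σ r} := by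
    have : 2 < treewidth (G.induce (bagUnion σ.bag (subtree T ρ ρ) ∪ X)) := by
      rw [huniv]
      exact hg.1
    exact this
  obtain ⟨r, hr, hmax⟩ := Set.exists_max_image _ (T.dist ρ) (Set.toFinite _) ⟨ρ, hρ⟩
  exact ⟨_, hg, r, hr, hmax, rfl⟩

theorem mem_of_mem_component {Z : Set V} (P : Set V)
    (hP : ∀ u ∉ Z, ∀ v ∉ Z, G.Adj u v → u ∈ P → v ∈ P) (C : (G.induce Zᶜ).ConnectedComponent)
    {u v : V} (hu : u ∈ componentVerts C) (hv : v ∈ componentVerts C) (huP : u ∈ P) : v ∈ P := by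
  obtain ⟨u, hu, rfl⟩ := hu
  obtain ⟨v, hv, rfl⟩ := hv
  obtain ⟨w⟩ := SimpleGraph.ConnectedComponent.exact (hu.trans hv.symm)
  clear hu hv
  induction w with
  | nil => exact huP
  | @cons a b _ h _ ih => exact ih (hP _ a.2 _ b.2 h huP)

/-- Pigeonhole: of `k + 1 ≥ t + 2` disjoint sets, at most one meets `C`, as each contains `C` or
misses it, and at most `t` meet `S`. -/
theorem exists_disjoint_of_card_lt {U C S : Set V} {W : ℕ → Set V} {k t : ℕ} (hk : t + 1 ≤ k)
    (hdisj : ∀ i < k, ∀ j < k, i ≠ j → Disjoint (W i) (W j)) (hU : ∀ i < k, Disjoint (W i) U)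
    (hC : ∀ i < k, ∀ u ∈ C, ∀ v ∈ C, u ∈ W i → v ∈ W i)
    (hCU : ∀ u ∈ C, ∀ v ∈ C, u ∈ U → v ∈ U) (hS : S.encard ≤ t) :
    (Disjoint U C ∧ Disjoint U S) ∨ ∃ i < k, Disjoint (W i) C ∧ Disjoint (W i) S := by
  classical
  -- One family with `U` at index `k`, so that all `k + 1` sets are treated alike.
  set W' : ℕ → Set V := fun i => if i < k then W i else U with hW'
  suffices h : ∃ i ≤ k, Disjoint (W' i) C ∧ Disjoint (W' i) S by
    obtain ⟨i, _, hi'⟩ := h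
    by_cases e : i < k
    · simp only [hW', e, if_true] at hi'
      exact Or.inr ⟨i, e, hi'⟩
    · simp only [hW', e, if_false] at hi'
      exact Or.inl hi'
  have hd : ∀ i ≤ k, ∀ j ≤ k, i ≠ j → Disjoint (W' i) (W' j) := by
    intro i hi j hj hij
    by_cases ei : i < k <;> by_cases ej : j < k
    · simpa only [hW', ei, ej, if_true] using hdisj i ei j ej hij
    · simpa only [hW', ei, ej, if_true, if_false] using hU i ei
    · simpa only [hW', ei, ej, if_true, if_false] using (hU j ej).symm
    · omega
  have hcl : ∀ i, ∀ u ∈ C, ∀ v ∈ C, u ∈ W' i → v ∈ W' i := by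
    intro i
    by_cases ei : i < k
    · simpa only [hW', ei, if_true] using hC i ei
    · simpa only [hW', ei, if_false] using hCU
  by_contra! hcon
  set F := (Finset.range (k + 1)).filter fun i => Disjoint (W' i) C with hF
  have h1 : ((Finset.range (k + 1)).filter fun i => ¬ Disjoint (W' i) C).card ≤ 1 := by
    rw [Finset.card_le_one]
    intro i hi j hj
    rw [Finset.mem_filter, Finset.mem_range, Set.not_disjoint_iff] at hi hj
    obtain ⟨hi, u, hu, huC⟩ := hi
    obtain ⟨hj, v, hv, hvC⟩ := hj
    by_contra hij
    exact Set.disjoint_left.1 (hd i (by omega) j (by omega) hij) (hcl i u huC v hvC hu) hv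
  have h2 := Finset.card_filter_add_card_filter_not (s := Finset.range (k + 1))
    (fun i => Disjoint (W' i) C)
  rw [Finset.card_range] at h2
  change F.card + _ = _ at h2
  have hex : ∀ i ∈ F, ∃ x ∈ S, x ∈ W' i := by
    intro i hi
    rw [hF, Finset.mem_filter, Finset.mem_range] at hi
    obtain ⟨x, h1, h2⟩ := Set.not_disjoint_iff.1 (hcon i (by omega) hi.2)
    exact ⟨x, h2, h1⟩
  have hV : Nonempty V := by
    have : F.Nonempty := by rw [← Finset.card_pos]; omega
    obtain ⟨i, hi⟩ := this
    exact ⟨(hex i hi).choose⟩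
  choose! f hfS hfW using hex
  have hinj : Set.InjOn f F := by
    intro i hi j hj hij
    have hi' : i ≤ k := by have := (Finset.mem_filter.1 hi).1; rw [Finset.mem_range] at this; omega
    have hj' : j ≤ k := by have := (Finset.mem_filter.1 hj).1; rw [Finset.mem_range] at this; omega
    by_contra hne
    exact Set.disjoint_left.1 (hd i hi' j hj' hne) (hfW i hi) (hij ▸ hfW j hj)
  -- Picking an element of `S` from each set that misses `C` is injective, as the sets are disjoint;
  -- but at least `k ≥ t + 1` sets miss `C`.
  have h3 : (F : Set ℕ).encard ≤ t := by
    rw [← hinj.encard_image]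
    refine (Set.encard_le_encard ?_).trans hS
    rintro _ ⟨i, hi, rfl⟩
    exact hfS i hi
  rw [Set.encard_coe_eq_coe_finsetCard] at h3
  have : F.card ≤ t := by exact_mod_cast h3
  omega

/-- If the bound failed, `S` would miss `X` entirely. One of the `t + 2` or more disjoint
obstructions avoids both `C` and `S`; with `X` it would lie inside the graph that remains, which has
treewidth at most two. -/
theorem Invariant.isLimitClique [Finite V] (h : Invariant G X T σ W) {t : ℕ}
    (hcount : t + 1 ≤ σ.count) (hX : IsInput G X) (hU : ¬ Reducible G (σ.verts ∪ X))
    (C : (G.induce (X ∪ σ.out)ᶜ).ConnectedComponent) :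
    IsLimitClique (G.induce (componentVerts C)ᶜ) t (X.ncard - 1) (Subtype.val ⁻¹' X) := by
  have hXC : ∀ x ∈ X, x ∉ componentVerts C := by
    rintro _ hx ⟨u, _, rfl⟩
    exact u.2 (Or.inl hx)
  refine ⟨fun x hx y hy hxy => hX.clique hx hy (fun e => hxy (Subtype.ext e)), ?_⟩
  rintro S ⟨hmod, hcard⟩
  by_contra hlt
  -- A single vertex of `X` in `S` already gives the bound `X.ncard - 1`.
  have hXS : ∀ x ∈ X, x ∉ Subtype.val '' S := by
    rintro _ hx ⟨x, hxS, rfl⟩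
    apply hlt
    have hsub : Subtype.val '' ((Subtype.val ⁻¹' X : Set ↥(componentVerts C)ᶜ) \ S) ⊆
        X \ {x.1} := by
      rintro _ ⟨y, ⟨hyX, hyS⟩, rfl⟩
      refine ⟨hyX, fun e => hyS ?_⟩
      rwa [Subtype.ext e]
    have h1 := Set.encard_le_encard hsub
    rw [Subtype.val_injective.encard_image] at h1
    refine h1.trans (le_of_eq ?_)
    rw [← Set.ncard_sdiff_singleton_of_mem hx, Set.Finite.cast_ncard_eq (Set.toFinite _)]
  have hred : Reducible G (Subtype.val '' Sᶜ) := by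
    rw [reducible_iff_twTwo]
    exact (treewidth_induce_le_two_iff.1 hmod).image_val
  have hno : ∀ Z : Set V, Disjoint Z (componentVerts C) → Disjoint Z (Subtype.val '' S) →
      Reducible G (Z ∪ X) := by
    intro Z hZC hZS
    refine hred.subset ?_
    have : ∀ x, x ∉ componentVerts C → x ∉ Subtype.val '' S → x ∈ Subtype.val '' Sᶜ :=
      fun x h1 h2 => ⟨⟨x, h1⟩, fun hc => h2 ⟨_, hc, rfl⟩, rfl⟩
    rintro x (hx | hx)
    · exact this x (Set.disjoint_left.1 hZC hx) (Set.disjoint_left.1 hZS hx)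
    · exact this x (hXC x hx) (hXS x hx)
  rcases exists_disjoint_of_card_lt (U := σ.verts) (C := componentVerts C)
    (S := Subtype.val '' S) (W := W) hcount h.removed_disjoint h.removed_verts
    (fun i hi u hu v hv => mem_of_mem_component (W i)
      (fun u hu v hv huv => h.removed_closed u hu v hv huv i hi) C hu hv)
    (fun u hu v hv => mem_of_mem_component σ.verts h.verts_closed C hu hv)
    (by rw [Subtype.val_injective.encard_image]; exact hcard) with h1 | ⟨i, hi, h1⟩
  · exact hU (hno _ h1.1 h1.2)
  · exact h.removed_not_reducible i hi (hno _ h1.1 h1.2)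

/-- Glue the finished part and the remaining vertices along `X`; by `verts_closed` no edge outside
`X` joins them. -/
theorem Invariant.treewidth_compl_le_two [Finite V] (h : Invariant G X T σ W) (hX : G.IsClique X)
    (hU : Reducible G (σ.verts ∪ X)) : treewidth (G.induce σ.outᶜ) ≤ 2 := by
  rw [treewidth_induce_le_two_iff_reducible]
  refine (h.done.union hU hX ?_ Set.subset_union_right ?_ ?_).subset ?_
  · rintro x hx (hc | hc)
    · obtain ⟨s, hs⟩ := LoopState.mem_verts.1 hc
      exact h.bag_sub s hs hx
    · exact h.out_sub hc hx
  · rintro x ⟨hx, hx' | hx'⟩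
    · exact absurd (Or.inl hx') hx
    · exact hx'
  · intro u hu huX v hv hvX huv
    have hv := hv.resolve_right hvX
    refine hu (Or.inl (h.verts_closed v ?_ u ?_ huv.symm hv))
    · exact fun hc => hc.elim hvX (h.verts_out v hv)
    · exact fun hc => hc.elim huX (fun hc => hu (Or.inr hc))
  · intro x hx
    by_cases hxU : x ∈ σ.verts
    · exact Or.inr (Or.inl hxU)
    · exact Or.inl fun hc => hc.elim hxU hx

end Separation

theorem find_disjoint_modulator_correct [Finite V] [Finite ι] (G : SimpleGraph V) (t : ℕ)
    (X : Set V) (T : SimpleGraph ι) (ρ : ι) (χ : ι → Set ↥Xᶜ) (hX : IsInput G X)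
    (hχ : IsTreeDecomposition (G.induce Xᶜ) T χ) (hw : width χ ≤ 2) :
    (∀ σ : LoopState V ι, Reachable G t X T ρ χ σ → Guard G t X σ →
      ∃ σ' : LoopState V ι, Step G t X T ρ σ σ') ∧
    ∀ Y : Set V, Returns G t X T ρ χ Y →
      Y ⊆ Xᶜ ∧ Y.encard ≤ 3 * t + 3 ∧
      (treewidth (G.induce Yᶜ) ≤ 2 ∨
        ∀ C : (G.induce (X ∪ Y)ᶜ).ConnectedComponent,
          IsLimitClique (G.induce (componentVerts C)ᶜ) t (X.ncard - 1) (Subtype.val ⁻¹' X)) := by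
  refine ⟨fun σ _ hg => exists_step_of_guard hχ.isTree hg, ?_⟩
  rintro _ ⟨σ, hσ, hg, rfl⟩
  obtain ⟨W, h⟩ := exists_invariant_of_reachable hX hχ hw hσ
  refine ⟨h.out_sub, h.out_card.trans ?_, ?_⟩
  · have : (σ.count : ℕ∞) ≤ (t + 1 : ℕ) := Nat.cast_le.2 hσ.count_le
    refine (mul_le_mul_right this 3).trans (le_of_eq ?_)
    push_cast
    rw [mul_add, mul_one]
  -- The guard has failed for one of its two reasons; if not by treewidth, then all `t + 1`
  -- iterations were made.
  · by_cases hU : Reducible G (σ.verts ∪ X)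
    · exact Or.inl (h.treewidth_compl_le_two hX.clique hU)
    · refine Or.inr fun C => h.isLimitClique ?_ hX hU C
      by_contra hc
      exact hg ⟨two_lt_treewidth_induce_iff.2 hU, not_le.1 hc⟩

end Correctness

/-! ### Programs with bounded loops

A small language whose loops all run over `0, …, n - 1`, so that its programs run in polynomial
time, and its translation to the programs of the machine. Variable `x` is kept in register `2 x`,
and the odd registers hold intermediate results. -/

/-- The number of the array that is used for intermediate results. -/
def scratch : ℕ := 100

/-- The contents of the arrays. -/
abbrev Cells := ℕ → ℕ → ℕ → ℕ

/-- Expressions with bounded sums. In depth `d`, the variables are those below `d`, and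
`sum e` is the sum of `e` over all values below `n` of variable `d`. -/
inductive BExpr where
  | const (k : ℕ)
  | var (x : ℕ)
  | cell (a : ℕ) (i j : BExpr)
  | add (e f : BExpr)
  | sub (e f : BExpr)
  | ite (e f g : BExpr)
  | sum (e : BExpr)

/-- The environment `ρ` with the value `i` for variable `d`. -/
def bind (ρ : ℕ → ℕ) (d i : ℕ) : ℕ → ℕ := fun x => if x = d then i else ρ x

/-- The value of an expression. -/
def BExpr.eval : BExpr → ℕ → (ℕ → ℕ) → Cells → ℕ
  | .const k, _, _, _ => k
  | .var x, d, ρ, _ => if x < d then ρ x else 0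
  | .cell a i j, d, ρ, c => if a = scratch then 0 else c a (i.eval d ρ c) (j.eval d ρ c)
  | .add e f, d, ρ, c => e.eval d ρ c + f.eval d ρ c
  | .sub e f, d, ρ, c => e.eval d ρ c - f.eval d ρ c
  | .ite e f g, d, ρ, c => if e.eval d ρ c ≠ 0 then f.eval d ρ c else g.eval d ρ c
  | .sum e, d, ρ, c => ∑ i ∈ Finset.range (ρ 0), e.eval (d + 1) (bind ρ d i) c

theorem bind_congr {ρ ρ' : ℕ → ℕ} {d : ℕ} (h : ∀ x < d, ρ x = ρ' x) (i : ℕ) :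
    ∀ x < d + 1, bind ρ d i x = bind ρ' d i x := by
  intro x hx
  unfold bind
  split_ifs with e
  · rfl
  · exact h x (by omega)

/-- The default value zero for variables out of scope and for the scratch array makes values
independent of whatever compiled code leaves there. Depth zero is excluded because sums read `n`
from variable `0`. -/
theorem BExpr.eval_congr (e : BExpr) {d : ℕ} (hd : 0 < d) {ρ ρ' : ℕ → ℕ} {c c' : Cells}
    (h : ∀ x < d, ρ x = ρ' x) (hc : ∀ a, a ≠ scratch → c a = c' a) :
    e.eval d ρ c = e.eval d ρ' c' := by
  induction e generalizing d ρ ρ' with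
  | const k => rfl
  | var x =>
    simp only [eval]
    split_ifs with hx
    · exact h x hx
    · rfl
  | cell a i j hi hj =>
    simp only [eval]
    split_ifs with ha
    · rfl
    · rw [hi hd h, hj hd h, hc a ha]
  | add e f he hf => simp only [eval, he hd h, hf hd h]
  | sub e f he hf => simp only [eval, he hd h, hf hd h]
  | ite e f g he hf hg => simp only [eval, he hd h, hf hd h, hg hd h]
  | sum e he =>
    simp only [eval]
    rw [h 0 hd]
    exact Finset.sum_congr rfl fun i _ => he (Nat.succ_pos _) (bind_congr h i)

/-- A loop over the values below `n` of register `y`. -/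
def forProg (y : ℕ) (body : Prog) : Prog :=
  .seq (.setReg y (.const 0))
    (.loop (.sub (.reg 0) (.reg y)) (.seq body (.setReg y (.add (.reg y) (.const 1)))))

/-- The rule for loops: `I i` holds when round `i` starts, and the body must restore register `0`
and the counter. The constants `10` generously cover tests and increments. -/
theorem exists_runs_forProg {y n q : ℕ} (hy : y ≠ 0) {body : Prog} {I : ℕ → Memory → Prop}
    (hbody : ∀ i < n, ∀ μ : Memory, μ.reg 0 = n → μ.reg y = i → I i μ →
      ∃ k ≤ q, ∃ μ', Runs body μ k μ' ∧ μ'.reg 0 = n ∧ μ'.reg y = i ∧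
        I (i + 1) (μ'.setReg y (i + 1)))
    {μ : Memory} (h0 : μ.reg 0 = n) (hI : I 0 (μ.setReg y 0)) :
    ∃ k ≤ n * (q + 10) + 10, ∃ μ', Runs (forProg y body) μ k μ' ∧ μ'.reg 0 = n ∧ I n μ' := by
  have loop : ∀ m i, i + m = n → ∀ μ : Memory, μ.reg 0 = n → μ.reg y = i → I i μ →
      ∃ k ≤ m * (q + 10) + 4, ∃ μ',
        Runs (.loop (.sub (.reg 0) (.reg y)) (.seq body (.setReg y (.add (.reg y) (.const 1)))))
          μ k μ' ∧ μ'.reg 0 = n ∧ I n μ' := by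
    intro m
    induction m with
    | zero =>
      intro i hi μ h0 hy hI
      refine ⟨_, ?_, μ, Runs.loop_false ?_, h0, ?_⟩
      · simp [Expr.cost]
      · simp only [Expr.eval, h0, hy]; omega
      · rwa [← hi]
    | succ m ih =>
      intro i hi μ h0 hyi hI
      obtain ⟨k, hk, μ1, hr, h1, h2, h3⟩ := hbody i (by omega) μ h0 hyi hI
      obtain ⟨l, hl, μ2, hr', h4, h5⟩ := ih (i + 1) (by omega) (μ1.setReg y (i + 1))
        (by simp [Memory.setReg, hy.symm, h1]) (by simp [Memory.setReg]) h3
      have hs := Runs.setReg y (.add (.reg y) (.const 1)) μ1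
      simp only [Expr.eval, h2] at hs
      refine ⟨_, ?_, μ2, Runs.loop_true ?_ (Runs.seq hr hs) hr', h4, h5⟩
      · simp only [Expr.cost]
        rw [add_mul]
        omega
      · simp only [Expr.eval, h0, hyi]; omega
  obtain ⟨k, hk, μ', hr, h1, h2⟩ := loop n 0 (by omega) (μ.setReg y 0)
    (by simp [Memory.setReg, hy.symm, h0]) (by simp [Memory.setReg]) hI
  refine ⟨_, ?_, μ', Runs.seq (Runs.setReg y (.const 0) μ) hr, h1, h2⟩
  simp only [Expr.cost]
  omega

/-- The values of the variables. -/
def Memory.env (μ : Memory) : ℕ → ℕ := fun x => μ.reg (2 * x)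

/-- The program that evaluates an expression and puts its value into register `2 s + 1`. -/
def BExpr.compile : BExpr → ℕ → ℕ → Prog
  | .const k, _, s => .setReg (2 * s + 1) (.const k)
  | .var x, d, s => .setReg (2 * s + 1) (if x < d then .reg (2 * x) else .const 0)
  | .cell a i j, d, s => .seq (i.compile d s) (.seq (j.compile d (s + 1))
      (.setReg (2 * s + 1) (if a = scratch then .const 0 else
        .cell a (.reg (2 * s + 1)) (.reg (2 * (s + 1) + 1)))))
  | .add e f, d, s => .seq (e.compile d s) (.seq (f.compile d (s + 1))
      (.setReg (2 * s + 1) (.add (.reg (2 * s + 1)) (.reg (2 * (s + 1) + 1)))))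
  | .sub e f, d, s => .seq (e.compile d s) (.seq (f.compile d (s + 1))
      (.setReg (2 * s + 1) (.sub (.reg (2 * s + 1)) (.reg (2 * (s + 1) + 1)))))
  | .ite e f g, d, s => .seq (e.compile d s)
      (.ite (.reg (2 * s + 1)) (f.compile d s) (g.compile d s))
  | .sum e, d, s => .seq (.setReg (2 * s + 1) (.const 0))
      (forProg (2 * d) (.seq (e.compile (d + 1) (s + 1))
        (.setReg (2 * s + 1) (.add (.reg (2 * s + 1)) (.reg (2 * (s + 1) + 1))))))

/-- The run from `μ` to `μ'` has changed no variable below `d`, no intermediate result below `s`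
and no array. -/
structure Preserves (d s : ℕ) (μ μ' : Memory) : Prop where
  var : ∀ x < d, μ'.reg (2 * x) = μ.reg (2 * x)
  tmp : ∀ x < s, μ'.reg (2 * x + 1) = μ.reg (2 * x + 1)
  cell : μ'.cell = μ.cell

theorem Preserves.trans {d s s' : ℕ} {μ μ' μ'' : Memory} (h : Preserves d s μ μ')
    (h' : Preserves d s' μ' μ'') (hs : s ≤ s') : Preserves d s μ μ'' :=
  ⟨fun x hx => (h'.var x hx).trans (h.var x hx),
    fun x hx => (h'.tmp x (by omega)).trans (h.tmp x hx), h'.cell.trans h.cell⟩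

theorem Preserves.setReg {d s : ℕ} (μ : Memory) (v : ℕ) :
    Preserves d s μ (μ.setReg (2 * s + 1) v) := by
  refine ⟨fun x _ => ?_, fun x _ => ?_, rfl⟩
  · exact if_neg (by omega)
  · exact if_neg (by omega)

theorem Preserves.eval_eq {d s : ℕ} {μ μ' : Memory} (h : Preserves d s μ μ') (hd : 0 < d)
    (e : BExpr) : e.eval d μ'.env μ'.cell = e.eval d μ.env μ.cell :=
  e.eval_congr hd h.var fun a _ => congrFun h.cell a

theorem reg_setReg_self (μ : Memory) (x v : ℕ) : (μ.setReg x v).reg x = v := by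
  simp [Memory.setReg]

theorem reg_setReg_of_ne (μ : Memory) {x y : ℕ} (v : ℕ) (h : y ≠ x) :
    (μ.setReg x v).reg y = μ.reg y := by
  simp [Memory.setReg, h]

/-- The program `c` evaluates `e` in polynomial time. -/
def Evaluates (e : BExpr) (d s : ℕ) (c : Prog) : Prop :=
  ∃ p : Polynomial ℕ, ∀ μ : Memory, ∃ k ≤ p.eval (μ.reg 0), ∃ μ', Runs c μ k μ' ∧
    μ'.reg (2 * s + 1) = e.eval d μ.env μ.cell ∧ Preserves d s μ μ'

/-- The first operand waits in slot `s` while the second is computed from slot `s + 1` upwards,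
which leaves slot `s` alone. -/
theorem Evaluates.binary {e f g : BExpr} {d s : ℕ} {c c' : Prog} {r : Expr} (hd : 0 < d)
    (he : Evaluates e d s c) (hf : Evaluates f d (s + 1) c')
    (hg : ∀ μ : Memory, μ.reg (2 * s + 1) = e.eval d μ.env μ.cell →
      μ.reg (2 * (s + 1) + 1) = f.eval d μ.env μ.cell → r.eval μ = g.eval d μ.env μ.cell) :
    Evaluates g d s (.seq c (.seq c' (.setReg (2 * s + 1) r))) := by
  obtain ⟨p, hp⟩ := he
  obtain ⟨q, hq⟩ := hf
  refine ⟨p + q + Polynomial.C (r.cost + 3), fun μ => ?_⟩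
  obtain ⟨k, hk, μ1, r1, v1, p1⟩ := hp μ
  obtain ⟨l, hl, μ2, r2, v2, p2⟩ := hq μ1
  have h0 : μ1.reg 0 = μ.reg 0 := p1.var 0 hd
  have p12 := p1.trans p2 (Nat.le_succ s)
  refine ⟨_, ?_, _, r1.seq (r2.seq (Runs.setReg _ _ _)), ?_, ?_⟩
  · rw [h0] at hl
    simp only [Polynomial.eval_add, Polynomial.eval_C]
    omega
  · rw [reg_setReg_self, hg μ2, p12.eval_eq hd]
    · rw [p12.eval_eq hd, p2.tmp s (Nat.lt_succ_self s), v1]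
    · rw [v2, p2.eval_eq hd]
  · exact p12.trans (Preserves.setReg _ _) le_rfl

theorem BExpr.evaluates_compile (e : BExpr) {d : ℕ} (hd : 0 < d) (s : ℕ) :
    Evaluates e d s (e.compile d s) := by
  induction e generalizing d s with
  | const k =>
    refine ⟨Polynomial.C 2, fun μ => ⟨_, ?_, _, Runs.setReg _ _ _, ?_, Preserves.setReg _ _⟩⟩
    · simp [Expr.cost]
    · rw [reg_setReg_self]; rfl
  | var x =>
    refine ⟨Polynomial.C 2, fun μ => ⟨_, ?_, _, Runs.setReg _ _ _, ?_, Preserves.setReg _ _⟩⟩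
    · split_ifs <;> simp [Expr.cost]
    · rw [reg_setReg_self]
      simp only [eval]
      split_ifs <;> rfl
  | cell a i j hi hj =>
    refine Evaluates.binary hd (hi hd s) (hj hd (s + 1)) fun μ h1 h2 => ?_
    simp only [eval]
    split_ifs
    · rfl
    · simp only [Expr.eval, h1, h2]
  | add e f he hf =>
    exact Evaluates.binary hd (he hd s) (hf hd (s + 1)) fun μ h1 h2 => by
      simp only [eval, Expr.eval, h1, h2]
  | sub e f he hf =>
    exact Evaluates.binary hd (he hd s) (hf hd (s + 1)) fun μ h1 h2 => by
      simp only [eval, Expr.eval, h1, h2]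
  | ite e f g he hf hg =>
    obtain ⟨p, hp⟩ := he hd s
    obtain ⟨q, hq⟩ := hf hd s
    obtain ⟨r, hr⟩ := hg hd s
    refine ⟨p + q + r + Polynomial.C 3, fun μ => ?_⟩
    obtain ⟨k, hk, μ1, r1, v1, p1⟩ := hp μ
    have h0 : μ1.reg 0 = μ.reg 0 := p1.var 0 hd
    by_cases hc : e.eval d μ.env μ.cell = 0
    · obtain ⟨l, hl, μ2, r2, v2, p2⟩ := hr μ1
      refine ⟨_, ?_, μ2, r1.seq (Runs.ite_false (v1.trans hc) r2), ?_, p1.trans p2 le_rfl⟩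
      · rw [h0] at hl
        simp only [Polynomial.eval_add, Polynomial.eval_C, Expr.cost]
        omega
      · rw [v2, p1.eval_eq hd]
        simp only [eval, hc, ne_eq, not_true_eq_false, if_false]
    · obtain ⟨l, hl, μ2, r2, v2, p2⟩ := hq μ1
      refine ⟨_, ?_, μ2, r1.seq (Runs.ite_true (by rw [Expr.eval, v1]; exact hc) r2), ?_,
        p1.trans p2 le_rfl⟩
      · rw [h0] at hl
        simp only [Polynomial.eval_add, Polynomial.eval_C, Expr.cost]
        omega
      · rw [v2, p1.eval_eq hd]
        simp only [eval, hc, ne_eq, not_false_eq_true, if_true]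
  | sum e he =>
    obtain ⟨p, hp⟩ := he (Nat.succ_pos d) (s + 1)
    refine ⟨Polynomial.X * (p + Polynomial.C 15) + Polynomial.C 13, fun μ => ?_⟩
    set n := μ.reg 0 with hn
    set μ0 := μ.setReg (2 * s + 1) 0 with hμ0
    have hP0 : Preserves d s μ μ0 := Preserves.setReg _ _
    let v : ℕ → ℕ := fun i => e.eval (d + 1) (bind μ.env d i) μ.cell
    -- Slot `s` accumulates the partial sum; the body is compiled at depth `d + 1` and slot `s + 1`,
    -- so it spares both the loop variable and the accumulator.
    let I : ℕ → Memory → Prop := fun i ν => Preserves d s μ ν ∧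
      ν.reg (2 * s + 1) = ∑ l ∈ Finset.range i, v l
    have hset : ∀ i l ν, I i ν → I i (ν.setReg (2 * d) l) := by
      rintro i l ν ⟨h1, h2⟩
      refine ⟨⟨fun x hx => ?_, fun x hx => ?_, h1.cell⟩, ?_⟩
      · rw [reg_setReg_of_ne _ _ (by omega)]; exact h1.var x hx
      · rw [reg_setReg_of_ne _ _ (by omega)]; exact h1.tmp x hx
      · rw [reg_setReg_of_ne _ _ (by omega)]; exact h2
    have key := exists_runs_forProg (y := 2 * d) (n := n) (q := p.eval n + 5) (I := I) (by omega)
      (body := .seq (e.compile (d + 1) (s + 1))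
        (.setReg (2 * s + 1) (.add (.reg (2 * s + 1)) (.reg (2 * (s + 1) + 1)))))
      (fun i hi ν h0 hy hI => ?_) (μ := μ0) (by rw [hμ0, reg_setReg_of_ne _ _ (by omega)]) ?_
    · obtain ⟨k, hk, μ', hr, h0, h1, h2⟩ := key
      refine ⟨_, ?_, μ', (Runs.setReg _ _ _).seq hr, h2, h1⟩
      simp only [Polynomial.eval_add, Polynomial.eval_C, Polynomial.eval_X, Polynomial.eval_mul,
        Expr.cost]
      have : n * (Polynomial.eval n p + 5 + 10) = n * (Polynomial.eval n p + 15) := by ring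
      omega
    · obtain ⟨k, hk, ν1, hr, hv, hP⟩ := hp ν
      rw [h0] at hk
      have hx : ∀ x < d + 1, ν.env x = bind μ.env d i x := by
        intro x hx
        unfold bind
        split_ifs with ex
        · rw [ex]; exact hy
        · exact hI.1.var x (by omega)
      have hv' : ν1.reg (2 * (s + 1) + 1) = v i := by
        rw [hv]
        exact e.eval_congr (Nat.succ_pos d) hx fun a _ => congrFun hI.1.cell a
      have hacc : ν1.reg (2 * s + 1) = ∑ l ∈ Finset.range i, v l := by
        rw [hP.tmp s (Nat.lt_succ_self s)]; exact hI.2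
      refine ⟨_, ?_, _, hr.seq (Runs.setReg _ _ _), ?_, ?_, hset _ _ _ ⟨⟨fun x hx => ?_,
        fun x hx => ?_, ?_⟩, ?_⟩⟩
      · simp only [Expr.cost]; omega
      · rw [reg_setReg_of_ne _ _ (by omega)]
        exact (hP.var 0 (Nat.succ_pos d)).trans h0
      · rw [reg_setReg_of_ne _ _ (by omega)]
        exact (hP.var d (Nat.lt_succ_self d)).trans hy
      · rw [reg_setReg_of_ne _ _ (by omega)]
        exact (hP.var x (by omega)).trans (hI.1.var x hx)
      · rw [reg_setReg_of_ne _ _ (by omega)]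
        exact (hP.tmp x (by omega)).trans (hI.1.tmp x hx)
      · exact hP.cell.trans hI.1.cell
      · rw [reg_setReg_self, Finset.sum_range_succ]
        simp only [Expr.eval]
        rw [hacc, hv']
    · refine hset _ _ _ ⟨hP0, ?_⟩
      rw [hμ0, reg_setReg_self]; rfl

/-! ### Bounded programs and their compilation -/

/-- Programs with bounded loops. In depth `d`, `upd a e` gives every entry of array `a` with
indices below `n` the value of `e`, in which the indices are the variables `d` and `d + 1`, and
`loop p` runs `p` for every value below `n` of variable `d`. -/
inductive BProg where
  | skip
  | upd (a : ℕ) (e : BExpr)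
  | seq (p q : BProg)
  | ite (e : BExpr) (p q : BProg)
  | loop (p : BProg)

/-- `F (m - 1) (… (F 0 c))`. -/
def iterFrom {α : Type*} (F : ℕ → α → α) (c : α) : ℕ → α
  | 0 => c
  | m + 1 => F m (iterFrom F c m)

/-- The arrays after the run of a program. -/
def BProg.sem : BProg → ℕ → (ℕ → ℕ) → Cells → Cells
  | .skip, _, _, c => c
  | .upd a e, d, ρ, c => fun b i j =>
      if (b = a ∨ b = scratch) ∧ i < ρ 0 ∧ j < ρ 0 then
        e.eval (d + 2) (bind (bind ρ d i) (d + 1) j) c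
      else c b i j
  | .seq p q, d, ρ, c => q.sem d ρ (p.sem d ρ c)
  | .ite e p q, d, ρ, c => if e.eval d ρ c ≠ 0 then p.sem d ρ c else q.sem d ρ c
  | .loop p, d, ρ, c => iterFrom (fun i c => p.sem (d + 1) (bind ρ d i) c) c (ρ 0)

theorem BProg.sem_congr (p : BProg) {d : ℕ} (hd : 0 < d) {ρ ρ' : ℕ → ℕ} (c : Cells)
    (h : ∀ x < d, ρ x = ρ' x) : p.sem d ρ c = p.sem d ρ' c := by
  induction p generalizing d ρ ρ' c with
  | skip => rfl
  | upd a e =>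
    funext b i j
    simp only [sem]
    rw [h 0 hd, e.eval_congr (Nat.succ_pos (d + 1)) (bind_congr (bind_congr h i) j) fun _ _ => rfl]
  | seq p q hp hq => simp only [sem]; rw [hp hd c h, hq hd _ h]
  | ite e p q hp hq =>
    simp only [sem]
    rw [hp hd c h, hq hd c h, e.eval_congr hd h fun _ _ => rfl]
  | loop p hp =>
    simp only [sem]
    rw [h 0 hd]
    congr 1
    funext i c
    exact hp (Nat.succ_pos d) c (bind_congr h i)

/-- The translation of a program. -/
def BProg.compile : BProg → ℕ → Prog
  | .skip, _ => .skip
  | .upd a e, d => .seq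
      (forProg (2 * d) (forProg (2 * (d + 1)) (.seq (e.compile (d + 2) 0)
        (.setCell scratch (.reg (2 * d)) (.reg (2 * (d + 1))) (.reg 1)))))
      (forProg (2 * d) (forProg (2 * (d + 1))
        (.setCell a (.reg (2 * d)) (.reg (2 * (d + 1)))
          (.cell scratch (.reg (2 * d)) (.reg (2 * (d + 1)))))))
  | .seq p q, d => .seq (p.compile d) (q.compile d)
  | .ite e p q, d => .seq (e.compile d 0) (.ite (.reg 1) (p.compile d) (q.compile d))
  | .loop p, d => forProg (2 * d) (p.compile (d + 1))

/-- The program `c` transforms the arrays by `F` in polynomial time, without changes to variables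
below `d`. -/
def Transforms (F : (ℕ → ℕ) → Cells → Cells) (d : ℕ) (c : Prog) : Prop :=
  ∃ p : Polynomial ℕ, ∀ μ : Memory, ∃ k ≤ p.eval (μ.reg 0), ∃ μ', Runs c μ k μ' ∧
    μ'.cell = F μ.env μ.cell ∧ ∀ x < d, μ'.reg (2 * x) = μ.reg (2 * x)

open Classical in
/-- The arrays `c` with the value `v i j` for the entries `a[i, j]` with `P i j`. -/
noncomputable def setWhere (c : Cells) (a : ℕ) (v : ℕ → ℕ → ℕ) (P : ℕ → ℕ → Prop) : Cells :=
  fun b i j => if b = a ∧ P i j then v i j else c b i j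

/-- Two nested loops fill the array row by row. The body may assume only that some set `P` of
entries has been written, which describes every intermediate state. -/
theorem exists_runs_matrix {d n q a : ℕ} (hd : 0 < d) {body : Prog} {c : Cells} {v : ℕ → ℕ → ℕ}
    {ρ : ℕ → ℕ} (hbody : ∀ i < n, ∀ j < n, ∀ μ : Memory, (∀ x < d, μ.reg (2 * x) = ρ x) →
      μ.reg (2 * d) = i → μ.reg (2 * (d + 1)) = j → ∀ P, μ.cell = setWhere c a v P →
      ∃ k ≤ q, ∃ μ', Runs body μ k μ' ∧ μ'.cell = (μ.setCell a i j (v i j)).cell ∧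
        ∀ x < d + 2, μ'.reg (2 * x) = μ.reg (2 * x))
    (h0 : ρ 0 = n) {μ : Memory} (hρ : ∀ x < d, μ.reg (2 * x) = ρ x) (hc : μ.cell = c) :
    ∃ k ≤ n * (n * (q + 10) + 10 + 10) + 10, ∃ μ',
      Runs (forProg (2 * d) (forProg (2 * (d + 1)) body)) μ k μ' ∧
      μ'.cell = setWhere c a v (fun i j => i < n ∧ j < n) ∧ ∀ x < d, μ'.reg (2 * x) = ρ x := by
  have hreg : ∀ (μ : Memory), (∀ x < d, μ.reg (2 * x) = ρ x) → μ.reg 0 = n :=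
    fun μ h => (h 0 hd).trans h0
  have hsetreg : ∀ (μ : Memory) (y w : ℕ), d ≤ y → (∀ x < d, μ.reg (2 * x) = ρ x) →
      ∀ x < d, (μ.setReg (2 * y) w).reg (2 * x) = ρ x := fun μ y w hy h x hx => by
    rw [reg_setReg_of_ne _ _ (by omega)]; exact h x hx
  let I : ℕ → Memory → Prop := fun i ν => (∀ x < d, ν.reg (2 * x) = ρ x) ∧
    ν.cell = setWhere c a v (fun k l => k < i ∧ l < n)
  have key := exists_runs_forProg (y := 2 * d) (n := n)
    (q := n * (q + 10) + 10) (I := I) (by omega) (body := forProg (2 * (d + 1)) body)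
    (fun i hi ν hν0 hνi hI => ?_) (hreg μ hρ)
    ⟨hsetreg μ d 0 le_rfl hρ, by
      funext b k l
      simp [setWhere, Memory.setReg, hc]⟩
  · obtain ⟨k, hk, μ', hr, _, h1, h2⟩ := key
    exact ⟨k, hk, μ', hr, h2, h1⟩
  -- Within row `i`: all earlier rows are complete, and so are the entries before column `j`.
  let J : ℕ → Memory → Prop := fun j ν => (∀ x < d, ν.reg (2 * x) = ρ x) ∧ ν.reg (2 * d) = i ∧
    ν.cell = setWhere c a v (fun k l => (k < i ∧ l < n) ∨ (k = i ∧ l < j))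
  have key := exists_runs_forProg (y := 2 * (d + 1)) (n := n)
    (q := q) (I := J) (by omega) (body := body)
    (fun j hj ν' hν0' hνj hJ => ?_) hν0
    ⟨hsetreg ν (d + 1) 0 (by omega) hI.1, by rw [reg_setReg_of_ne _ _ (by omega)]; exact hνi, by
      show ν.cell = _
      rw [hI.2]
      simp⟩
  · obtain ⟨k, hk, μ', hr, h0', h1, h2, h3⟩ := key
    refine ⟨k, hk, μ', hr, h0', h2, hsetreg μ' d _ le_rfl h1, ?_⟩
    show μ'.cell = _
    rw [h3]
    have : ∀ k l, ((k < i ∧ l < n) ∨ (k = i ∧ l < n)) ↔ (k < i + 1 ∧ l < n) := by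
      intro k l; omega
    simp only [this]
  · obtain ⟨k, hk, μ', hr, h1, h2⟩ := hbody i hi j hj ν' hJ.1 hJ.2.1 hνj _ hJ.2.2
    refine ⟨k, hk, μ', hr, (h2 0 (by omega)).trans hν0', (h2 (d + 1) (by omega)).trans hνj,
      hsetreg μ' (d + 1) _ (by omega) fun x hx => (h2 x (by omega)).trans (hJ.1 x hx), ?_, ?_⟩
    · rw [reg_setReg_of_ne _ _ (by omega)]
      exact (h2 d (by omega)).trans hJ.2.1
    · show μ'.cell = _
      rw [h1]
      funext b k l
      simp only [Memory.setCell, hJ.2.2, setWhere]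
      by_cases hb : b = a
      · by_cases hk : k = i
        · subst hk
          by_cases hl : l = j
          · subst hl; simp [hb]
          · have : l < j + 1 ↔ l < j := by omega
            simp [hb, hl, this]
        · simp [hk]
      · simp [hb]

theorem BProg.transforms_compile (p : BProg) {d : ℕ} (hd : 0 < d) :
    Transforms (fun ρ c => p.sem d ρ c) d (p.compile d) := by
  induction p generalizing d with
  | skip => exact ⟨Polynomial.C 1, fun μ => ⟨_, by simp, μ, Runs.skip μ, rfl, fun _ _ => rfl⟩⟩
  | upd a e =>
    obtain ⟨p, hp⟩ := e.evaluates_compile (d := d + 2) (by omega) 0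
    refine ⟨Polynomial.X * (Polynomial.X * (p + Polynomial.C 20) + Polynomial.C 20) +
      Polynomial.X * (Polynomial.X * Polynomial.C 20 + Polynomial.C 20) + Polynomial.C 30,
      fun μ => ?_⟩
    set n := μ.reg 0 with hn
    let v : ℕ → ℕ → ℕ := fun i j => e.eval (d + 2) (bind (bind μ.env d i) (d + 1) j) μ.cell
    -- An update is simultaneous, although the expression may read the array being changed. So all
    -- values are first written to `scratch` and copied by a second pass.
    obtain ⟨k, hk, μ1, r1, c1, x1⟩ := exists_runs_matrix (d := d) (n := n) (q := p.eval n + 10)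
      (a := scratch) (v := v) (c := μ.cell) (ρ := μ.env) hd (body := .seq (e.compile (d + 2) 0)
        (.setCell scratch (.reg (2 * d)) (.reg (2 * (d + 1))) (.reg 1)))
      (fun i hi j hj ν hx hνi hνj P hc => by
        obtain ⟨k, hk, ν', hr, hv, hP⟩ := hp ν
        rw [show ν.reg 0 = n from hx 0 hd] at hk
        refine ⟨_, ?_, _, hr.seq (Runs.setCell _ _ _ _ _), ?_, fun x hx => hP.var x hx⟩
        · simp only [Expr.cost]; omega
        · have e1 : ν'.reg (2 * d) = i := (hP.var d (by omega)).trans hνi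
          have e2 : ν'.reg (2 * (d + 1)) = j := (hP.var (d + 1) (by omega)).trans hνj
          have e3 : ν'.reg 1 = v i j := by
            -- Entries of `scratch` already written do not matter, since no expression can read
            -- them.
            refine hv.trans (e.eval_congr (by omega) ?_ ?_)
            · intro x hx'
              unfold bind
              split_ifs with ex ex'
              · rw [ex]; exact hνj
              · rw [ex']; exact hνi
              · exact hx x (by omega)
            · intro b hb
              rw [hc]
              funext k l
              simp [setWhere, hb]
          simp only [Expr.eval, e1, e2, e3, Memory.setCell, hP.cell])
      rfl (fun _ _ => rfl) rfl
    obtain ⟨l, hl, μ2, r2, c2, x2⟩ := exists_runs_matrix (d := d) (n := n) (q := 10)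
      (a := a) (v := v) (c := μ1.cell) (ρ := μ.env) hd
      (body := .setCell a (.reg (2 * d)) (.reg (2 * (d + 1)))
        (.cell scratch (.reg (2 * d)) (.reg (2 * (d + 1)))))
      (fun i hi j hj ν hx hνi hνj P hc => by
        refine ⟨_, ?_, _, Runs.setCell _ _ _ _ _, ?_, fun x hx => rfl⟩
        · simp [Expr.cost]
        · have e1 : ν.cell scratch i j = v i j := by
            rw [hc, c1]
            simp [setWhere, hi, hj]
          simp only [Expr.eval, hνi, hνj, e1])
      rfl x1 rfl
    refine ⟨_, ?_, μ2, r1.seq r2, ?_, x2⟩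
    · simp only [Polynomial.eval_add, Polynomial.eval_C, Polynomial.eval_X, Polynomial.eval_mul]
      have e1 : n * (n * (Polynomial.eval n p + 10 + 10) + 10 + 10) =
        n * (n * (Polynomial.eval n p + 20) + 20) := by ring
      have e2 : n * (n * (10 + 10) + 10 + 10) = n * (n * 20 + 20) := by ring
      omega
    · rw [c2, c1]
      funext b i j
      change setWhere (setWhere μ.cell scratch v fun i j => i < n ∧ j < n) a v
        (fun i j => i < n ∧ j < n) b i j =
        if (b = a ∨ b = scratch) ∧ i < n ∧ j < n then v i j else μ.cell b i j
      unfold setWhere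
      by_cases hb : b = a <;> by_cases hs : b = scratch <;> by_cases hij : i < n ∧ j < n <;>
        simp [hb, hs, hij]
  | seq p q hp hq =>
    obtain ⟨p1, h1⟩ := hp hd
    obtain ⟨p2, h2⟩ := hq hd
    refine ⟨p1 + p2 + Polynomial.C 1, fun μ => ?_⟩
    obtain ⟨k, hk, μ1, r1, c1, x1⟩ := h1 μ
    obtain ⟨l, hl, μ2, r2, c2, x2⟩ := h2 μ1
    refine ⟨_, ?_, μ2, r1.seq r2, ?_, fun x hx => (x2 x hx).trans (x1 x hx)⟩
    · rw [show μ1.reg 0 = μ.reg 0 from x1 0 hd] at hl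
      simp only [Polynomial.eval_add, Polynomial.eval_C]
      omega
    · rw [c2, c1]
      exact q.sem_congr hd _ x1
  | ite e p q hp hq =>
    obtain ⟨p0, h0⟩ := e.evaluates_compile hd 0
    obtain ⟨p1, h1⟩ := hp hd
    obtain ⟨p2, h2⟩ := hq hd
    refine ⟨p0 + p1 + p2 + Polynomial.C 3, fun μ => ?_⟩
    obtain ⟨k, hk, μ1, r1, v1, P1⟩ := h0 μ
    have hn : μ1.reg 0 = μ.reg 0 := P1.var 0 hd
    by_cases hc : e.eval d μ.env μ.cell = 0
    · obtain ⟨l, hl, μ2, r2, c2, x2⟩ := h2 μ1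
      refine ⟨_, ?_, μ2, r1.seq (Runs.ite_false (v1.trans hc) r2), ?_,
        fun x hx => (x2 x hx).trans (P1.var x hx)⟩
      · rw [hn] at hl
        simp only [Polynomial.eval_add, Polynomial.eval_C, Expr.cost]
        omega
      · simp only [sem, hc, ne_eq, not_true_eq_false, if_false]
        rw [c2, P1.cell]
        exact q.sem_congr hd _ P1.var
    · obtain ⟨l, hl, μ2, r2, c2, x2⟩ := h1 μ1
      refine ⟨_, ?_, μ2, r1.seq (Runs.ite_true (by rw [Expr.eval]; exact v1.trans_ne hc) r2), ?_,
        fun x hx => (x2 x hx).trans (P1.var x hx)⟩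
      · rw [hn] at hl
        simp only [Polynomial.eval_add, Polynomial.eval_C, Expr.cost]
        omega
      · simp only [sem, hc, ne_eq, not_false_eq_true, if_true]
        rw [c2, P1.cell]
        exact p.sem_congr hd _ P1.var
  | loop p hp =>
    obtain ⟨p1, h1⟩ := hp (Nat.succ_pos d)
    refine ⟨Polynomial.X * (p1 + Polynomial.C 10) + Polynomial.C 10, fun μ => ?_⟩
    let I : ℕ → Memory → Prop := fun i ν => (∀ x < d, ν.reg (2 * x) = μ.reg (2 * x)) ∧
      ν.cell = iterFrom (fun i c => p.sem (d + 1) (bind μ.env d i) c) μ.cell i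
    have hset : ∀ (ν : Memory) (w : ℕ), (∀ x < d, ν.reg (2 * x) = μ.reg (2 * x)) →
        ∀ x < d, (ν.setReg (2 * d) w).reg (2 * x) = μ.reg (2 * x) := fun ν w h x hx => by
      rw [reg_setReg_of_ne _ _ (by omega)]; exact h x hx
    have key := exists_runs_forProg (y := 2 * d) (n := μ.reg 0)
      (q := p1.eval (μ.reg 0)) (I := I) (by omega) (body := p.compile (d + 1))
      (fun i hi ν h0 hy hI => ?_) rfl ⟨hset μ 0 fun _ _ => rfl, rfl⟩
    · obtain ⟨k, hk, μ', hr, _, h2, h3⟩ := key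
      refine ⟨k, ?_, μ', hr, h3, h2⟩
      simpa only [Polynomial.eval_add, Polynomial.eval_C, Polynomial.eval_X, Polynomial.eval_mul]
        using hk
    · obtain ⟨k, hk, ν', hr, hc, hx⟩ := h1 ν
      rw [h0] at hk
      refine ⟨k, hk, ν', hr, (hx 0 (by omega)).trans h0, (hx d (by omega)).trans hy,
        hset _ _ fun x hxd => (hx x (by omega)).trans (hI.1 x hxd), ?_⟩
      show ν'.cell = _
      rw [hc, hI.2]
      refine p.sem_congr (Nat.succ_pos d) _ fun x hx' => ?_
      unfold bind
      split_ifs with ex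
      · rw [ex]; exact hy
      · exact hI.1 x (by omega)

/-! ### Bounded formulas -/

namespace BExpr

/-- The expression has a value other than zero. -/
def Holds (e : BExpr) (d : ℕ) (ρ : ℕ → ℕ) (c : Cells) : Prop := e.eval d ρ c ≠ 0

def and (e f : BExpr) : BExpr := ite e f (const 0)
def or (e f : BExpr) : BExpr := ite e (const 1) f
def not (e : BExpr) : BExpr := ite e (const 0) (const 1)
-- Truncated subtraction is nonzero exactly for a strict inequality; likewise below, a sum of
-- naturals is nonzero exactly when some term is.
def lt (e f : BExpr) : BExpr := sub f e
def eq (e f : BExpr) : BExpr := not (add (sub e f) (sub f e))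
def ex (e : BExpr) : BExpr := sum e
def count (e : BExpr) : BExpr := sum (ite e (const 1) (const 0))

/-- The entry `a[i, 0]`. -/
def unary (a : ℕ) (i : BExpr) : BExpr := cell a i (const 0)

variable {e f g : BExpr} {d : ℕ} {ρ : ℕ → ℕ} {c : Cells}

theorem holds_and : (and e f).Holds d ρ c ↔ e.Holds d ρ c ∧ f.Holds d ρ c := by
  simp only [Holds, and, eval]
  split_ifs with h <;> simp [h]

theorem holds_or : (or e f).Holds d ρ c ↔ e.Holds d ρ c ∨ f.Holds d ρ c := by
  simp only [Holds, or, eval]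
  split_ifs with h
  · simp [h]
  · rw [not_not] at h; simp [h]

theorem holds_not : (not e).Holds d ρ c ↔ ¬ e.Holds d ρ c := by
  simp only [Holds, not, eval]
  split_ifs with h <;> simp [h]

theorem holds_lt : (lt e f).Holds d ρ c ↔ e.eval d ρ c < f.eval d ρ c := by
  simp only [Holds, lt, eval]
  omega

theorem holds_eq : (eq e f).Holds d ρ c ↔ e.eval d ρ c = f.eval d ρ c := by
  rw [eq, holds_not]
  simp only [Holds, eval]
  omega

theorem holds_ite : (ite e f g).Holds d ρ c ↔
    (e.Holds d ρ c ∧ f.Holds d ρ c) ∨ (¬ e.Holds d ρ c ∧ g.Holds d ρ c) := by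
  simp only [Holds, eval]
  split_ifs with h
  · simp [h]
  · rw [not_not] at h; simp [h]

theorem holds_ex (n : ℕ) (h : ρ 0 = n) :
    (ex e).Holds d ρ c ↔ ∃ i : Fin n, e.Holds (d + 1) (bind ρ d i) c := by
  simp only [Holds, ex, eval, h, ne_eq, Finset.sum_eq_zero_iff, Finset.mem_range]
  push Not
  exact ⟨fun ⟨i, hi, h⟩ => ⟨⟨i, hi⟩, h⟩, fun ⟨i, h⟩ => ⟨i, i.2, h⟩⟩

theorem eval_count (n : ℕ) (h : ρ 0 = n) :
    (count e).eval d ρ c = {i : Fin n | e.Holds (d + 1) (bind ρ d i) c}.ncard := by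
  classical
  simp only [count, eval, h]
  rw [← Fin.sum_univ_eq_sum_range
    (fun i => if e.eval (d + 1) (bind ρ d i) c ≠ 0 then 1 else 0) n, Finset.sum_boole,
    Set.ncard_eq_toFinset_card']
  rw [Nat.cast_id]
  congr 1
  ext i
  rw [Set.mem_toFinset, Finset.mem_filter]
  exact ⟨fun h => h.2, fun h => ⟨Finset.mem_univ _, h⟩⟩

theorem holds_cell {a : ℕ} (ha : a ≠ scratch) :
    (cell a e f).Holds d ρ c ↔ c a (e.eval d ρ c) (f.eval d ρ c) ≠ 0 := by
  simp [Holds, eval, ha]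

theorem holds_unary {a : ℕ} (ha : a ≠ scratch) :
    (unary a e).Holds d ρ c ↔ c a (e.eval d ρ c) 0 ≠ 0 := by
  simp [Holds, unary, eval, ha]

theorem eval_const {k : ℕ} : (const k).eval d ρ c = k := rfl

theorem eval_var {x : ℕ} (h : x < d) : (var x).eval d ρ c = ρ x := if_pos h

end BExpr

theorem bind_self (ρ : ℕ → ℕ) (d i : ℕ) : bind ρ d i d = i := if_pos rfl

theorem bind_of_ne (ρ : ℕ → ℕ) {d x : ℕ} (i : ℕ) (h : x ≠ d) : bind ρ d i x = ρ x := if_neg h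

theorem BProg.sem_upd_self {a : ℕ} {e : BExpr} {d : ℕ} {ρ : ℕ → ℕ} {c : Cells} {n : ℕ}
    (h : ρ 0 = n) (i j : Fin n) : (BProg.upd a e).sem d ρ c a i j ≠ 0 ↔
      e.Holds (d + 2) (bind (bind ρ d i) (d + 1) j) c := by
  simp [sem, BExpr.Holds, h]

theorem BProg.sem_upd_of_ne {a b : ℕ} {e : BExpr} {d : ℕ} {ρ : ℕ → ℕ} {c : Cells}
    (h : b ≠ a) (h' : b ≠ scratch) : (BProg.upd a e).sem d ρ c b = c b := by
  funext i j
  simp [sem, h, h']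

theorem iterFrom_induction {α : Type*} {F : ℕ → α → α} {c : α} {n : ℕ} (P : ℕ → α → Prop)
    (h0 : P 0 c) (hs : ∀ m < n, ∀ c, P m c → P (m + 1) (F m c)) : P n (iterFrom F c n) := by
  suffices h : ∀ m ≤ n, P m (iterFrom F c m) from h n le_rfl
  intro m
  induction m with
  | zero => exact fun _ => h0
  | succ m ih => exact fun hm => hs m hm _ (ih (Nat.le_of_lt hm))

/-! ### The program that eliminates vertices of degree at most two -/

open BExpr in
/-- Vertex `x` is present and has degree at most two. -/
def elimExpr (D : ℕ) (x : BExpr) : BExpr :=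
  and (unary 4 x) (lt (count (and (cell 3 x (var D)) (unary 4 (var D)))) (const 3))

open BExpr in
/-- Eliminates the least vertex of degree at most two. -/
def elimBody (d : ℕ) : BProg :=
  .seq (.upd 5 (and (elimExpr (d + 2) (var d))
    (not (ex (and (lt (var (d + 2)) (var d)) (elimExpr (d + 3) (var (d + 2))))))))
  (.seq (.upd 6 (ite (unary 5 (var d))
    (or (eq (var d) (var (d + 1))) (and (cell 3 (var d) (var (d + 1))) (unary 4 (var (d + 1)))))
    (cell 6 (var d) (var (d + 1)))))
  (.seq (.upd 3 (or (cell 3 (var d) (var (d + 1)))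
    (and (not (eq (var d) (var (d + 1)))) (ex (and (unary 5 (var (d + 2)))
      (and (and (cell 3 (var (d + 2)) (var d)) (unary 4 (var d)))
        (and (cell 3 (var (d + 2)) (var (d + 1))) (unary 4 (var (d + 1))))))))))
  (.upd 4 (and (unary 4 (var d)) (not (unary 5 (var d)))))))

/-- Eliminates vertices of degree at most two as long as possible. -/
def elimProg (d : ℕ) : BProg := .loop (elimBody (d + 1))

/-- Arrays `3`, `4` and `6` hold the graph `H`, the vertices present and the recorded bags. -/
structure ElimRep {n : ℕ} (c : Cells) (H : SimpleGraph (Fin n)) (A : Set (Fin n))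
    (B : Fin n → Set (Fin n)) : Prop where
  graph : ∀ i j : Fin n, c 3 i j ≠ 0 ↔ H.Adj i j
  alive : ∀ i : Fin n, c 4 i 0 ≠ 0 ↔ i ∈ A
  bag : ∀ i j : Fin n, c 6 i j ≠ 0 ↔ j ∈ B i

theorem BProg.sem_upd_unary {a : ℕ} {e : BExpr} {d : ℕ} {ρ : ℕ → ℕ} {c : Cells} {n : ℕ}
    (h : ρ 0 = n) (i : Fin n) : (BProg.upd a e).sem d ρ c a i 0 ≠ 0 ↔
      e.Holds (d + 2) (bind (bind ρ d i) (d + 1) 0) c :=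
  sem_upd_self h i ⟨0, i.pos⟩

theorem holds_elimExpr {n : ℕ} {c : Cells} {H : SimpleGraph (Fin n)} {A : Set (Fin n)}
    {B : Fin n → Set (Fin n)} (h : ElimRep c H A B) {D : ℕ} {ρ : ℕ → ℕ}
    (hρ : ρ 0 = n) {x : ℕ} (hx : x < D) {v : Fin n} (hv : ρ x = v) :
    (elimExpr D (.var x)).Holds D ρ c ↔ v ∈ A ∧ (nbrs H A v).encard ≤ 2 := by
  have h1 : ((nbrs H A v).encard ≤ 2) ↔ (nbrs H A v).ncard < 3 := by
    rw [← Set.Finite.cast_ncard_eq (Set.toFinite _)]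
    rw [Nat.lt_succ_iff]
    exact_mod_cast Iff.rfl
  have h2 : {i : Fin n | H.Adj v i ∧ i ∈ A} = nbrs H A v := by
    ext i; exact and_comm
  have hx' : x < D + 1 := by omega
  have hxD : x ≠ D := by omega
  simp only [elimExpr, BExpr.holds_and, BExpr.holds_lt, BExpr.eval_count n hρ,
    BExpr.holds_unary (show 4 ≠ scratch by decide), BExpr.holds_cell (show 3 ≠ scratch by decide),
    BExpr.eval_var hx, BExpr.eval_var hx', BExpr.eval_var (Nat.lt_succ_self D), BExpr.eval_const,
    bind_self, bind_of_ne _ _ hxD, hv, h.graph, h.alive, h1, h2]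

theorem elimBody_frame {d : ℕ} {ρ : ℕ → ℕ} {c : Cells} {b : ℕ} (h3 : b ≠ 3) (h4 : b ≠ 4)
    (h5 : b ≠ 5) (h6 : b ≠ 6) (hs : b ≠ scratch) : (elimBody d).sem d ρ c b = c b := by
  simp only [elimBody, BProg.sem.eq_3]
  rw [BProg.sem_upd_of_ne h4 hs, BProg.sem_upd_of_ne h3 hs, BProg.sem_upd_of_ne h6 hs,
    BProg.sem_upd_of_ne h5 hs]

/-- Array `5` marks the least eligible vertex, so at most one is eliminated per round. The bag and
the fill edges refer to the vertices present before the removal, which is why array `4` changes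
last. -/
theorem elimBody_spec {n : ℕ} {c : Cells} {H : SimpleGraph (Fin n)} {A : Set (Fin n)}
    {B : Fin n → Set (Fin n)} (h : ElimRep c H A B) {d : ℕ} (hd : d ≠ 0) {ρ : ℕ → ℕ}
    (hρ : ρ 0 = n) :
    (∃ v ∈ A, (nbrs H A v).encard ≤ 2 ∧ ElimRep ((elimBody d).sem d ρ c) (fill H A v) (A \ {v})
      (Function.update B v (insert v (nbrs H A v)))) ∨
    ((∀ v ∈ A, ¬ (nbrs H A v).encard ≤ 2) ∧ ElimRep ((elimBody d).sem d ρ c) H A B) := by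
  classical
  have hd1 : (0 : ℕ) ≠ d + 1 := by omega
  have hd2 : (0 : ℕ) ≠ d + 2 := by omega
  have hρ2 : ∀ i j, bind (bind ρ d i) (d + 1) j 0 = n := fun i j => by
    rw [bind_of_ne _ _ hd1, bind_of_ne _ _ hd.symm, hρ]
  have e1 : d < d + 2 := by omega
  have e2 : d + 1 < d + 2 := by omega
  have e3 : d < d + 3 := by omega
  have e4 : d + 1 < d + 3 := by omega
  have e5 : d + 2 < d + 3 := by omega
  have b1 : ∀ i j, bind (bind ρ d i) (d + 1) j d = i := fun i j => by
    rw [bind_of_ne _ _ (by omega), bind_self]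
  have b2 : ∀ i j, bind (bind ρ d i) (d + 1) j (d + 1) = j := fun i j => bind_self _ _ _
  have b3 : ∀ i j k, bind (bind (bind ρ d i) (d + 1) j) (d + 2) k d = i := fun i j k => by
    rw [bind_of_ne _ _ (by omega), b1]
  have b4 : ∀ i j k, bind (bind (bind ρ d i) (d + 1) j) (d + 2) k (d + 1) = j := fun i j k => by
    rw [bind_of_ne _ _ (by omega), b2]
  have b5 : ∀ i j k, bind (bind (bind ρ d i) (d + 1) j) (d + 2) k (d + 2) = k := fun i j k =>
    bind_self _ _ _
  have hρ3 : ∀ i j k, bind (bind (bind ρ d i) (d + 1) j) (d + 2) k 0 = n := fun i j k => by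
    rw [bind_of_ne _ _ hd2, hρ2]
  simp only [elimBody, BProg.sem.eq_3]
  set c1 := BProg.sem (.upd 5 _) d ρ c with hc1
  set c2 := BProg.sem (.upd 6 _) d ρ c1 with hc2
  set c3 := BProg.sem (.upd 3 _) d ρ c2 with hc3
  set c4 := BProg.sem (.upd 4 _) d ρ c3 with hc4
  let E : Fin n → Prop := fun v => v ∈ A ∧ (nbrs H A v).encard ≤ 2
  have f13 : c1 3 = c 3 := BProg.sem_upd_of_ne (by decide) (by decide)
  have f14 : c1 4 = c 4 := BProg.sem_upd_of_ne (by decide) (by decide)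
  have f16 : c1 6 = c 6 := BProg.sem_upd_of_ne (by decide) (by decide)
  have f23 : c2 3 = c1 3 := BProg.sem_upd_of_ne (by decide) (by decide)
  have f24 : c2 4 = c1 4 := BProg.sem_upd_of_ne (by decide) (by decide)
  have f25 : c2 5 = c1 5 := BProg.sem_upd_of_ne (by decide) (by decide)
  have f34 : c3 4 = c2 4 := BProg.sem_upd_of_ne (by decide) (by decide)
  have f35 : c3 5 = c2 5 := BProg.sem_upd_of_ne (by decide) (by decide)
  have f36 : c3 6 = c2 6 := BProg.sem_upd_of_ne (by decide) (by decide)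
  have f43 : c4 3 = c3 3 := BProg.sem_upd_of_ne (by decide) (by decide)
  have f46 : c4 6 = c3 6 := BProg.sem_upd_of_ne (by decide) (by decide)
  have s5 : ∀ i : Fin n, c1 5 i 0 ≠ 0 ↔ E i ∧ ¬ ∃ y : Fin n, (y : ℕ) < i ∧ E y := by
    intro i
    rw [hc1, BProg.sem_upd_unary hρ, BExpr.holds_and, BExpr.holds_not,
      BExpr.holds_ex n (hρ2 _ _), holds_elimExpr h (hρ2 _ _) e1 (b1 _ _)]
    refine and_congr Iff.rfl (not_congr (exists_congr fun y => ?_))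
    rw [BExpr.holds_and, BExpr.holds_lt, BExpr.eval_var e3, BExpr.eval_var e5, b3, b5]
    exact and_congr Iff.rfl (holds_elimExpr h (hρ3 _ _ _) e5 (b5 _ _ _))
  have s6 : ∀ i j : Fin n, c2 6 i j ≠ 0 ↔ (c1 5 i 0 ≠ 0 ∧ (i = j ∨ (H.Adj i j ∧ j ∈ A))) ∨
      (¬ c1 5 i 0 ≠ 0 ∧ j ∈ B i) := by
    intro i j
    rw [hc2, BProg.sem_upd_self hρ, BExpr.holds_ite, BExpr.holds_or, BExpr.holds_eq,
      BExpr.holds_and, BExpr.holds_unary (by decide), BExpr.holds_unary (by decide),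
      BExpr.holds_cell (by decide), BExpr.holds_cell (by decide), BExpr.eval_var e1,
      BExpr.eval_var e2, b1, b2, f13, f14, f16, h.graph, h.alive, h.bag, Fin.ext_iff]
  have s3 : ∀ i j : Fin n, c3 3 i j ≠ 0 ↔ H.Adj i j ∨ (i ≠ j ∧ ∃ y : Fin n, c1 5 y 0 ≠ 0 ∧
      (H.Adj y i ∧ i ∈ A) ∧ (H.Adj y j ∧ j ∈ A)) := by
    intro i j
    rw [hc3, BProg.sem_upd_self hρ, BExpr.holds_or, BExpr.holds_and, BExpr.holds_not,
      BExpr.holds_eq, BExpr.holds_ex n (hρ2 _ _), BExpr.holds_cell (by decide), BExpr.eval_var e1,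
      BExpr.eval_var e2, b1, b2, f23, f13, h.graph, Ne, Fin.ext_iff]
    refine or_congr Iff.rfl (and_congr Iff.rfl (exists_congr fun y => ?_))
    rw [BExpr.holds_and, BExpr.holds_and, BExpr.holds_and, BExpr.holds_and,
      BExpr.holds_unary (by decide), BExpr.holds_unary (by decide), BExpr.holds_unary (by decide),
      BExpr.holds_cell (by decide), BExpr.holds_cell (by decide), BExpr.eval_var e3,
      BExpr.eval_var e4, BExpr.eval_var e5, b3, b4, b5, f25, f24, f14, f23, f13, h.graph, h.graph,
      h.alive, h.alive]
  have s4 : ∀ i : Fin n, c4 4 i 0 ≠ 0 ↔ i ∈ A ∧ ¬ c1 5 i 0 ≠ 0 := by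
    intro i
    rw [hc4, BProg.sem_upd_unary hρ, BExpr.holds_and, BExpr.holds_not,
      BExpr.holds_unary (by decide), BExpr.holds_unary (by decide), BExpr.eval_var e1, b1,
      f34, f24, f14, f35, f25, h.alive]
  by_cases hE : ∃ v, E v
  · obtain ⟨v, hv, hmin⟩ := Set.exists_min_image {v | E v} (fun v : Fin n => (v : ℕ))
      (Set.toFinite _) hE
    have hsel : ∀ i : Fin n, c1 5 i 0 ≠ 0 ↔ i = v := by
      intro i
      rw [s5]
      constructor
      · rintro ⟨hi, hlt⟩
        refine Fin.ext (le_antisymm (not_lt.1 fun hc => hlt ⟨v, hc, hv⟩) (hmin i hi))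
      · rintro rfl
        exact ⟨hv, fun ⟨y, hy, hyE⟩ => absurd (hmin y hyE) (not_le.2 hy)⟩
    refine Or.inl ⟨v, hv.1, hv.2, fun i j => ?_, fun i => ?_, fun i j => ?_⟩
    · rw [f43, s3]
      simp only [hsel, exists_eq_left]
      constructor
      · rintro (hij | ⟨hij, h1, h2⟩)
        · exact le_fill hij
        · exact ⟨hij, Or.inr ⟨⟨h1.2, h1.1⟩, ⟨h2.2, h2.1⟩⟩⟩
      · rintro ⟨hij, hadj | ⟨h1, h2⟩⟩
        · exact Or.inl hadj
        · exact Or.inr ⟨hij, ⟨h1.2, h1.1⟩, ⟨h2.2, h2.1⟩⟩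
    · rw [s4, hsel]; rfl
    · rw [f46, f36, s6, hsel]
      by_cases hi : i = v
      · subst hi
        rw [Function.update_self]
        simp only [true_and, not_true_eq_false, false_and, or_false]
        exact or_congr eq_comm and_comm
      · rw [Function.update_of_ne hi]
        simp [hi]
  · push Not at hE
    have hsel : ∀ i : Fin n, ¬ c1 5 i 0 ≠ 0 := fun i hi => hE i ((s5 i).1 hi).1
    refine Or.inr ⟨fun v hv hd => hE v ⟨hv, hd⟩, fun i j => ?_, fun i => ?_, fun i j => ?_⟩
    · rw [f43, s3]; simp only [hsel, false_and, exists_false, and_false, or_false]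
    · rw [s4]; simp only [hsel, not_false_eq_true, and_true]
    · rw [f46, f36, s6]; simp only [hsel, false_and, false_or, not_false_eq_true, true_and]

/-- A sequence of eliminations of vertices of degree at most two, with a record of the bags. -/
inductive ElimRun {n : ℕ} (G : SimpleGraph (Fin n)) (A₀ : Set (Fin n))
    (B₀ : Fin n → Set (Fin n)) :
    SimpleGraph (Fin n) → Set (Fin n) → (Fin n → Set (Fin n)) → Prop where
  | refl : ElimRun G A₀ B₀ G A₀ B₀
  | step {H : SimpleGraph (Fin n)} {A : Set (Fin n)} {B : Fin n → Set (Fin n)} {v : Fin n} :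
      ElimRun G A₀ B₀ H A B → v ∈ A → (nbrs H A v).encard ≤ 2 →
      ElimRun G A₀ B₀ (fill H A v) (A \ {v}) (Function.update B v (insert v (nbrs H A v)))

theorem ElimRun.reducible_iff {n : ℕ} {G H : SimpleGraph (Fin n)} {A₀ A : Set (Fin n)}
    {B₀ B : Fin n → Set (Fin n)} (h : ElimRun G A₀ B₀ H A B) :
    Reducible H A ↔ Reducible G A₀ := by
  induction h with
  | refl => rfl
  | step _ hv hN ih => rw [Reducible.fill_iff hv hN, ih]

/-- Each of the `n` rounds eliminates a vertex or finds none eligible, after which nothing changes.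
A reducible nonempty set always has an eligible vertex, so being stuck there refutes reducibility.
-/
theorem elimProg_spec {n : ℕ} {c : Cells} {G : SimpleGraph (Fin n)} {A₀ : Set (Fin n)}
    {B₀ : Fin n → Set (Fin n)} (h : ElimRep c G A₀ B₀) {d : ℕ} (hd : d ≠ 0) {ρ : ℕ → ℕ}
    (hρ : ρ 0 = n) :
    (∃ H A B, ElimRun G A₀ B₀ H A B ∧ ElimRep ((elimProg d).sem d ρ c) H A B ∧
      (A = ∅ ↔ Reducible G A₀)) ∧
    ∀ b, b ≠ 3 → b ≠ 4 → b ≠ 5 → b ≠ 6 → b ≠ scratch → (elimProg d).sem d ρ c b = c b := by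
  have key : (∃ H A B, ElimRun G A₀ B₀ H A B ∧ ElimRep ((elimProg d).sem d ρ c) H A B ∧
      (A.ncard + n ≤ A₀.ncard ∨ ∀ v ∈ A, ¬ (nbrs H A v).encard ≤ 2)) ∧
      ∀ b, b ≠ 3 → b ≠ 4 → b ≠ 5 → b ≠ 6 → b ≠ scratch → (elimProg d).sem d ρ c b = c b := by
    simp only [elimProg, BProg.sem, hρ]
    refine iterFrom_induction (fun m c' => (∃ H A B, ElimRun G A₀ B₀ H A B ∧ ElimRep c' H A B ∧
      (A.ncard + m ≤ A₀.ncard ∨ ∀ v ∈ A, ¬ (nbrs H A v).encard ≤ 2)) ∧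
      ∀ b, b ≠ 3 → b ≠ 4 → b ≠ 5 → b ≠ 6 → b ≠ scratch → c' b = c b) ?_ ?_
    · exact ⟨⟨G, A₀, B₀, ElimRun.refl, h, Or.inl le_rfl⟩, fun _ _ _ _ _ _ => rfl⟩
    · rintro m _ c' ⟨⟨H, A, B, hr, hrep, hm⟩, hf⟩
      refine ⟨?_, fun b h3 h4 h5 h6 hs =>
        (elimBody_frame h3 h4 h5 h6 hs).trans (hf b h3 h4 h5 h6 hs)⟩
      rcases elimBody_spec hrep (d := d + 1) (Nat.succ_ne_zero d) (ρ := bind ρ d m)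
        ((bind_of_ne _ _ hd.symm).trans hρ) with ⟨v, hv, hN, hrep'⟩ | ⟨hstuck, hrep'⟩
      · refine ⟨_, _, _, hr.step hv hN, hrep', Or.inl ?_⟩
        rcases hm with hm | hm
        · have := Set.ncard_sdiff_singleton_add_one hv
          omega
        · exact absurd hN (hm v hv)
      · exact ⟨H, A, B, hr, hrep', Or.inr hstuck⟩
  obtain ⟨⟨H, A, B, hr, hrep, hm⟩, hf⟩ := key
  refine ⟨⟨H, A, B, hr, hrep, ?_⟩, hf⟩
  rw [← hr.reducible_iff]
  constructor
  · rintro rfl; exact Reducible.empty H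
  · intro hred
    rcases hm with hm | hm
    · have h1 : A₀.ncard ≤ n := by
        simpa using Set.ncard_le_card A₀
      rw [← Set.ncard_eq_zero (Set.toFinite A)]
      omega
    · by_contra hne
      obtain ⟨v, hv, hN⟩ := hred.exists_degree_le_two (Set.nonempty_iff_ne_empty.2 hne)
      exact hm v hv hN

/-! ### The tree decomposition recorded by an elimination -/

/-- A rank that drops towards the parent brings every node to the root; the depth is the number of
steps needed. -/
theorem exists_rooted_parentTree {ι : Type*} {ρ : ι} {par : ι → ι} (h : par ρ = ρ) (rank : ι → ℕ)
    (hrank : ∀ i, i ≠ ρ → rank (par i) < rank i) :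
    ∃ dep, Rooted (parentTree ρ par) ρ par dep := by
  classical
  have hex : ∀ i, ∃ k, par^[k] i = ρ := by
    intro i
    induction hr : rank i using Nat.strong_induction_on generalizing i with
    | _ r ih =>
      by_cases hi : i = ρ
      · exact ⟨0, hi⟩
      · obtain ⟨k, hk⟩ := ih _ (hr ▸ hrank i hi) (par i) rfl
        exact ⟨k + 1, hk⟩
  refine ⟨fun i => Nat.find (hex i), rooted_parentTree h ?_ fun i hi => ?_⟩
  · exact (Nat.find_eq_zero _).2 rfl
  · exact Nat.find_comp_succ (hex i) (hex (par i)) hi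

section Elimination
variable {n : ℕ} {G H : SimpleGraph (Fin n)} {A₀ A : Set (Fin n)} {B : Fin n → Set (Fin n)}

/-- The invariants of an elimination: `rk v` is the time at which `v` was eliminated, and `B v` is
its closed neighbourhood at that time. -/
structure ElimInvariant (G : SimpleGraph (Fin n)) (A₀ : Set (Fin n)) (H : SimpleGraph (Fin n))
    (A : Set (Fin n)) (B : Fin n → Set (Fin n)) (rk : Fin n → ℕ) (K : ℕ) : Prop where
  sub : A ⊆ A₀
  bag_self : ∀ v ∈ A₀, v ∉ A → v ∈ B v
  bag_sub : ∀ v, B v ⊆ A₀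
  bag_card : ∀ v, (B v).encard ≤ 3
  bag_empty : ∀ v, (v ∈ A₀ → v ∈ A) → B v = ∅
  rank_lt : ∀ v, v ∉ A → rk v < K
  rank_up : ∀ v, v ∉ A → ∀ u ∈ B v, u ≠ v → u ∈ A ∨ rk v < rk u
  clique : ∀ v, ∀ u ∈ B v, ∀ w ∈ B v, u ≠ w → H.Adj u w
  edge : ∀ u ∈ A₀, ∀ w ∈ A₀, H.Adj u w → (u ∈ A ∧ w ∈ A) ∨ u ∈ B w ∨ w ∈ B u
  le : ∀ u w, G.Adj u w → H.Adj u w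

theorem ElimRun.exists_invariant (h : ElimRun G A₀ (fun _ => ∅) H A B) :
    ∃ rk K, ElimInvariant G A₀ H A B rk K := by
  induction h with
  | refl =>
    exact ⟨fun _ => 0, 1, le_rfl, fun v h h' => absurd h h', by simp, by simp, by simp, by simp,
      by simp, by simp, fun u hu w hw _ => Or.inl ⟨hu, hw⟩, fun _ _ h => h⟩
  | @step H A B v _ hv hN ih =>
    obtain ⟨rk, K, h⟩ := ih
    have hv0 : v ∈ A₀ := h.sub hv
    have hNv : ∀ u ∈ nbrs H A v, u ≠ v := fun u hu e => notMem_nbrs (e ▸ hu)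
    have hA : ∀ u, u ≠ v → u ∉ A \ {v} → u ∉ A := fun u hu hc h => hc ⟨h, hu⟩
    -- `K` exceeds all earlier elimination times and becomes that of `v`.
    refine ⟨Function.update rk v K, K + 1, Set.sdiff_subset.trans h.sub, ?_, ?_, ?_, ?_, ?_, ?_,
      ?_, ?_, fun u w huw => le_fill (h.le u w huw)⟩
    · intro u hu huA
      by_cases e : u = v
      · subst e; rw [Function.update_self]; exact Or.inl rfl
      · rw [Function.update_of_ne e]; exact h.bag_self u hu (hA u e huA)
    · intro u
      by_cases e : u = v
      · subst e; rw [Function.update_self]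
        exact Set.insert_subset hv0 fun w hw => h.sub hw.1
      · rw [Function.update_of_ne e]; exact h.bag_sub u
    · intro u
      by_cases e : u = v
      · subst e; rw [Function.update_self]
        refine (Set.encard_insert_le _ _).trans ((add_le_add_left hN 1).trans ?_)
        norm_num
      · rw [Function.update_of_ne e]; exact h.bag_card u
    · intro u hu
      have e : u ≠ v := by
        rintro rfl
        exact (hu hv0).2 rfl
      rw [Function.update_of_ne e]
      exact h.bag_empty u fun hu0 => (hu hu0).1
    · intro u hu
      by_cases e : u = v
      · subst e; rw [Function.update_self]; exact Nat.lt_succ_self K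
      · rw [Function.update_of_ne e]; exact (h.rank_lt u (hA u e hu)).trans (Nat.lt_succ_self K)
    · intro u hu w hw hwu
      by_cases e : u = v
      · subst e
        rw [Function.update_self] at hw
        have hw := hw.resolve_left hwu
        exact Or.inl ⟨hw.1, hwu⟩
      · rw [Function.update_of_ne e] at hw ⊢
        by_cases ew : w = v
        · subst ew
          rw [Function.update_self]
          exact Or.inr (h.rank_lt u (hA u e hu))
        · rw [Function.update_of_ne ew]
          exact (h.rank_up u (hA u e hu) w hw hwu).imp (fun h => ⟨h, ew⟩) id
    · intro u x hx y hy hxy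
      by_cases e : u = v
      · subst e
        rw [Function.update_self] at hx hy
        rcases hx with rfl | hx <;> rcases hy with rfl | hy
        · exact absurd rfl hxy
        · exact le_fill hy.2
        · exact le_fill hx.2.symm
        · exact ⟨hxy, Or.inr ⟨hx, hy⟩⟩
      · rw [Function.update_of_ne e] at hx hy
        exact le_fill (h.clique u x hx y hy hxy)
    · rintro x hx y hy ⟨hxy, hadj | ⟨h1, h2⟩⟩
      · by_cases ex : x = v
        · subst ex
          rw [Function.update_self, Function.update_of_ne (Ne.symm hxy)]
          rcases h.edge x hx y hy hadj with h' | h' | h'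
          · exact Or.inr (Or.inr (Or.inr ⟨h'.2, hadj⟩))
          · exact Or.inr (Or.inl h')
          · rw [h.bag_empty x fun _ => hv] at h'
            exact absurd h' (Set.notMem_empty y)
        · rw [Function.update_of_ne ex]
          by_cases ey : y = v
          · subst ey
            rw [Function.update_self]
            rcases h.edge x hx y hy hadj with h' | h' | h'
            · exact Or.inr (Or.inl (Or.inr ⟨h'.1, hadj.symm⟩))
            · rw [h.bag_empty y fun _ => hv] at h'
              exact absurd h' (Set.notMem_empty x)
            · exact Or.inr (Or.inr h')
          · rw [Function.update_of_ne ey]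
            exact (h.edge x hx y hy hadj).imp (fun h => ⟨⟨h.1, ex⟩, ⟨h.2, ey⟩⟩) id
      · exact Or.inl ⟨⟨h1.1, hNv x h1⟩, ⟨h2.1, hNv y h2⟩⟩

/-- Node `p` is the parent of node `v` in the tree with root `ρ` for the bags `B`. -/
def IsParent (B : Fin n → Set (Fin n)) (ρ v p : Fin n) : Prop :=
  (p ∈ B v ∧ p ≠ v ∧ ∀ w ∈ B v, w ≠ v → w ∈ B p) ∨ ((∀ w ∈ B v, w = v) ∧ p = ρ ∧ v ≠ p)

/-- The parent of `v` is the member of `B v` other than `v` that was eliminated first: the rest of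
`B v` had become a clique, so it lies in the bag of the parent as well. Nodes without such a member
hang from `ρ`, whose bag is empty. `IsParent` expresses this without elimination times, which the
program does not record. -/
theorem ElimInvariant.exists_isTreeDecompositionOn {rk : Fin n → ℕ} {K : ℕ}
    (h : ElimInvariant G A₀ H ∅ B rk K) {ρ : Fin n} (hρ : ρ ∉ A₀) :
    ∃ par dep, Rooted (parentTree ρ par) ρ par dep ∧
      (∀ v p, IsParent B ρ v p ↔ v ≠ ρ ∧ par v = p) ∧
      IsTreeDecompositionOn G A₀ (parentTree ρ par) B := by
  classical
  have hBρ : B ρ = ∅ := h.bag_empty ρ fun h' => absurd h' hρ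
  have hmem : ∀ u v, u ∈ B v → v ∈ A₀ := fun u v hu => by
    by_contra hc
    rw [h.bag_empty v fun h' => absurd h' hc] at hu
    exact hu
  have hup : ∀ v, ∀ u ∈ B v, u ≠ v → rk v < rk u := fun v u hu hne =>
    (h.rank_up v (Set.notMem_empty v) u hu hne).resolve_left (Set.notMem_empty u)
  have hadj : ∀ v, ∀ u ∈ B v, ∀ w ∈ B v, u ≠ w → u ∈ B w ∨ w ∈ B u := fun v u hu w hw hne =>
    (h.edge u (h.bag_sub v hu) w (h.bag_sub v hw) (h.clique v u hu w hw hne)).resolve_left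
      fun h' => h'.1
  have hex : ∀ v, v ≠ ρ → ∃ p, IsParent B ρ v p := by
    intro v hv
    by_cases hB : ∀ w ∈ B v, w = v
    · exact ⟨ρ, Or.inr ⟨hB, rfl, hv⟩⟩
    · push Not at hB
      obtain ⟨p, ⟨hp, hpv⟩, hmin⟩ := Set.exists_min_image {w | w ∈ B v ∧ w ≠ v} rk
        (Set.toFinite _) hB
      refine ⟨p, Or.inl ⟨hp, hpv, fun w hw hwv => ?_⟩⟩
      by_cases e : w = p
      · rw [e]; exact h.bag_self p (h.bag_sub v hp) (Set.notMem_empty p)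
      · refine (hadj v w hw p hp e).resolve_right fun hc => ?_
        exact absurd (hmin w ⟨hw, hwv⟩) (not_le.2 (hup w p hc (Ne.symm e)))
  -- Two different parents from `B v` would lie in each other's bags, so each would have been
  -- eliminated before the other.
  have huniq : ∀ v p q, IsParent B ρ v p → IsParent B ρ v q → p = q := by
    rintro v p q (⟨h1, h2, h3⟩ | ⟨h1, h2, h3⟩) (⟨h4, h5, h6⟩ | ⟨h4, h5, h6⟩)
    · by_contra hne
      have hlt := hup p q (h3 q h4 h5) (Ne.symm hne)
      exact absurd (hup q p (h6 p h1 h2) hne) (not_lt.2 hlt.le)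
    · exact absurd (h4 p h1) h2
    · exact absurd (h1 q h4) h5
    · exact h2.trans h5.symm
  have hroot : ∀ p, ¬ IsParent B ρ ρ p := by
    rintro p (⟨h1, _⟩ | ⟨_, h2, h3⟩)
    · rw [hBρ] at h1; exact h1
    · exact h3 h2.symm
  choose! f hf using hex
  let par : Fin n → Fin n := fun v => if v = ρ then ρ else f v
  have hpar : ∀ v p, IsParent B ρ v p ↔ v ≠ ρ ∧ par v = p := by
    intro v p
    constructor
    · intro hp
      have hv : v ≠ ρ := by rintro rfl; exact hroot p hp
      refine ⟨hv, ?_⟩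
      simp only [par, hv, if_false]
      exact huniq v _ _ (hf v hv) hp
    · rintro ⟨hv, rfl⟩
      simp only [par, hv, if_false]
      exact hf v hv
  -- Parents other than the root are eliminated later than their children, so time counted backwards
  -- from `K + 1` drops; it is positive away from the root.
  obtain ⟨dep, hdep⟩ := exists_rooted_parentTree (ρ := ρ) (par := par) (by simp [par])
    (fun v => if v = ρ then 0 else K + 1 - rk v) (fun v hv => by
      have hK := h.rank_lt v (Set.notMem_empty v)
      simp only [hv, if_false]
      rcases (hpar v _).2 ⟨hv, rfl⟩ with ⟨h1, h2, _⟩ | ⟨_, h2, _⟩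
      · have := hup v _ h1 h2
        have := h.rank_lt (par v) (Set.notMem_empty _)
        split_ifs <;> omega
      · rw [if_pos h2]; omega)
  refine ⟨par, dep, hdep, hpar, hdep.isTree, h.bag_sub, h.bag_card, ?_, ?_⟩
  · intro u hu v hv huv
    have huu := h.bag_self u hu (Set.notMem_empty u)
    have hvv := h.bag_self v hv (Set.notMem_empty v)
    rcases (h.edge u hu v hv (h.le u v huv)).resolve_left (fun h' => h'.1) with h' | h'
    · exact ⟨v, h', hvv⟩
    · exact ⟨u, huu, h'⟩
  · intro v hv
    -- The nodes of `v` have `v` itself on top: a different node with `v` in its bag passes it on to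
    -- its parent.
    refine hdep.connected_of_top (τ := v) (h.bag_self v hv (Set.notMem_empty v)) fun s hs hsv => ?_
    have hs' : v ∈ B s := hs
    have hsρ : s ≠ ρ := by rintro rfl; exact hρ (hmem _ _ hs')
    refine ⟨hsρ, ?_⟩
    rcases (hpar s _).2 ⟨hsρ, rfl⟩ with ⟨_, _, h3⟩ | ⟨h1, _⟩
    · exact h3 v hs' (Ne.symm hsv)
    · exact absurd (h1 v hs').symm hsv

end Elimination

/-! ### The main loop -/

namespace BExpr

/-- Vertex `i` is the root, the least vertex in `X`. Variable `D` is bound. -/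
def rootExpr (D : ℕ) (i : BExpr) : BExpr :=
  and (unary 1 i) (not (ex (and (lt (var D) i) (unary 1 (var D)))))

/-- The parent of node `i` is node `p`. Variable `D` is bound. -/
def parentExpr (D : ℕ) (i p : BExpr) : BExpr :=
  or
    (and (cell 7 i p) (and (not (eq p i))
      (not (ex (and (cell 7 i (var D)) (and (not (eq (var D) i)) (not (cell 7 p (var D)))))))))
    (and (not (ex (and (cell 7 i (var D)) (not (eq (var D) i)))))
      (and (rootExpr D p) (not (eq i p))))

/-- The number of ancestors of node `i`. -/
def depthExpr (D : ℕ) (i : BExpr) : BExpr := count (cell 8 i (var D))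

/-- Node `i` is a candidate of the largest depth. -/
def bestExpr (D : ℕ) (i : BExpr) : BExpr :=
  and (unary 9 i)
    (not (ex (and (unary 9 (var D)) (lt (depthExpr (D + 1) i) (depthExpr (D + 1) (var D))))))

end BExpr

open BExpr in
/-- Computes the bags of the tree decomposition. -/
def decompositionProg : BProg :=
  .seq (.upd 3 (cell 0 (var 2) (var 3)))
  (.seq (.upd 4 (not (unary 1 (var 2))))
  (.seq (elimProg 2) (.upd 7 (cell 6 (var 2) (var 3)))))

open BExpr in
/-- Computes the ancestors of all nodes. -/
def ancestorProg : BProg :=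
  .loop (.upd 8 (or (eq (var 3) (var 4))
    (ex (and (parentExpr 6 (var 3) (var 5)) (cell 8 (var 5) (var 4))))))

open BExpr in
/-- Computes whether the nodes are candidates. -/
def candidateProg : BProg :=
  .loop (.seq (.upd 3 (cell 0 (var 4) (var 5)))
    (.seq (.upd 4 (or (unary 1 (var 4))
      (ex (and (cell 8 (var 6) (var 3)) (cell 7 (var 6) (var 4))))))
    (.seq (elimProg 4)
    (.upd 9 (ite (eq (var 4) (var 3)) (ex (unary 4 (var 6))) (unary 9 (var 4)))))))

open BExpr in
/-- One iteration of the main loop. -/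
def iterationProg : BProg :=
  .seq candidateProg
  (.ite (and (not (lt (var 1) (var 2))) (ex (unary 9 (var 3))))
    (.seq (.upd 5 (and (bestExpr 5 (var 3))
      (not (ex (and (lt (var 5) (var 3)) (bestExpr 6 (var 5)))))))
    (.seq (.upd 2 (or (unary 2 (var 3)) (ex (and (unary 5 (var 5)) (cell 7 (var 5) (var 3))))))
    (.upd 7 (and (cell 7 (var 3) (var 4)) (not (ex (and (unary 5 (var 5))
      (ex (and (cell 8 (var 6) (var 5)) (cell 7 (var 6) (var 4)))))))))))
    .skip)

/-- The algorithm. -/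
def mainProg : BProg :=
  .seq decompositionProg (.seq ancestorProg (.loop iterationProg))

/-! ### What the stages of the main program compute -/

section Program
variable {n : ℕ} {G : SimpleGraph (Fin n)} {X : Set (Fin n)} {c : Cells} {ρ : ℕ → ℕ}

/-- Array `0` holds the graph `G` and array `1` the set `X`. -/
structure InputRep (c : Cells) (G : SimpleGraph (Fin n)) (X : Set (Fin n)) : Prop where
  graph : ∀ i j : Fin n, c 0 i j ≠ 0 ↔ G.Adj i j
  modulator : ∀ i : Fin n, c 1 i 0 ≠ 0 ↔ i ∈ X

theorem InputRep.congr {c' : Cells} (h : InputRep c G X) (h0 : c' 0 = c 0) (h1 : c' 1 = c 1) :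
    InputRep c' G X :=
  ⟨fun i j => by rw [h0, h.graph], fun i => by rw [h1, h.modulator]⟩

theorem inputRep_inputMemory (t : ℕ) : InputRep (inputMemory G t X).cell G X := by
  constructor
  · intro i j
    simp [inputMemory, Fin.val_inj]
  · intro i
    simp [inputMemory, Fin.val_inj]

theorem inputMemory_cell_eq_zero {t a : ℕ} (h0 : a ≠ 0) (h1 : a ≠ 1) (i j : ℕ) :
    (inputMemory G t X).cell a i j = 0 := by
  simp [inputMemory, h0, h1]

theorem decompositionProg_spec (h : InputRep c G X) (h6 : ∀ i j, c 6 i j = 0)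
    (hX : Reducible G Xᶜ) (hρ : ρ 0 = n) :
    (∃ H B, ElimRun G Xᶜ (fun _ => ∅) H ∅ B ∧
      ∀ i j : Fin n, decompositionProg.sem 2 ρ c 7 i j ≠ 0 ↔ j ∈ B i) ∧
    ∀ b, b ≠ 3 → b ≠ 4 → b ≠ 5 → b ≠ 6 → b ≠ 7 → b ≠ scratch →
      decompositionProg.sem 2 ρ c b = c b := by
  simp only [decompositionProg, BProg.sem.eq_3]
  set c1 := BProg.sem (.upd 3 _) 2 ρ c with hc1
  set c2 := BProg.sem (.upd 4 _) 2 ρ c1 with hc2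
  have f1 : ∀ b, b ≠ 3 → b ≠ scratch → c1 b = c b := fun b => BProg.sem_upd_of_ne
  have f2 : ∀ b, b ≠ 4 → b ≠ scratch → c2 b = c1 b := fun b => BProg.sem_upd_of_ne
  have hrep : ElimRep c2 G Xᶜ (fun _ => ∅) := by
    refine ⟨fun i j => ?_, fun i => ?_, fun i j => ?_⟩
    · rw [f2 3 (by decide) (by decide), hc1, BProg.sem_upd_self hρ,
        BExpr.holds_cell (by decide)]
      simp [BExpr.eval, bind, ← h.graph]
    · rw [hc2, BProg.sem_upd_unary hρ, BExpr.holds_not, BExpr.holds_unary (by decide),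
        f1 1 (by decide) (by decide)]
      simp [BExpr.eval, bind, ← h.modulator]
    · rw [f2 6 (by decide) (by decide), f1 6 (by decide) (by decide), h6]
      simp
  obtain ⟨⟨H, A, B, hrun, hrep', hA⟩, f3⟩ := elimProg_spec hrep (d := 2) (by decide) hρ
  obtain rfl := hA.2 hX
  refine ⟨⟨H, B, hrun, fun i j => ?_⟩, fun b h3 h4 h5 h6 h7 hs => ?_⟩
  · rw [BProg.sem_upd_self hρ, BExpr.holds_cell (by decide)]
    simp [BExpr.eval, bind, ← hrep'.bag]
  · rw [BProg.sem_upd_of_ne h7 hs, f3 b h3 h4 h5 h6 hs, f2 b h4 hs, f1 b h3 hs]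

theorem holds_parentExpr {B : Fin n → Set (Fin n)} {o : Fin n}
    (h1 : ∀ i : Fin n, c 1 i 0 ≠ 0 ↔ i ∈ X) (h7 : ∀ i j : Fin n, c 7 i j ≠ 0 ↔ j ∈ B i) (ho : o ∈ X) (hmin : ∀ i ∈ X, o ≤ i)
    {i p : Fin n} (hρ : ρ 0 = n) (hi : ρ 3 = i) (hp : ρ 5 = p) :
    (BExpr.parentExpr 6 (.var 3) (.var 5)).Holds 6 ρ c ↔ IsParent B o i p := by
  have hroot : (p ∈ X ∧ ¬ ∃ y : Fin n, (y : ℕ) < p ∧ y ∈ X) ↔ p = o := by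
    constructor
    · rintro ⟨h, h'⟩
      exact le_antisymm (not_lt.1 fun hc => h' ⟨o, hc, ho⟩) (hmin p h)
    · rintro rfl
      exact ⟨ho, fun ⟨y, hy, hyX⟩ => absurd (hmin y hyX) (not_le.2 hy)⟩
  rw [BExpr.parentExpr, BExpr.rootExpr]
  simp only [BExpr.holds_and, BExpr.holds_or, BExpr.holds_not, BExpr.holds_eq, BExpr.holds_lt,
    BExpr.holds_ex n hρ, BExpr.holds_cell (show 7 ≠ scratch by decide),
    BExpr.holds_unary (show 1 ≠ scratch by decide)]
  simp only [BExpr.eval, bind, hi, hp, h1, h7, if_true, if_false, Nat.reduceLT, Nat.reduceAdd,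
    Nat.reduceEqDiff, Fin.val_inj]
  rw [hroot, IsParent]
  push Not
  rfl

/-- After `m` rounds the array holds the ancestor pairs whose depths differ by less than `m`. Paths
have fewer than `n` edges, so `n` rounds find all pairs. -/
theorem ancestorProg_spec {B : Fin n → Set (Fin n)} {o : Fin n} {par : Fin n → Fin n}
    {dep : Fin n → ℕ}
    (h1 : ∀ i : Fin n, c 1 i 0 ≠ 0 ↔ i ∈ X) (h7 : ∀ i j : Fin n, c 7 i j ≠ 0 ↔ j ∈ B i)
    (h8 : ∀ i j, c 8 i j = 0) (ho : o ∈ X) (hmin : ∀ i ∈ X, o ≤ i)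
    (hr : Rooted (parentTree o par) o par dep)
    (hpar : ∀ v p, IsParent B o v p ↔ v ≠ o ∧ par v = p) (hρ : ρ 0 = n) :
    (∀ i j : Fin n, ancestorProg.sem 2 ρ c 8 i j ≠ 0 ↔ Rooted.Anc par i j) ∧
    ∀ b, b ≠ 8 → b ≠ scratch → ancestorProg.sem 2 ρ c b = c b := by
  have key : (∀ i j : Fin n, ancestorProg.sem 2 ρ c 8 i j ≠ 0 ↔
      Rooted.Anc par i j ∧ dep i < dep j + n) ∧
      ∀ b, b ≠ 8 → b ≠ scratch → ancestorProg.sem 2 ρ c b = c b := by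
    simp only [ancestorProg, BProg.sem.eq_5, hρ]
    refine iterFrom_induction (fun m (c' : Cells) => (∀ i j : Fin n, c' 8 i j ≠ 0 ↔
      Rooted.Anc par i j ∧ dep i < dep j + m) ∧ ∀ b, b ≠ 8 → b ≠ scratch → c' b = c b) ?_ ?_
    · refine ⟨fun i j => ?_, fun _ _ _ => rfl⟩
      rw [h8]
      refine ⟨fun h => absurd rfl h, fun h => ?_⟩
      have := hr.dep_le_of_anc h.1
      omega
    · rintro m _ c' ⟨hc, hf⟩
      have h1' : ∀ i : Fin n, c' 1 i 0 ≠ 0 ↔ i ∈ X := fun i => by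
        rw [hf 1 (by decide) (by decide), h1]
      have h7' : ∀ i j : Fin n, c' 7 i j ≠ 0 ↔ j ∈ B i := fun i j => by
        rw [hf 7 (by decide) (by decide), h7]
      refine ⟨fun i j => ?_, fun b h8 hs => (BProg.sem_upd_of_ne h8 hs).trans (hf b h8 hs)⟩
      have hρ' : bind ρ 2 m 0 = n := hρ
      have hρ2 : bind (bind (bind ρ 2 m) 3 i) (3 + 1) j 0 = n := hρ
      rw [BProg.sem_upd_self hρ', BExpr.holds_or, BExpr.holds_eq, BExpr.holds_ex n hρ2]
      have hstep : ∀ p : Fin n, ((BExpr.parentExpr 6 (.var 3) (.var 5)).and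
          (.cell 8 (.var 5) (.var 4))).Holds (3 + 2 + 1)
          (bind (bind (bind (bind ρ 2 m) 3 i) (3 + 1) j) (3 + 2) p) c' ↔
          (i ≠ o ∧ par i = p) ∧ Rooted.Anc par p j ∧ dep p < dep j + m := by
        intro p
        rw [BExpr.holds_and, holds_parentExpr (i := i) (p := p)
          (ρ := bind (bind (bind (bind ρ 2 m) 3 i) (3 + 1) j) (3 + 2) p)
          h1' h7' ho hmin hρ rfl rfl, hpar,
          BExpr.holds_cell (by decide), ← hc]
        rfl
      simp only [hstep]
      change ((i : ℕ) = j ∨ _) ↔ _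
      rw [Fin.val_inj]
      constructor
      · rintro (rfl | ⟨p, ⟨hi, rfl⟩, ha, hd⟩)
        · exact ⟨Rooted.anc_refl _ _, by omega⟩
        · exact ⟨Rooted.anc_par ha, by rw [hr.dep_par i hi]; omega⟩
      · rintro ⟨ha, hd⟩
        rcases Rooted.anc_iff.1 ha with e | ha'
        · exact Or.inl e
        · by_cases hi : i = o
          · subst hi
            exact Or.inl (hr.anc_root_left.1 ha).symm
          · exact Or.inr ⟨par i, ⟨hi, rfl⟩, ha', by have := hr.dep_par i hi; omega⟩
  refine ⟨fun i j => ?_, key.2⟩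
  rw [key.1]
  refine and_iff_left_of_imp fun _ => ?_
  obtain ⟨p, hp, hl, _⟩ := hr.exists_path i
  have := hp.length_lt
  rw [Fintype.card_fin] at this
  omega

/-- The arrays hold the input, the ancestors of all nodes and the state `σ`. -/
structure LoopRep (c : Cells) (G : SimpleGraph (Fin n)) (X : Set (Fin n)) (par : Fin n → Fin n)
    (σ : LoopState (Fin n) (Fin n)) : Prop where
  input : InputRep c G X
  anc : ∀ i j : Fin n, c 8 i j ≠ 0 ↔ Rooted.Anc par i j
  bag : ∀ i j : Fin n, c 7 i j ≠ 0 ↔ j ∈ σ.bag i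
  out : ∀ i : Fin n, c 2 i 0 ≠ 0 ↔ i ∈ σ.out

theorem LoopRep.congr {par : Fin n → Fin n} {σ : LoopState (Fin n) (Fin n)} {c' : Cells}
    (h : LoopRep c G X par σ) (hf : ∀ b, b ≠ 3 → b ≠ 4 → b ≠ 5 → b ≠ 6 → b ≠ 9 → b ≠ scratch →
      c' b = c b) : LoopRep c' G X par σ := by
  have h0 := hf 0 (by decide) (by decide) (by decide) (by decide) (by decide) (by decide)
  have h1 := hf 1 (by decide) (by decide) (by decide) (by decide) (by decide) (by decide)
  have h2 := hf 2 (by decide) (by decide) (by decide) (by decide) (by decide) (by decide)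
  have h7 := hf 7 (by decide) (by decide) (by decide) (by decide) (by decide) (by decide)
  have h8 := hf 8 (by decide) (by decide) (by decide) (by decide) (by decide) (by decide)
  exact ⟨h.input.congr h0 h1, by rw [h8]; exact h.anc, by rw [h7]; exact h.bag,
    by rw [h2]; exact h.out⟩

theorem isCandidate_iff {par : Fin n → Fin n} {dep : Fin n → ℕ} {o : Fin n}
    {σ : LoopState (Fin n) (Fin n)} (hr : Rooted (parentTree o par) o par dep) {r : Fin n} :
    IsCandidate G X (parentTree o par) o σ r ↔
      ¬ Reducible G {i | i ∈ X ∨ ∃ y, Rooted.Anc par y r ∧ i ∈ σ.bag y} := by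
  rw [IsCandidate, two_lt_treewidth_induce_iff]
  have : bagUnion σ.bag (subtree (parentTree o par) o r) ∪ X =
      {i | i ∈ X ∨ ∃ y, Rooted.Anc par y r ∧ i ∈ σ.bag y} := by
    ext i
    simp only [Set.mem_union, mem_bagUnion, hr.mem_subtree hr.isTree]
    exact or_comm
  rw [this]

/-- Node `r` is a candidate iff elimination on the vertices of `X` and of the bags below `r` leaves
something over. -/
theorem candidateProg_spec {par : Fin n → Fin n} {dep : Fin n → ℕ} {o : Fin n}
    {σ : LoopState (Fin n) (Fin n)} (h : LoopRep c G X par σ)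
    (hr : Rooted (parentTree o par) o par dep) (hρ : ρ 0 = n) :
    (∀ r : Fin n, candidateProg.sem 3 ρ c 9 r 0 ≠ 0 ↔ IsCandidate G X (parentTree o par) o σ r) ∧
    ∀ b, b ≠ 3 → b ≠ 4 → b ≠ 5 → b ≠ 6 → b ≠ 9 → b ≠ scratch →
      candidateProg.sem 3 ρ c b = c b := by
  have key : (∀ r : Fin n, (r : ℕ) < n → (candidateProg.sem 3 ρ c 9 r 0 ≠ 0 ↔
      IsCandidate G X (parentTree o par) o σ r)) ∧
      ∀ b, b ≠ 3 → b ≠ 4 → b ≠ 5 → b ≠ 6 → b ≠ 9 → b ≠ scratch →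
        candidateProg.sem 3 ρ c b = c b := by
    simp only [candidateProg, BProg.sem.eq_5, BProg.sem.eq_3, hρ]
    refine iterFrom_induction (fun m (c' : Cells) => (∀ r : Fin n, (r : ℕ) < m → (c' 9 r 0 ≠ 0 ↔
      IsCandidate G X (parentTree o par) o σ r)) ∧
      ∀ b, b ≠ 3 → b ≠ 4 → b ≠ 5 → b ≠ 6 → b ≠ 9 → b ≠ scratch → c' b = c b) ?_ ?_
    · exact ⟨fun r hr => absurd hr (Nat.not_lt_zero _), fun _ _ _ _ _ _ _ => rfl⟩
    · rintro m hm c' ⟨hc, hf⟩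
      have h' := h.congr hf
      set r : Fin n := ⟨m, hm⟩ with hrdef
      have hρ' : bind ρ 3 m 0 = n := hρ
      have hρ2 : ∀ i j, bind (bind (bind ρ 3 m) 4 i) (4 + 1) j 0 = n := fun _ _ => hρ
      set c1 := BProg.sem (.upd 3 _) _ (bind ρ 3 m) c' with hc1
      set c2 := BProg.sem (.upd 4 _) _ (bind ρ 3 m) c1 with hc2
      have f1 : ∀ b, b ≠ 3 → b ≠ scratch → c1 b = c' b := fun b => BProg.sem_upd_of_ne
      have f2 : ∀ b, b ≠ 4 → b ≠ scratch → c2 b = c1 b := fun b => BProg.sem_upd_of_ne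
      -- Only the test matters here, so array `6` may start with bags from earlier eliminations.
      have hrep : ElimRep c2 G {i | i ∈ X ∨ ∃ y, Rooted.Anc par y r ∧ i ∈ σ.bag y}
          (fun i => {j | c2 6 i j ≠ 0}) := by
        refine ⟨fun i j => ?_, fun i => ?_, fun i j => Iff.rfl⟩
        · rw [f2 3 (by decide) (by decide), hc1, BProg.sem_upd_self hρ',
            BExpr.holds_cell (by decide), ← h'.input.graph]
          rfl
        · rw [hc2, BProg.sem_upd_unary hρ', BExpr.holds_or, BExpr.holds_unary (by decide),
            BExpr.holds_ex n (hρ2 _ _)]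
          simp only [BExpr.holds_and, BExpr.holds_cell (show 8 ≠ scratch by decide),
            BExpr.holds_cell (show 7 ≠ scratch by decide), f1 1 (by decide) (by decide),
            f1 8 (by decide) (by decide), f1 7 (by decide) (by decide)]
          change (c' 1 i 0 ≠ 0 ∨ ∃ y : Fin n, c' 8 y r ≠ 0 ∧ c' 7 y i ≠ 0) ↔ _
          simp only [h'.input.modulator, h'.anc, h'.bag]
          rfl
      obtain ⟨⟨H, A, B, hrun, hrep', hA⟩, f3⟩ := elimProg_spec hrep (d := 4) (by decide) hρ'
      refine ⟨fun i hi => ?_, fun b h3 h4 h5 h6 h9 hs => ?_⟩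
      · rw [BProg.sem_upd_unary hρ', BExpr.holds_ite, BExpr.holds_eq, BExpr.holds_ex n (hρ2 _ _),
          BExpr.holds_unary (by decide)]
        simp only [BExpr.holds_unary (show 4 ≠ scratch by decide)]
        rw [f3 9 (by decide) (by decide) (by decide) (by decide) (by decide),
          f2 9 (by decide) (by decide), f1 9 (by decide) (by decide)]
        change ((((i : ℕ) = m) ∧ ∃ y : Fin n, (elimProg 4).sem 4 (bind ρ 3 m) c2 4 y 0 ≠ 0) ∨
          ((¬ (i : ℕ) = m) ∧ c' 9 i 0 ≠ 0)) ↔ _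
        simp only [hrep'.alive]
        by_cases e : (i : ℕ) = m
        · have e' : i = r := Fin.ext e
          simp only [e, true_and, not_true_eq_false, false_and, or_false]
          rw [e', isCandidate_iff hr, ← hA]
          exact Set.nonempty_iff_ne_empty
        · simp only [e, false_and, not_false_eq_true, true_and, false_or]
          exact hc i (by omega)
      · rw [BProg.sem_upd_of_ne h9 hs, f3 b h3 h4 h5 h6 hs, f2 b h4 hs, f1 b h3 hs]
        exact hf b h3 h4 h5 h6 h9 hs
  exact ⟨fun r => key.1 r r.2, key.2⟩

/-- The program measures depth by counting ancestors, the nodes on the path to the root; the excess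
of one cancels in comparisons. -/
theorem Rooted.ncard_anc {ι : Type*} {T : SimpleGraph ι} {o : ι} {par : ι → ι} {dep : ι → ℕ}
    (hr : Rooted T o par dep) (v : ι) : {y | Rooted.Anc par v y}.ncard = dep v + 1 := by
  classical
  obtain ⟨p, hp, hl, hs⟩ := hr.exists_path v
  have : {y | Rooted.Anc par v y} = (p.support.toFinset : Set ι) := by
    ext y
    simp [hs]
  rw [this, Set.ncard_coe_finset, List.toFinset_card_of_nodup hp.support_nodup,
    SimpleGraph.Walk.length_support, hl]

theorem holds_bestExpr {par : Fin n → Fin n} {dep : Fin n → ℕ} {T : SimpleGraph (Fin n)}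
    {o : Fin n} {P : Fin n → Prop} (hr : Rooted T o par dep)
    (h8 : ∀ i j : Fin n, c 8 i j ≠ 0 ↔ Rooted.Anc par i j) (h9 : ∀ r : Fin n, c 9 r 0 ≠ 0 ↔ P r)
    {D x : ℕ} (hx : x < D) (hD : D ≠ 0) (hρ : ρ 0 = n) {i : Fin n} (hi : ρ x = i) :
    (BExpr.bestExpr D (.var x)).Holds D ρ c ↔ P i ∧ ∀ r, P r → dep r ≤ dep i := by
  have hρ' : ∀ k : ℕ, bind ρ D k 0 = n := fun k => (bind_of_ne _ _ hD.symm).trans hρ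
  have hx1 : x < D + 1 := by omega
  have hx2 : x < D + 1 + 1 := by omega
  have hxD : x ≠ D := by omega
  have hxD1 : x ≠ D + 1 := by omega
  have hD1 : D ≠ D + 1 := by omega
  have hD2 : D < D + 1 + 1 := by omega
  rw [BExpr.bestExpr, BExpr.holds_and, BExpr.holds_not, BExpr.holds_ex n hρ]
  simp only [BExpr.holds_and, BExpr.holds_lt, BExpr.depthExpr, BExpr.eval_count n (hρ' _),
    BExpr.holds_unary (show 9 ≠ scratch by decide), BExpr.holds_cell (show 8 ≠ scratch by decide),
    BExpr.eval_var hx, BExpr.eval_var hx2, BExpr.eval_var (Nat.lt_succ_self D),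
    BExpr.eval_var hD2, BExpr.eval_var (Nat.lt_succ_self (D + 1)), bind_self, bind_of_ne _ _ hxD,
    bind_of_ne _ _ hxD1, bind_of_ne _ _ hD1, hi, h8, h9, hr.ncard_anc]
  push Not
  simp only [Nat.add_le_add_iff_right]

/-- The round number `k` stands in for the iteration count. They agree while the algorithm runs;
after it has stopped the count stays behind, but then the state no longer changes. -/
theorem iterationProg_spec {par : Fin n → Fin n} {dep : Fin n → ℕ} {o : Fin n}
    {σ : LoopState (Fin n) (Fin n)} (h : LoopRep c G X par σ)
    (hr : Rooted (parentTree o par) o par dep) (hρ : ρ 0 = n) {t k : ℕ} (ht : ρ 1 = t)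
    (hk : ρ 2 = k) (hcount : σ.count ≤ k)
    (hσ : σ.count = k ∨ ¬ Guard G t X σ) :
    (∃ σ', Step G t X (parentTree o par) o σ σ' ∧
      LoopRep (iterationProg.sem 3 ρ c) G X par σ' ∧ σ'.count = k + 1) ∨
    (¬ Guard G t X σ ∧ LoopRep (iterationProg.sem 3 ρ c) G X par σ) := by
  obtain ⟨hcand, hf⟩ := candidateProg_spec h hr hρ
  have hrep := h.congr hf
  -- The root is a candidate whenever any node is, so searching for candidates also tests the loop
  -- condition.
  have hguard : 2 < treewidth (G.induce (bagUnion σ.bag Set.univ ∪ X)) ↔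
      ∃ r, IsCandidate G X (parentTree o par) o σ r := by
    rw [two_lt_treewidth_induce_iff]
    constructor
    · intro hg
      refine ⟨o, (isCandidate_iff hr).2 fun hc => hg (hc.subset ?_)⟩
      rintro x (hx | hx)
      · obtain ⟨s, _, hs⟩ := mem_bagUnion.1 hx
        exact Or.inr ⟨s, hr.anc_root s, hs⟩
      · exact Or.inl hx
    · rintro ⟨r, hr'⟩ hc
      refine (isCandidate_iff hr).1 hr' (hc.subset ?_)
      rintro x (hx | ⟨y, _, hy⟩)
      · exact Or.inr hx
      · exact Or.inl (mem_bagUnion.2 ⟨y, trivial, hy⟩)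
  simp only [iterationProg, BProg.sem.eq_3, BProg.sem.eq_4]
  set c0 := candidateProg.sem 3 ρ c with hc0
  have hcond : (BExpr.and (.not (.lt (.var 1) (.var 2))) (.ex (.unary 9 (.var 3)))).eval 3 ρ c0 ≠ 0
      ↔ k ≤ t ∧ ∃ r, IsCandidate G X (parentTree o par) o σ r := by
    change BExpr.Holds _ _ _ _ ↔ _
    rw [BExpr.holds_and, BExpr.holds_not, BExpr.holds_lt, BExpr.holds_ex n hρ, not_lt]
    simp only [BExpr.holds_unary (show 9 ≠ scratch by decide)]
    rw [BExpr.eval_var (by decide), BExpr.eval_var (by decide), ht, hk]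
    exact and_congr Iff.rfl (exists_congr fun r => hcand r)
  by_cases hg : Guard G t X σ
  · have hck := hσ.resolve_right (not_not.2 hg)
    have hex := hguard.1 hg.1
    rw [if_pos (hcond.2 ⟨by have := hg.2; omega, hex⟩)]
    left
    set c1 := BProg.sem (.upd 5 _) 3 ρ c0 with hc1
    set c2 := BProg.sem (.upd 2 _) 3 ρ c1 with hc2
    set c3 := BProg.sem (.upd 7 _) 3 ρ c2 with hc3
    have f1 : ∀ b, b ≠ 5 → b ≠ scratch → c1 b = c0 b := fun b => BProg.sem_upd_of_ne
    have f2 : ∀ b, b ≠ 2 → b ≠ scratch → c2 b = c1 b := fun b => BProg.sem_upd_of_ne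
    have f3 : ∀ b, b ≠ 7 → b ≠ scratch → c3 b = c2 b := fun b => BProg.sem_upd_of_ne
    have hρ2 : ∀ i j, bind (bind ρ 3 i) (3 + 1) j 0 = n := fun _ _ => hρ
    let E : Fin n → Prop := fun i => IsCandidate G X (parentTree o par) o σ i ∧
      ∀ r, IsCandidate G X (parentTree o par) o σ r → dep r ≤ dep i
    have s5 : ∀ i : Fin n, c1 5 i 0 ≠ 0 ↔ E i ∧ ¬ ∃ y : Fin n, (y : ℕ) < i ∧ E y := by
      intro i
      rw [hc1, BProg.sem_upd_unary hρ, BExpr.holds_and, BExpr.holds_not,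
        BExpr.holds_ex n (hρ2 _ _), holds_bestExpr hr hrep.anc hcand (D := 5) (x := 3)
          (by decide) (by decide) (hρ2 i 0) rfl]
      refine and_congr Iff.rfl (not_congr (exists_congr fun y => ?_))
      rw [BExpr.holds_and, BExpr.holds_lt, BExpr.eval_var (by decide), BExpr.eval_var (by decide)]
      exact and_congr Iff.rfl
        (holds_bestExpr hr hrep.anc hcand (D := 6) (x := 5)
          (ρ := bind (bind (bind ρ 3 i) (3 + 1) 0) (3 + 2) y) (by decide) (by decide) hρ rfl)
    have hE : ∃ v, E v := by
      obtain ⟨r, h1, h2⟩ := Set.exists_max_image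
        {r | IsCandidate G X (parentTree o par) o σ r} dep (Set.toFinite _) hex
      exact ⟨r, h1, h2⟩
    -- Ties between deepest candidates are broken by the least index.
    obtain ⟨r, hrE, hmin⟩ := Set.exists_min_image {v | E v} (fun v : Fin n => (v : ℕ))
      (Set.toFinite _) hE
    have hsel : ∀ i : Fin n, c1 5 i 0 ≠ 0 ↔ i = r := by
      intro i
      rw [s5]
      constructor
      · rintro ⟨hi, hlt⟩
        exact Fin.ext (le_antisymm (not_lt.1 fun hc => hlt ⟨r, hc, hrE⟩) (hmin i hi))
      · rintro rfl
        exact ⟨hrE, fun ⟨y, hy, hyE⟩ => absurd (hmin y hyE) (not_le.2 hy)⟩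
    refine ⟨_, ⟨hg, r, hrE.1, fun r' hr' => ?_, rfl⟩, ⟨?_, ?_, ?_, ?_⟩, by rw [hck]⟩
    · rw [hr.dist_eq hr.isTree, hr.dist_eq hr.isTree]
      exact hrE.2 r' hr'
    · refine hrep.input.congr ?_ ?_ <;>
        rw [f3 _ (by decide) (by decide), f2 _ (by decide) (by decide),
          f1 _ (by decide) (by decide)]
    · intro i j
      rw [f3 _ (by decide) (by decide), f2 _ (by decide) (by decide), f1 _ (by decide) (by decide)]
      exact hrep.anc i j
    · intro i j
      rw [hc3, BProg.sem_upd_self hρ, BExpr.holds_and, BExpr.holds_not,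
        BExpr.holds_ex n (hρ2 _ _)]
      have hin : ∀ ρ' : ℕ → ℕ, ρ' 0 = n → ∀ e : BExpr, e.ex.Holds 6 ρ' c2 ↔
          ∃ y : Fin n, e.Holds 7 (bind ρ' 6 y) c2 := fun ρ' h' e => BExpr.holds_ex n h'
      have hex' : ∀ y : Fin n, ((BExpr.unary 5 (.var 5)).and
          (((BExpr.cell 8 (.var 6) (.var 5)).and (.cell 7 (.var 6) (.var 4))).ex)).Holds (3 + 2 + 1)
          (bind (bind (bind ρ 3 i) (3 + 1) j) (3 + 2) y) c2 ↔
          y = r ∧ ∃ z : Fin n, Rooted.Anc par z y ∧ j ∈ σ.bag z := by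
        intro y
        rw [BExpr.holds_and, hin (bind (bind (bind ρ 3 i) (3 + 1) j) (3 + 2) y) hρ,
          BExpr.holds_unary (by decide),
          f2 5 (by decide) (by decide)]
        refine and_congr (hsel y) (exists_congr fun z => ?_)
        rw [BExpr.holds_and, BExpr.holds_cell (by decide), BExpr.holds_cell (by decide),
          f2 7 (by decide) (by decide), f2 8 (by decide) (by decide), f1 7 (by decide) (by decide),
          f1 8 (by decide) (by decide), ← hrep.anc, ← hrep.bag]
        rfl
      simp only [hex', exists_eq_left]
      rw [BExpr.holds_cell (by decide), f2 7 (by decide) (by decide), f1 7 (by decide) (by decide)]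
      change (c0 7 i j ≠ 0 ∧ _) ↔ _
      rw [hrep.bag]
      simp only [Set.mem_sdiff, mem_bagUnion, hr.mem_subtree hr.isTree]
    · intro i
      rw [f3 2 (by decide) (by decide), hc2, BProg.sem_upd_unary hρ, BExpr.holds_or,
        BExpr.holds_ex n (hρ2 _ _)]
      simp only [BExpr.holds_and, BExpr.holds_cell (show 7 ≠ scratch by decide),
        BExpr.holds_unary (show 5 ≠ scratch by decide),
        BExpr.holds_unary (show 2 ≠ scratch by decide), f1 7 (by decide) (by decide),
        f1 2 (by decide) (by decide)]
      change (c0 2 i 0 ≠ 0 ∨ ∃ y : Fin n, c1 5 y 0 ≠ 0 ∧ c0 7 y i ≠ 0) ↔ _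
      simp only [hsel, exists_eq_left, hrep.bag, hrep.out]
      rfl
  · right
    refine ⟨hg, ?_⟩
    rw [if_neg]
    · exact hrep
    · rw [hcond]
      rintro ⟨hkt, hex⟩
      exact hg ⟨hguard.2 hex, by omega⟩

/-- A candidate has some vertex in the bags below it, since `G[X]` alone is reducible; so each
iteration removes at least one vertex. -/
theorem Reachable.count_add_ncard_le {V ι : Type*} [Finite V] {G : SimpleGraph V} {X : Set V}
    {T : SimpleGraph ι} {ρ : ι} {t : ℕ} {χ : ι → Set ↥Xᶜ} {σ : LoopState V ι}
    (hX : Reducible G X) (h : Reachable G t X T ρ χ σ) :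
    σ.count + σ.verts.ncard ≤ Xᶜ.ncard := by
  induction h with
  | refl =>
    simp only [initState, zero_add]
    refine Set.ncard_le_ncard ?_ (Set.toFinite _)
    intro v hv
    obtain ⟨s, u, _, rfl⟩ := LoopState.mem_verts.1 hv
    exact u.2
  | @tail σ σ' _ hstep ih =>
    obtain ⟨_, r, hcand, _, rfl⟩ := hstep
    have hne : (bagUnion σ.bag (subtree T ρ r)).Nonempty := by
      by_contra hc
      rw [Set.not_nonempty_iff_eq_empty] at hc
      rw [IsCandidate, two_lt_treewidth_induce_iff, hc, Set.empty_union] at hcand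
      exact hcand hX
    obtain ⟨v, hv⟩ := hne
    refine le_trans ?_ ih
    have hlt : LoopState.verts (V := V) (ι := ι) ⟨σ.count + 1,
        fun s => σ.bag s \ bagUnion σ.bag (subtree T ρ r), σ.out ∪ σ.bag r⟩ ⊂ σ.verts := by
      refine ⟨fun u hu => ?_, fun hc => ?_⟩
      · obtain ⟨s, hs⟩ := LoopState.mem_verts.1 hu
        exact LoopState.mem_verts.2 ⟨s, hs.1⟩
      · obtain ⟨s, hs⟩ := LoopState.mem_verts.1 (hc (LoopState.bagUnion_subset_verts hv))
        exact hs.2 hv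
    have := Set.ncard_lt_ncard hlt (Set.toFinite _)
    dsimp only at this ⊢
    omega

theorem mainProg_spec {t : ℕ} (hX : IsInput G X) (hρ : ρ 0 = n) (ht : ρ 1 = t) :
    ∃ (T : SimpleGraph (Fin n)) (o : Fin n) (χ : Fin n → Set ↥Xᶜ),
      IsTreeDecomposition (G.induce Xᶜ) T χ ∧ width χ ≤ 2 ∧
      Returns G t X T o χ {v | mainProg.sem 2 ρ (inputMemory G t X).cell 2 v 0 ≠ 0} := by
  have hXne : X.Nonempty := Set.encard_pos.1 hX.pos
  -- The least vertex of `X` serves as the root; its bag is empty as it is not in `G - X`.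
  obtain ⟨o, ho, hmin⟩ := Set.exists_min_image X id (Set.toFinite _) hXne
  have hoX : o ∉ Xᶜ := not_not.2 ho
  simp only [mainProg, BProg.sem.eq_3, BProg.sem.eq_5, hρ]
  set c0 := (inputMemory G t X).cell with hc0
  have hin : InputRep c0 G X := inputRep_inputMemory t
  obtain ⟨⟨H, B, hrun, h7⟩, f1⟩ := decompositionProg_spec (ρ := ρ) hin
    (inputMemory_cell_eq_zero (by decide) (by decide))
    (treewidth_induce_le_two_iff_reducible.1 hX.modulator) hρ
  set c1 := decompositionProg.sem 2 ρ c0 with hc1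
  have hz : ∀ b, b ≠ 0 → b ≠ 1 → b ≠ 3 → b ≠ 4 → b ≠ 5 → b ≠ 6 → b ≠ 7 → b ≠ scratch →
      ∀ i j, c1 b i j = 0 := fun b h0 h1 h3 h4 h5 h6 h7 hs i j => by
    rw [f1 b h3 h4 h5 h6 h7 hs]
    exact inputMemory_cell_eq_zero h0 h1 i j
  have hin1 : InputRep c1 G X := hin.congr
    (f1 0 (by decide) (by decide) (by decide) (by decide) (by decide) (by decide))
    (f1 1 (by decide) (by decide) (by decide) (by decide) (by decide) (by decide))
  obtain ⟨rk, K, hinv⟩ := hrun.exists_invariant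
  obtain ⟨par, dep, hr, hpar, htd⟩ := hinv.exists_isTreeDecompositionOn hoX
  obtain ⟨h8, f2⟩ := ancestorProg_spec (ρ := ρ) hin1.modulator h7
    (hz 8 (by decide) (by decide) (by decide) (by decide) (by decide) (by decide) (by decide)
      (by decide)) ho hmin hr hpar hρ
  set c2 := ancestorProg.sem 2 ρ c1 with hc2
  have htd' : IsTreeDecompositionOn (G.induce Xᶜ) Set.univ (parentTree o par)
      (fun s => Subtype.val ⁻¹' B s) := by
    have := htd.comap (G := G.induce Xᶜ) (A := Set.univ) Subtype.val (fun v _ => v.2)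
      Subtype.val_injective.injOn (fun _ _ _ _ h => h)
    simpa only [Set.univ_inter] using this
  refine ⟨parentTree o par, o, fun s => Subtype.val ⁻¹' B s, htd'.isTreeDecomposition.1,
    htd'.isTreeDecomposition.2, ?_⟩
  have hrep : LoopRep c2 G X par (initState (X := X) fun s => Subtype.val ⁻¹' B s) := by
    refine ⟨hin1.congr (f2 0 (by decide) (by decide)) (f2 1 (by decide) (by decide)), h8,
      fun i j => ?_, fun i => ?_⟩
    · rw [f2 7 (by decide) (by decide), h7]
      simp only [initState, Subtype.image_preimage_coe]
      exact ⟨fun h => ⟨hinv.bag_sub i h, h⟩, fun h => h.2⟩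
    · rw [f2 2 (by decide) (by decide), hz 2 (by decide) (by decide) (by decide) (by decide)
        (by decide) (by decide) (by decide) (by decide)]
      simp [initState]
  obtain ⟨σ, hreach, hrepσ, hcount, hσ⟩ := iterFrom_induction (n := n) (c := c2)
    (F := fun i c => iterationProg.sem (2 + 1) (bind ρ 2 i) c)
    (fun m (c' : Cells) => ∃ σ, Reachable G t X (parentTree o par) o
      (fun s => (Subtype.val ⁻¹' B s : Set ↥Xᶜ)) σ ∧ LoopRep c' G X par σ ∧ σ.count ≤ m ∧
      (σ.count = m ∨ ¬ Guard G t X σ))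
    ⟨_, Relation.ReflTransGen.refl, hrep, le_rfl, Or.inl rfl⟩ (by
      rintro m _ c' ⟨σ, hreach, hrepσ, hcount, hσ⟩
      rcases iterationProg_spec hrepσ hr (ρ := bind ρ 2 m) hρ ht rfl hcount hσ with
        ⟨σ', hstep, hrep', hc'⟩ | ⟨hg, hrep'⟩
      · exact ⟨σ', hreach.tail hstep, hrep', hc'.le, Or.inl hc'⟩
      · exact ⟨σ, hreach, hrep', hcount.trans (Nat.le_succ m), Or.inr hg⟩)
  refine ⟨σ, hreach, ?_, ?_⟩
  -- The count is at most the number of vertices outside the nonempty set `X`, hence below `n`, so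
  -- the guard failed within the `n` rounds.
  · refine hσ.elim (fun hc hg => ?_) id
    have h1 := hreach.count_add_ncard_le (Reducible.of_encard_le_three hX.le_three)
    have h2 := Set.ncard_add_ncard_compl X
    have h3 := (Set.ncard_pos (Set.toFinite X)).2 hXne
    rw [Nat.card_eq_fintype_card, Fintype.card_fin] at h2
    omega
  · ext v
    exact (hrepσ.out v).symm

/-- The program of the machine. -/
def machineProg : Prog := .seq (.setReg 2 (.reg 1)) (mainProg.compile 2)

theorem exists_polynomial_machineProg : ∃ p : Polynomial ℕ,
    ∀ (n : ℕ) (G : SimpleGraph (Fin n)) (t : ℕ) (X : Set (Fin n)), IsInput G X →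
      ∃ (k : ℕ) (μ : Memory), Runs machineProg (inputMemory G t X) k μ ∧ k ≤ p.eval n ∧
        ∃ (m : ℕ) (T : SimpleGraph (Fin m)) (ρ : Fin m) (χ : Fin m → Set ↥Xᶜ),
          IsTreeDecomposition (G.induce Xᶜ) T χ ∧ width χ ≤ 2 ∧
          Returns G t X T ρ χ (outputSet n μ) := by
  obtain ⟨p, hp⟩ := mainProg.transforms_compile (d := 2) (by decide)
  refine ⟨p + Polynomial.C 3, fun n G t X hX => ?_⟩
  -- Register `1` is a slot for intermediate results, so `t` is first moved to register `2`, the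
  -- place of variable `1`.
  set μ := (inputMemory G t X).setReg 2 ((Expr.reg 1).eval (inputMemory G t X)) with hμ
  have h0 : μ.reg 0 = n := by simp [hμ, Memory.setReg, inputMemory]
  have h1 : μ.reg 2 = t := by simp [hμ, Memory.setReg, inputMemory, Expr.eval]
  obtain ⟨k, hk, μ', hrun, hcell, _⟩ := hp μ
  rw [h0] at hk
  refine ⟨_, μ', (Runs.setReg 2 (.reg 1) _).seq hrun, ?_, ?_⟩
  · simp only [Polynomial.eval_add, Polynomial.eval_C, Expr.cost]
    omega
  · obtain ⟨T, o, χ, h2, h3, h4⟩ := mainProg_spec (ρ := μ.env) hX h0 h1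
    refine ⟨n, T, o, χ, h2, h3, ?_⟩
    have : outputSet n μ' =
        {v : Fin n | mainProg.sem 2 μ.env (inputMemory G t X).cell 2 v 0 ≠ 0} := by
      simp only [outputSet, hcell]
      rfl
    rw [this]
    exact h4

end Program

end TW2

/-- First part: for every input and every choice of a width-2 tree decomposition of `G - X` and of
its root, no run of the algorithm gets stuck (each makes at most `t + 1` iterations, by the
condition of the loop), and every set `Y` that a run returns is as claimed.
Second part: one program runs the algorithm, with suitable choices, in polynomial time. -/
theorem mainTheorem3 :
    (∀ {V ι : Type*} [Finite V] [Finite ι] (G : SimpleGraph V) (t : ℕ) (X : Set V)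
        (T : SimpleGraph ι) (ρ : ι) (χ : ι → Set ↥Xᶜ),
        TW2.IsInput G X →
        TW2.IsTreeDecomposition (G.induce Xᶜ) T χ → TW2.width χ ≤ 2 →
        (∀ σ : TW2.LoopState V ι, TW2.Reachable G t X T ρ χ σ → TW2.Guard G t X σ →
          ∃ σ' : TW2.LoopState V ι, TW2.Step G t X T ρ σ σ') ∧
        ∀ Y : Set V, TW2.Returns G t X T ρ χ Y →
          Y ⊆ Xᶜ ∧ Y.encard ≤ 3 * t + 3 ∧
          (TW2.treewidth (G.induce Yᶜ) ≤ 2 ∨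
            ∀ C : (G.induce (X ∪ Y)ᶜ).ConnectedComponent,
              TW2.IsLimitClique (G.induce (TW2.componentVerts C)ᶜ) t (X.ncard - 1)
                (Subtype.val ⁻¹' X))) ∧
    ∃ (prog : TW2.Prog) (p : Polynomial ℕ),
      ∀ (n : ℕ) (G : SimpleGraph (Fin n)) (t : ℕ) (X : Set (Fin n)),
        TW2.IsInput G X →
        ∃ (k : ℕ) (μ : TW2.Memory),
          TW2.Runs prog (TW2.inputMemory G t X) k μ ∧ k ≤ p.eval n ∧
          ∃ (m : ℕ) (T : SimpleGraph (Fin m)) (ρ : Fin m) (χ : Fin m → Set ↥Xᶜ),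
            TW2.IsTreeDecomposition (G.induce Xᶜ) T χ ∧ TW2.width χ ≤ 2 ∧
            TW2.Returns G t X T ρ χ (TW2.outputSet n μ) := by
  exact ⟨fun G t X T ρ χ hX hχ hw => TW2.find_disjoint_modulator_correct G t X T ρ χ hX hχ hw,
    TW2.machineProg, TW2.exists_polynomial_machineProg⟩
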